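/- Let $n,N\ge 0$ be integers and identify $T^*\mathbb R^n$ with $\mathbb C^n$ by $(x,p)\mapsto z=p+ix$. *Pseudodifferential operators.* A smooth function $d$ on $T^*\mathbb R^n$ is a (Shubin) symbol of order $m\in\mathbb R$ if $|\partial_p^\alpha\partial_x^\beta d(x,p)|\le c_{\alpha,\beta}(1+|x|+|p|)^{m-|\alpha|-|\beta|}$ for all $\alpha,\beta$; it is classical if it has an asymptotic expansion $d\sim\sum_{j\ge 0}d_{m-j}$ with $d_{m-j}$ a symbol of order $m-j$ that is positively homogeneous of degree $m-j$ in $(x,p)$ for $|(x,p)|\ge 1$. Let $\Psi(\mathbb R^n)\subset\mathcal B(L^2(\mathbb R^n))$ be the $C^*$-algebra obtained as the norm closure of the algebra of pseudodifferential operators (Weyl quantizations) with classical symbols of order zero, and let $\sigma:\Psi(\mathbb R^n)\to C(\mathbb S^{2n-1})$ be the symbol homomorphism, i.e. the continuous extension of the map that sends an operator with symbol $d\sim\sum_j d_{-j}$ to $d_0|_{\mathbb S^{2n-1}}$. *Group action.* For $g\in U(n)$ let $R_g$ be the unitary operator on $L^2(\mathbb R^n)$ determined by $R_gW(z)R_g^{-1}=W(gz)$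 for all $z\in\mathbb C^n$ and $R_g\varphi_0=\varphi_0$, where $W(p+ix)f(y)=e^{ip\cdot y-ip\cdot x/2}f(y-x)$ and $\varphi_0(y)=e^{-|y|^2/2}$. (Equivalently, for $g=\exp(B+iA)$ with $A$ real symmetric and $B$ real skew-symmetric, $R_g=e^{-i\widehat H}e^{i\operatorname{tr}A/2}$, where $\widehat H$ is the Weyl quantization of the quadratic Hamiltonian $H$ whose flow at time $1$ is $g$.) The map $g\mapsto R_g$ is a unitary representation of $U(n)$. The group $U(n)$ acts on $\Psi(\mathbb R^n)$ by $D\mapsto R_gDR_g^{-1}$ and on $C(\mathbb S^{2n-1})$ by $f\mapsto (g^{-1})^*f$, and $\sigma$ is equivariant. *Crossed products.* Let $G\subset U(n)$ be a subgroup, regarded as a discrete group. Let $\Psi(\mathbb R^n)\rtimes G$ and $C(\mathbb S^{2n-1})\rtimes G$ be the maximal crossed products, $C^*(G)$ the maximal group $C^*$-algebra, mapped canonically to both of them, and $\sigma:\Psi(\mathbb R^n)\rtimes G\to C(\mathbb S^{2n-1})\rtimes G$, $\{D_g\}\mapsto\{\sigma(D_g)\}$, the induced symbol homomorphism. The natural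 representation $\Psi(\mathbb R^n)\rtimes G\to\mathcal B(L^2(\mathbb R^n))$, $\{D_g\}\mapsto\sum_g D_gR_g$, makes $N\times N$ matrices over $\Psi(\mathbb R^n)\rtimes G$ and over $C^*(G)$ act on $L^2(\mathbb R^n,\mathbb C^N)$. *Triples and ellipticity.* Let $(D,P_1,P_2)$ be a triple in which $D\in\operatorname{Mat}_N(\Psi(\mathbb R^n)\rtimes G)$, $P_1,P_2\in\operatorname{Mat}_N(C^*(G))$ are projections ($P_j=P_j^*=P_j^2$), and $D=P_2DP_1$. The triple is called elliptic if there is $r\in\operatorname{Mat}_N(C(\mathbb S^{2n-1})\rtimes G)$ with $$P_1\,r\,\sigma(D)=P_1,\qquad \sigma(D)\,r\,P_2=P_2 .$$ **Lemma.** If the triple $(D,P_1,P_2)$ is elliptic, then the operator $$D:\operatorname{Im}P_1\longrightarrow\operatorname{Im}P_2,\qquad \operatorname{Im}P_1,\operatorname{Im}P_2\subset L^2(\mathbb R^n,\mathbb C^N),$$ is Fredholm. -/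

import Mathlib

open MeasureTheory Complex
open scoped Real InnerProductSpace ContDiff ENNReal

noncomputable section

namespace GOperators

/-- The configuration space `ℝⁿ`. -/
abbrev Config (n : ℕ) : Type := EuclideanSpace ℝ (Fin n)

/-- The phase space `T*ℝⁿ`, identified with `ℂⁿ` by `(x, p) ↦ z = p + i x`.  Thus the momentum
is `p = Re z` and the position is `x = Im z`; Lebesgue measure `volume` is `dx dp`. -/
abbrev Phase (n : ℕ) : Type := EuclideanSpace ℂ (Fin n)

/-- The Hilbert space `L²(ℝⁿ)`. -/
abbrev L2 (n : ℕ) : Type := Lp ℂ 2 (volume : Measure (Config n))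

/-- The position component `x = Im z` of the phase space point `z = p + i x`. -/
def pos {n : ℕ} (z : Phase n) : Config n := WithLp.toLp 2 fun i => (z i).im

/-- The unitary group `U(n)`. -/
abbrev U (n : ℕ) : Type := Matrix.unitaryGroup (Fin n) ℂ

/-- The natural action of `U(n)` on phase space `ℂⁿ`, by complex linear isometries. -/
def act (n : ℕ) : U n →* (Phase n ≃ₗᵢ[ℂ] Phase n) :=
  (Unitary.linearIsometryEquiv (𝕜 := ℂ) (H := Phase n)).toMonoidHom.comp
    (Unitary.map
      { toFun := Matrix.toEuclideanCLM (n := Fin n) (𝕜 := ℂ)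
        map_one' := map_one _
        map_mul' := map_mul _
        map_star' := map_star _ }).toMonoidHom

theorem act_apply {n : ℕ} (g : U n) (z : Phase n) :
    act n g z = WithLp.toLp 2 ((g : Matrix (Fin n) (Fin n) ℂ).mulVec z.ofLp) := by
  rfl

/-- The Gaussian coherent state `φ_z = W(z) φ_0` (not normalised) centred at `z = p + i x`, where
`φ_0(y) = exp(-|y|²/2)` and `W(z) f (y) = exp(i p·y - i p·x/2) f(y - x)`. -/
def coherentFun {n : ℕ} (z : Phase n) (y : Config n) : ℂ :=
  cexp (∑ j, (I * (z j).re * y j - I / 2 * (z j).re * (z j).im - ((y j - (z j).im : ℝ) : ℂ) ^ 2 / 2))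

theorem continuous_coherentFun {n : ℕ} (z : Phase n) : Continuous (coherentFun z) := by
  unfold coherentFun
  fun_prop

theorem norm_coherentFun {n : ℕ} (z : Phase n) (y : Config n) :
    ‖coherentFun z y‖ = rexp (-(1 / 2) * ‖y - pos z‖ ^ 2) := by
  rw [coherentFun, Complex.norm_exp, EuclideanSpace.norm_sq_eq, Finset.mul_sum, Complex.re_sum]
  congr 1
  refine Finset.sum_congr rfl fun j _ => ?_
  have h : (((y j - (z j).im : ℝ) : ℂ) ^ 2 / 2).re = (y j - (z j).im) ^ 2 / 2 := by
    rw [← ofReal_pow, ← ofReal_ofNat, ← ofReal_div, ofReal_re]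
  have h2 : (I / 2 * ((z j).re : ℂ) * ((z j).im : ℂ)).re = 0 := by
    have : I / 2 * ((z j).re : ℂ) * ((z j).im : ℂ) = (((z j).re * (z j).im / 2 : ℝ) : ℂ) * I := by
      push_cast; ring
    rw [this]; simp
  rw [sub_re, sub_re, h, h2]
  simp [pos]
  ring

theorem memLp_coherentFun {n : ℕ} (z : Phase n) :
    MemLp (coherentFun z) 2 (volume : Measure (Config n)) := by
  rw [memLp_two_iff_integrable_sq_norm (continuous_coherentFun z).aestronglyMeasurable]
  have h := (GaussianFourier.integrable_cexp_neg_mul_sq_norm_add (V := Config n) (b := 1)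
    (by simp) 0 0).norm.comp_sub_right (pos z)
  refine h.congr (Filter.Eventually.of_forall fun y => ?_)
  simp only [norm_coherentFun, Complex.norm_exp]
  rw [← Real.exp_nat_mul]
  congr 1
  simp only [neg_mul, one_mul, zero_mul, add_zero, neg_re]
  rw [← ofReal_pow, ofReal_re]
  push_cast
  ring

/-- The coherent state `φ_z` as an element of `L²(ℝⁿ)`. -/
def coherent {n : ℕ} (z : Phase n) : L2 n := (memLp_coherentFun z).toLp _

theorem coherent_ae {n : ℕ} (z : Phase n) : coherent z =ᵐ[volume] coherentFun z :=
  (memLp_coherentFun z).coeFn_toLp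

theorem inner_coherent {n : ℕ} (z w : Phase n) :
    ⟪coherent z, coherent w⟫_ℂ =
      (π : ℂ) ^ ((n : ℂ) / 2) * cexp (-(‖z‖ ^ 2 + ‖w‖ ^ 2) / 4 + ⟪w, z⟫_ℂ / 2) := by
  rw [L2.inner_def]
  have h1 : ∫ y, ⟪coherent z y, coherent w y⟫_ℂ ∂(volume : Measure (Config n)) =
      ∫ y : Config n, cexp (-1 * ∑ j, (y j : ℂ) ^ 2 +
        ∑ j, ((z j).im + (w j).im + I * ((w j).re - (z j).re)) * y j) *
        cexp (∑ j, (I / 2 * ((z j).re * (z j).im - (w j).re * (w j).im) -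
          ((z j).im ^ 2 + (w j).im ^ 2) / 2)) := by
    refine integral_congr_ae ?_
    filter_upwards [coherent_ae z, coherent_ae w] with y hz hw
    rw [hz, hw, RCLike.inner_apply, coherentFun, coherentFun, ← Complex.exp_conj, ← Complex.exp_add,
      ← Complex.exp_add]
    congr 1
    rw [map_sum, Finset.mul_sum, ← Finset.sum_add_distrib, ← Finset.sum_add_distrib,
      ← Finset.sum_add_distrib]
    refine Finset.sum_congr rfl fun j _ => ?_
    simp only [map_sub, map_mul, map_div₀, map_pow, conj_I, conj_ofReal, map_ofNat]
    push_cast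
    ring
  rw [h1, integral_mul_const, ← (PiLp.volume_preserving_toLp (Fin n)).integral_comp
    (MeasurableEquiv.toLp 2 _).measurableEmbedding]
  have h2 := GaussianFourier.integral_cexp_neg_mul_sum_add (ι := Fin n) (b := 1) (by simp)
    (fun j => ((z j).im + (w j).im + I * ((w j).re - (z j).re) : ℂ))
  simp only at h2 ⊢
  rw [h2, mul_assoc, ← Complex.exp_add]
  simp only [Fintype.card_fin, div_one]
  congr 2
  rw [Finset.sum_div, ← Finset.sum_add_distrib]
  have hz : ((‖z‖ : ℂ)) ^ 2 = ∑ j, (((z j).re : ℂ) ^ 2 + ((z j).im : ℂ) ^ 2) := by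
    rw [← ofReal_pow, EuclideanSpace.norm_sq_eq]
    push_cast
    refine Finset.sum_congr rfl fun j _ => ?_
    rw [← ofReal_pow, Complex.sq_norm, normSq_apply]; push_cast; ring
  have hw : ((‖w‖ : ℂ)) ^ 2 = ∑ j, (((w j).re : ℂ) ^ 2 + ((w j).im : ℂ) ^ 2) := by
    rw [← ofReal_pow, EuclideanSpace.norm_sq_eq]
    push_cast
    refine Finset.sum_congr rfl fun j _ => ?_
    rw [← ofReal_pow, Complex.sq_norm, normSq_apply]; push_cast; ring
  have hi : ⟪w, z⟫_ℂ = ∑ j, ((w j).re * (z j).re + (w j).im * (z j).im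
      + I * ((w j).re * (z j).im - (w j).im * (z j).re) : ℂ) := by
    rw [PiLp.inner_apply]
    refine Finset.sum_congr rfl fun j _ => ?_
    rw [RCLike.inner_apply]
    apply Complex.ext <;> simp <;> ring
  rw [hz, hw, hi, ← Finset.sum_add_distrib, neg_div, Finset.sum_div, Finset.sum_div,
    ← Finset.sum_neg_distrib, ← Finset.sum_add_distrib]
  refine Finset.sum_congr rfl fun j _ => ?_
  have : I ^ 2 = -1 := I_sq
  linear_combination (((w j).re - (z j).re : ℂ) ^ 2 / 4) * this

theorem inner_coherent_act {n : ℕ} (g : U n) (z w : Phase n) :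
    ⟪coherent (act n g z), coherent (act n g w)⟫_ℂ = ⟪coherent z, coherent w⟫_ℂ := by
  rw [inner_coherent, inner_coherent, LinearIsometryEquiv.norm_map, LinearIsometryEquiv.norm_map,
    LinearIsometryEquiv.inner_map_map]

theorem eq_zero_of_inner_coherent {n : ℕ} (f : L2 n) (hf : ∀ z, ⟪coherent z, f⟫_ℂ = 0) :
    f = 0 := by
  set G : Config n → ℂ := fun y => (starRingEnd ℂ) (coherentFun (0 : Phase n) y) * f y with hG
  have hGi : Integrable G := by
    have h := L2.integrable_inner (𝕜 := ℂ) (coherent (0 : Phase n)) f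
    refine h.congr ?_
    filter_upwards [coherent_ae (0 : Phase n)] with y hy
    rw [hy, RCLike.inner_apply, hG, mul_comm]
  have hF : ∀ w : Config n, FourierTransform.fourier G w = 0 := by
    intro w
    have h := hf (WithLp.toLp 2 fun j => ((2 * π * w j : ℝ) : ℂ))
    rw [L2.inner_def] at h
    rw [Real.fourier_eq', ← h]
    refine integral_congr_ae ?_
    filter_upwards [coherent_ae (n := n) (WithLp.toLp 2 fun j => ((2 * π * w j : ℝ) : ℂ))] with y hy
    rw [hy, RCLike.inner_apply, smul_eq_mul, hG]
    simp only [coherentFun]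
    rw [← Complex.exp_conj, ← Complex.exp_conj, ← mul_assoc, ← Complex.exp_add, mul_comm (f y)]
    congr 2
    rw [map_sum, map_sum, PiLp.inner_apply]
    rw [Finset.mul_sum, ofReal_sum, Finset.sum_mul, ← Finset.sum_add_distrib]
    refine Finset.sum_congr rfl fun j _ => ?_
    simp only [RCLike.inner_apply, ofReal_im, PiLp.zero_apply, zero_im, zero_re, ofReal_zero,
      mul_zero, sub_zero, zero_mul, zero_sub, map_sub, map_neg, map_mul, map_div₀, map_pow, conj_I,
      conj_ofReal, map_ofNat, ofReal_re, conj_trivial]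
    push_cast
    ring
  have hG0 : ∀ᵐ y ∂(volume : Measure (Config n)), G y = 0 := by
    refine ae_eq_zero_of_integral_contDiff_smul_eq_zero hGi.locallyIntegrable fun g hg hgc => ?_
    let gs : SchwartzMap (Config n) ℂ :=
      (hgc.comp_left (g := fun t : ℝ => (t : ℂ)) (by simp)).toSchwartzMap
        (ofRealCLM.contDiff.comp hg)
    obtain ⟨η, hη⟩ : ∃ η : SchwartzMap (Config n) ℂ, FourierTransform.fourier η = gs :=
      ⟨FourierTransformInv.fourierInv gs, FourierTransform.fourier_fourierInv_eq gs⟩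
    have key := VectorFourier.integral_fourierIntegral_smul_eq_flip (e := Real.fourierChar)
      (L := innerₗ (Config n)) (μ := volume) (ν := volume) (f := (η : Config n → ℂ)) (g := G)
      Real.continuous_fourierChar continuous_inner η.integrable hGi
    have h1 : ∀ ξ, VectorFourier.fourierIntegral Real.fourierChar volume (innerₗ (Config n))
        (η : Config n → ℂ) ξ = (g ξ : ℂ) := by
      intro ξ
      have := congrArg (fun s : SchwartzMap (Config n) ℂ => s ξ) hη
      exact this
    have h2 : ∀ x, VectorFourier.fourierIntegral Real.fourierChar volume (innerₗ (Config n)).flip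
        G x = 0 := by
      intro x
      rw [flip_innerₗ]
      exact hF x
    simp only [h1, h2, smul_zero, integral_zero] at key
    rw [← key]
    refine integral_congr_ae (Filter.Eventually.of_forall fun y => ?_)
    simp
  refine (Lp.eq_zero_iff_ae_eq_zero).2 ?_
  filter_upwards [hG0] with y hy
  have : (starRingEnd ℂ) (coherentFun (0 : Phase n) y) ≠ 0 := by
    simp [coherentFun, Complex.exp_ne_zero]
  exact (mul_eq_zero.1 hy).resolve_left this

/-- Finite linear combinations of coherent states. -/
def coherentComb (n : ℕ) : (Phase n →₀ ℂ) →ₗ[ℂ] L2 n := Finsupp.linearCombination ℂ coherent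

theorem denseRange_coherentComb (n : ℕ) : DenseRange (coherentComb n) := by
  have h : (LinearMap.range (coherentComb n)).topologicalClosure = ⊤ := by
    rw [Submodule.topologicalClosure_eq_top_iff, Submodule.eq_bot_iff]
    intro f hf
    refine eq_zero_of_inner_coherent f fun z => ?_
    exact hf _ ⟨Finsupp.single z 1, by simp [coherentComb]⟩
  have := Submodule.dense_iff_topologicalClosure_eq_top.2 h
  rwa [LinearMap.coe_range] at this

/-- Finite linear combinations of the coherent states moved by `g`. -/
def coherentCombAct {n : ℕ} (g : U n) : (Phase n →₀ ℂ) →ₗ[ℂ] L2 n :=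
  Finsupp.linearCombination ℂ fun z => coherent (act n g z)

theorem inner_coherentCombAct {n : ℕ} (g : U n) (c d : Phase n →₀ ℂ) :
    ⟪coherentCombAct g c, coherentCombAct g d⟫_ℂ = ⟪coherentComb n c, coherentComb n d⟫_ℂ := by
  simp only [coherentCombAct, coherentComb, Finsupp.linearCombination_apply, Finsupp.sum,
    sum_inner, inner_sum, inner_smul_left, inner_smul_right, inner_coherent_act]

theorem norm_coherentCombAct {n : ℕ} (g : U n) (c : Phase n →₀ ℂ) :
    ‖coherentCombAct g c‖ = ‖coherentComb n c‖ := by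
  rw [← sq_eq_sq₀ (norm_nonneg _) (norm_nonneg _), ← inner_self_eq_norm_sq (𝕜 := ℂ),
    ← inner_self_eq_norm_sq (𝕜 := ℂ), inner_coherentCombAct]

/-- The operator `R_g` on `L²(ℝⁿ)` attached to `g ∈ U(n)`: the bounded operator determined by
`R_g φ_z = φ_{g z}` for all coherent states. -/
def metaOp {n : ℕ} (g : U n) : L2 n →L[ℂ] L2 n :=
  (coherentCombAct g).extendOfNorm (coherentComb n)

theorem metaOp_comb {n : ℕ} (g : U n) (c : Phase n →₀ ℂ) :
    metaOp g (coherentComb n c) = coherentCombAct g c :=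
  LinearMap.extendOfNorm_eq (denseRange_coherentComb n)
    ⟨1, fun x => by rw [norm_coherentCombAct, one_mul]⟩ c

theorem metaOp_coherent {n : ℕ} (g : U n) (z : Phase n) :
    metaOp g (coherent z) = coherent (act n g z) := by
  have := metaOp_comb g (Finsupp.single z 1)
  simpa [coherentComb, coherentCombAct] using this

theorem ext_coherent {n : ℕ} {F : Type*} [NormedAddCommGroup F] [NormedSpace ℂ F]
    {S T : L2 n →L[ℂ] F} (h : ∀ z, S (coherent z) = T (coherent z)) : S = T := by
  refine ContinuousLinearMap.coeFn_injective
    ((denseRange_coherentComb n).equalizer S.continuous T.continuous (funext fun c => ?_))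
  simp only [Function.comp, coherentComb, Finsupp.linearCombination_apply, map_finsuppSum, map_smul,
    h]

theorem metaOp_one {n : ℕ} : metaOp (1 : U n) = 1 :=
  ext_coherent fun z => by rw [metaOp_coherent]; simp

theorem metaOp_mul {n : ℕ} (g h : U n) : metaOp (g * h) = metaOp g * metaOp h :=
  ext_coherent fun z => by
    rw [mul_apply_eq_comp, metaOp_coherent, metaOp_coherent, metaOp_coherent, map_mul]
    rfl

theorem star_metaOp_mul_self {n : ℕ} (g : U n) : star (metaOp g) * metaOp g = 1 := by
  refine ext_coherent fun z => ext_inner_left ℂ fun v => ?_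
  rw [mul_apply_eq_comp, ContinuousLinearMap.star_eq_adjoint,
    ContinuousLinearMap.adjoint_inner_right, one_apply_eq_self]
  have : ∀ v, ⟪metaOp g (coherent z), metaOp g v⟫_ℂ = ⟪coherent z, v⟫_ℂ := by
    have h : ((innerSL ℂ (metaOp g (coherent z))).comp (metaOp g)) = innerSL ℂ (coherent z) :=
      ext_coherent fun w => by
        simp [metaOp_coherent, inner_coherent_act]
    intro v
    exact congrArg (fun S : L2 n →L[ℂ] ℂ => S v) h
  rw [← inner_conj_symm, this, inner_conj_symm]

/-- The unitary representation `R : U(n) → U(L²(ℝⁿ))` by (complex) metaplectic operators.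
It is determined by `R_g φ_z = φ_{g z}`, that is, by `R_g W(z) R_g⁻¹ = W(g z)` for all `z` and
`R_g φ_0 = φ_0`.  Equivalently `R_g = π⁻¹(g) √(det g)` with `π⁻¹(g)` a metaplectic operator over
`g`, and `R_{exp(B + i A)} = exp(-i Ĥ) exp(i tr A / 2)`, `Ĥ` being the Weyl quantization of the
quadratic Hamiltonian of `B + i A`: one has `exp(-i Ĥ) W(z) exp(i Ĥ) = W(exp(B + i A) z)` and
`Ĥ φ_0 = (tr A / 2) φ_0`. -/
def R (n : ℕ) : U n →* unitary (L2 n →L[ℂ] L2 n) where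
  toFun g := ⟨metaOp g, by
    have h := star_metaOp_mul_self g
    refine Unitary.mem_iff.2 ⟨h, ?_⟩
    have h2 : metaOp g * metaOp g⁻¹ = 1 := by rw [← metaOp_mul, mul_inv_cancel, metaOp_one]
    rwa [left_inv_eq_right_inv h h2]⟩
  map_one' := Subtype.ext metaOp_one
  map_mul' g h := Subtype.ext (metaOp_mul g h)

theorem R_coherent {n : ℕ} (g : U n) (z : Phase n) :
    (R n g : L2 n →L[ℂ] L2 n) (coherent z) = coherent (act n g z) :=
  metaOp_coherent g z

/-- The cross-Wigner function
`W(u, v)(x, p) = (2π)⁻ⁿ ∫ e^{-i p·t} u(x + t/2) conj (v(x - t/2)) dt`, written with `t = 2 s`. -/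
def wigner {n : ℕ} (u v : L2 n) (z : Phase n) : ℂ :=
  (((π : ℝ)⁻¹ ^ n : ℝ) : ℂ) * ∫ s : Config n, cexp (-2 * I * ∑ j, (z j).re * s j) *
    u (pos z + s) * (starRingEnd ℂ) (v (pos z - s))

/-- `u ↦ (s ↦ v(x - s))` as an isometry of `L²`. -/
def reflOp {n : ℕ} (x : Config n) : L2 n →L[ℂ] L2 n :=
  (Lp.compMeasurePreservingₗᵢ ℂ (fun s : Config n => x - s)
    (Measure.measurePreserving_sub_left volume x)).toContinuousLinearMap

theorem reflOp_ae {n : ℕ} (x : Config n) (v : L2 n) :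
    reflOp x v =ᵐ[volume] fun s => v (x - s) :=
  Lp.coeFn_compMeasurePreserving v (Measure.measurePreserving_sub_left volume x)

/-- `u ↦ (s ↦ u(x + s))` as an isometry of `L²`. -/
def shiftOp {n : ℕ} (x : Config n) : L2 n →L[ℂ] L2 n :=
  (Lp.compMeasurePreservingₗᵢ ℂ (fun s : Config n => x + s)
    (measurePreserving_add_left volume x)).toContinuousLinearMap

theorem shiftOp_ae {n : ℕ} (x : Config n) (u : L2 n) :
    shiftOp x u =ᵐ[volume] fun s => u (x + s) :=
  Lp.coeFn_compMeasurePreserving u (measurePreserving_add_left volume x)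

theorem norm_phase {n : ℕ} (z : Phase n) (s : Config n) :
    ‖cexp (-2 * I * ∑ j, (z j).re * s j)‖ = 1 := by
  rw [show (-2 * I * (∑ j, (z j).re * s j : ℝ) : ℂ)
    = ((-2 * ∑ j, (z j).re * s j : ℝ) : ℂ) * I by push_cast; ring]
  exact Complex.norm_exp_ofReal_mul_I _

theorem memLp_phase {n : ℕ} (z : Phase n) (u : L2 n) :
    MemLp (fun s => cexp (-2 * I * ∑ j, (z j).re * s j) * u s) 2
      (volume : Measure (Config n)) := by
  refine (Lp.memLp u).of_le (.mul (Continuous.aestronglyMeasurable (by fun_prop))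
    (Lp.aestronglyMeasurable u)) (Filter.Eventually.of_forall fun s => ?_)
  rw [norm_mul, norm_phase, one_mul]

/-- Multiplication by `e^{-2 i p·s}` on `L²`. -/
def phaseOp {n : ℕ} (z : Phase n) : L2 n →L[ℂ] L2 n :=
  LinearMap.mkContinuous
    { toFun := fun u => (memLp_phase z u).toLp _
      map_add' := fun u v => by
        refine Lp.ext ?_
        filter_upwards [(memLp_phase z (u + v)).coeFn_toLp, (memLp_phase z u).coeFn_toLp,
          (memLp_phase z v).coeFn_toLp, Lp.coeFn_add u v,
          Lp.coeFn_add ((memLp_phase z u).toLp _) ((memLp_phase z v).toLp _)] with s h1 h2 h3 h4 h5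
        rw [h1, h5, Pi.add_apply, h2, h3, h4, Pi.add_apply, mul_add]
      map_smul' := fun c u => by
        refine Lp.ext ?_
        filter_upwards [(memLp_phase z (c • u)).coeFn_toLp, (memLp_phase z u).coeFn_toLp,
          Lp.coeFn_smul c u, Lp.coeFn_smul c ((memLp_phase z u).toLp _)] with s h1 h2 h4 h5
        rw [h1, RingHom.id_apply, h5, Pi.smul_apply, h2, h4, Pi.smul_apply, smul_eq_mul,
          smul_eq_mul]
        ring } 1 (fun u => by
      rw [one_mul]
      refine Lp.norm_le_norm_of_ae_le ?_
      filter_upwards [(memLp_phase z u).coeFn_toLp] with s h1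
      simp only [LinearMap.coe_mk, AddHom.coe_mk]
      rw [h1, norm_mul, norm_phase, one_mul])

theorem phaseOp_ae {n : ℕ} (z : Phase n) (u : L2 n) :
    phaseOp z u =ᵐ[volume] fun s => cexp (-2 * I * ∑ j, (z j).re * s j) * u s :=
  (memLp_phase z u).coeFn_toLp

theorem wigner_eq_inner {n : ℕ} (u v : L2 n) (z : Phase n) :
    wigner u v z =
      (((π : ℝ)⁻¹ ^ n : ℝ) : ℂ) * ⟪reflOp (pos z) v, phaseOp z (shiftOp (pos z) u)⟫_ℂ := by
  rw [wigner, L2.inner_def]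
  congr 1
  refine integral_congr_ae ?_
  filter_upwards [reflOp_ae (pos z) v, shiftOp_ae (pos z) u,
    phaseOp_ae z (shiftOp (pos z) u)] with s h1 h2 h3
  rw [h1, h3, h2, RCLike.inner_apply]

theorem wigner_coherent {n : ℕ} (a b z : Phase n) :
    wigner (coherent a) (coherent b) z = (((π : ℝ)⁻¹ ^ n : ℝ) : ℂ) *
      (cexp (-I * (⟪z, a⟫_ℂ).im) * ⟪coherent b, coherent ((2 : ℂ) • z - a)⟫_ℂ) := by
  rw [wigner, L2.inner_def, ← integral_sub_left_eq_self (fun y : Config n => ⟪coherent b y,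
    coherent ((2 : ℂ) • z - a) y⟫_ℂ) volume (pos z)]
  refine congrArg (fun t : ℂ => (((π : ℝ)⁻¹ ^ n : ℝ) : ℂ) * t) ?_
  rw [← integral_const_mul]
  refine integral_congr_ae ?_
  filter_upwards [(Measure.measurePreserving_sub_left volume (pos z)).quasiMeasurePreserving.ae_eq_comp
      (coherent_ae b), (Measure.measurePreserving_sub_left volume
        (pos z)).quasiMeasurePreserving.ae_eq_comp (coherent_ae ((2 : ℂ) • z - a)),
    (measurePreserving_add_left volume (pos z)).quasiMeasurePreserving.ae_eq_comp
      (coherent_ae a)] with s h1 h2 h3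
  simp only [Function.comp_apply] at h1 h2 h3
  rw [h1, h2, h3, RCLike.inner_apply, ← mul_assoc]
  congr 1
  rw [coherentFun, coherentFun, ← Complex.exp_add, ← Complex.exp_add, PiLp.inner_apply, im_sum,
    ofReal_sum, ofReal_sum]
  congr 1
  rw [Finset.mul_sum, Finset.mul_sum, ← Finset.sum_add_distrib, ← Finset.sum_add_distrib]
  refine Finset.sum_congr rfl fun j _ => ?_
  simp [pos]
  ring

theorem wigner_metaOp {n : ℕ} (g : U n) (u v : L2 n) (z : Phase n) :
    wigner (metaOp g u) (metaOp g v) (act n g z) = wigner u v z := by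
  have h0 : ∀ a b, wigner (metaOp g (coherent a)) (metaOp g (coherent b)) (act n g z) =
      wigner (coherent a) (coherent b) z := by
    intro a b
    rw [metaOp_coherent, metaOp_coherent, wigner_coherent, wigner_coherent,
      LinearIsometryEquiv.inner_map_map, ← map_smul, ← map_sub, inner_coherent_act]
  have hpi : (((π : ℝ)⁻¹ ^ n : ℝ) : ℂ) ≠ 0 := by
    exact_mod_cast pow_ne_zero n (inv_ne_zero Real.pi_ne_zero)
  simp only [wigner_eq_inner] at h0 ⊢
  congr 1
  have h1 : ∀ u b, ⟪reflOp (pos (act n g z)) (metaOp g (coherent b)), phaseOp (act n g z)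
      (shiftOp (pos (act n g z)) (metaOp g u))⟫_ℂ =
      ⟪reflOp (pos z) (coherent b), phaseOp z (shiftOp (pos z) u)⟫_ℂ := by
    intro u b
    have := ext_coherent
      (S := (innerSL ℂ (reflOp (pos (act n g z)) (metaOp g (coherent b)))).comp
        ((phaseOp (act n g z)).comp ((shiftOp (pos (act n g z))).comp (metaOp g))))
      (T := (innerSL ℂ (reflOp (pos z) (coherent b))).comp
        ((phaseOp z).comp (shiftOp (pos z))))
      (fun a => by simpa using mul_left_cancel₀ hpi (h0 a b))
    exact congrArg (fun S : L2 n →L[ℂ] ℂ => S u) this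
  have := ext_coherent
    (S := (innerSL ℂ (phaseOp (act n g z) (shiftOp (pos (act n g z)) (metaOp g u)))).comp
      ((reflOp (pos (act n g z))).comp (metaOp g)))
    (T := (innerSL ℂ (phaseOp z (shiftOp (pos z) u))).comp (reflOp (pos z)))
    (fun b => by
      have := congrArg (starRingEnd ℂ) (h1 u b)
      simpa [inner_conj_symm] using this)
  have h2 := congrArg (starRingEnd ℂ) (congrArg (fun S : L2 n →L[ℂ] ℂ => S v) this)
  simpa [inner_conj_symm] using h2

/-! ### Shubin classes and Weyl quantization -/

/-- `d` is a Shubin symbol of order `m` on `T*ℝⁿ`: it is smooth and all its derivatives of total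
order `k` are `O((1 + |(x, p)|)^{m - k})`. -/
def IsShubinSymbol {n : ℕ} (m : ℝ) (d : Phase n → ℂ) : Prop :=
  ContDiff ℝ ∞ d ∧
    ∀ k : ℕ, ∃ C : ℝ, ∀ z, ‖iteratedFDeriv ℝ k d z‖ ≤ C * (1 + ‖z‖) ^ (m - k)

/-- `a(t z) = t^m a(z)` for `|z| ≥ 1` and `t ≥ 1`. -/
def IsHomogeneousOutside {n : ℕ} (m : ℝ) (a : Phase n → ℂ) : Prop :=
  ∀ z : Phase n, 1 ≤ ‖z‖ → ∀ t : ℝ, 1 ≤ t → a ((t : ℂ) • z) = ((t ^ m : ℝ) : ℂ) * a z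

/-- `d` is a classical Shubin symbol of order `m`, with asymptotic expansion `d ∼ ∑ⱼ a j`, where
`a j` is a symbol of order `m - j`, homogeneous of degree `m - j` for `|z| ≥ 1`. -/
def HasExpansion {n : ℕ} (m : ℝ) (d : Phase n → ℂ) (a : ℕ → Phase n → ℂ) : Prop :=
  IsShubinSymbol m d ∧
  (∀ j : ℕ, IsShubinSymbol (m - j) (a j) ∧ IsHomogeneousOutside (m - j) (a j)) ∧
  ∀ N : ℕ, IsShubinSymbol (m - N) fun z => d z - ∑ j ∈ Finset.range N, a j z

/-- The bounded operator `T` on `L²(ℝⁿ)` is the Weyl quantization of the function `d` on `T*ℝⁿ`: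
`⟨T u, v⟩ = ∫ d(x, p) W(u, v)(x, p) dx dp` whenever the cross-Wigner function `W(u, v)` is
integrable (in particular for all Schwartz functions `u`, `v`). -/
def IsWeylOp {n : ℕ} (d : Phase n → ℂ) (T : L2 n →L[ℂ] L2 n) : Prop :=
  ∀ u v : L2 n, Integrable (wigner u v) → ⟪v, T u⟫_ℂ = ∫ z, d z * wigner u v z

/-- The unit sphere `S^{2n-1}` of phase space. -/
abbrev Sph (n : ℕ) : Type := Metric.sphere (0 : Phase n) 1

/-- `T` is a zero order classical pseudodifferential operator of Shubin type whose principal symbol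
(the restriction of the leading term to the sphere) is `f`. -/
def HasPrincipalSymbol {n : ℕ} (T : L2 n →L[ℂ] L2 n) (f : C(Sph n, ℂ)) : Prop :=
  ∃ (d : Phase n → ℂ) (a : ℕ → Phase n → ℂ), HasExpansion 0 d a ∧ IsWeylOp d T ∧
    ∀ z : Sph n, f z = a 0 z

/-- The zero order classical pseudodifferential operators of Shubin type. -/
def shubinOps (n : ℕ) : Set (L2 n →L[ℂ] L2 n) := {T | ∃ f, HasPrincipalSymbol T f}

/-- `Ψ(ℝⁿ)`: the norm closed `*`-subalgebra of `B(L²(ℝⁿ))` generated by (that is, the norm closure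
of) the `*`-algebra of zero order classical Shubin pseudodifferential operators. -/
def Psi (n : ℕ) : StarSubalgebra ℂ (L2 n →L[ℂ] L2 n) :=
  (StarAlgebra.adjoin ℂ (shubinOps n)).topologicalClosure

instance (n : ℕ) : IsClosed ((Psi n : StarSubalgebra ℂ (L2 n →L[ℂ] L2 n)) :
    Set (L2 n →L[ℂ] L2 n)) :=
  StarSubalgebra.isClosed_topologicalClosure _

/-- `act g` as a real linear isometry. -/
def actReal {n : ℕ} (g : U n) : Phase n ≃ₗᵢ[ℝ] Phase n :=
  { (act n g).toLinearEquiv.restrictScalars ℝ with norm_map' := (act n g).norm_map }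

theorem IsShubinSymbol.comp_act {n : ℕ} {m : ℝ} {d : Phase n → ℂ} (h : IsShubinSymbol m d)
    (g : U n) : IsShubinSymbol m fun z => d (act n g z) := by
  have e : (fun z => d (act n g z)) = d ∘ actReal g := rfl
  refine ⟨?_, fun k => ?_⟩
  · rw [e]
    exact h.1.comp (actReal g).contDiff
  · obtain ⟨C, hC⟩ := h.2 k
    refine ⟨C, fun z => ?_⟩
    rw [e, LinearIsometryEquiv.norm_iteratedFDeriv_comp_right]
    have := hC (actReal g z)
    rwa [LinearIsometryEquiv.norm_map] at this

theorem HasExpansion.comp_act {n : ℕ} {m : ℝ} {d : Phase n → ℂ} {a : ℕ → Phase n → ℂ}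
    (h : HasExpansion m d a) (g : U n) :
    HasExpansion m (fun z => d (act n g z)) fun j z => a j (act n g z) := by
  refine ⟨h.1.comp_act g, fun j => ⟨(h.2.1 j).1.comp_act g, fun z hz t ht => ?_⟩,
    fun N => (h.2.2 N).comp_act g⟩
  simp only [map_smul]
  exact (h.2.1 j).2 _ (by rwa [LinearIsometryEquiv.norm_map]) t ht

theorem act_inv_act {n : ℕ} (g : U n) (z : Phase n) : act n g⁻¹ (act n g z) = z := by
  simp

theorem wigner_metaOp_inv {n : ℕ} (g : U n) (u v : L2 n) (z : Phase n) :
    wigner (metaOp g⁻¹ u) (metaOp g⁻¹ v) z = wigner u v (act n g z) := by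
  have h := wigner_metaOp g⁻¹ u v (act n g z)
  rwa [act_inv_act] at h

/-- The action of `U(n)` on phase space restricted to the sphere. -/
def sphAct {n : ℕ} (g : U n) : C(Sph n, Sph n) where
  toFun z := ⟨act n g z, by simp⟩
  continuous_toFun := by
    refine Continuous.subtype_mk ?_ _
    exact (act n g).continuous.comp continuous_subtype_val

/-- The action of `U(n)` on `C(S^{2n-1})`: `g` acts by `f ↦ (g⁻¹)^* f`. -/
def sphAction (n : ℕ) : U n →* (C(Sph n, ℂ) →⋆ₐ[ℂ] C(Sph n, ℂ)) where
  toFun g := ContinuousMap.compStarAlgHom' ℂ ℂ (sphAct g⁻¹)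
  map_one' := by
    refine StarAlgHom.ext fun f => ContinuousMap.ext fun z => ?_
    change f _ = f _
    simp [sphAct]
  map_mul' g h := by
    refine StarAlgHom.ext fun f => ContinuousMap.ext fun z => ?_
    change f _ = f _
    simp [sphAct]

/-- Conjugation by `R_g` maps the Weyl quantization of `d` to that of `d ∘ g⁻¹`. -/
theorem HasPrincipalSymbol.conj {n : ℕ} {T : L2 n →L[ℂ] L2 n} {f : C(Sph n, ℂ)}
    (h : HasPrincipalSymbol T f) (g : U n) :
    HasPrincipalSymbol (Unitary.conjStarAlgAut ℂ (L2 n →L[ℂ] L2 n) (R n g) T)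
      (sphAction n g f) := by
  obtain ⟨d, a, hda, hT, hf⟩ := h
  refine ⟨_, _, hda.comp_act g⁻¹, fun u v huv => ?_, fun z => hf _⟩
  have hstar : star (R n g : L2 n →L[ℂ] L2 n) = metaOp g⁻¹ := by
    rw [← Unitary.coe_star, Unitary.star_eq_inv, ← map_inv]
    rfl
  have hmp := (actReal g).measurePreserving
  have hme : MeasurableEmbedding (actReal g) :=
    (actReal g).toHomeomorph.measurableEmbedding
  have hw : (fun z => wigner (metaOp g⁻¹ u) (metaOp g⁻¹ v) z) =
      wigner u v ∘ actReal g := funext fun z => wigner_metaOp_inv g u v z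
  have hint : Integrable (wigner (metaOp g⁻¹ u) (metaOp g⁻¹ v)) := by
    rw [show wigner (metaOp g⁻¹ u) (metaOp g⁻¹ v) = _ from hw]
    exact (hmp.integrable_comp_emb hme).2 huv
  have h1 := hT _ _ hint
  rw [Unitary.conjStarAlgAut_apply, mul_apply_eq_comp, mul_apply_eq_comp, hstar,
    ← ContinuousLinearMap.adjoint_inner_left, ← ContinuousLinearMap.star_eq_adjoint, hstar, h1,
    ← hmp.integral_comp hme (fun z => d (act n g⁻¹ z) * wigner u v z)]
  refine integral_congr_ae (Filter.Eventually.of_forall fun z => ?_)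
  simp only
  rw [wigner_metaOp_inv]
  change _ = d (act n g⁻¹ (act n g z)) * wigner u v (act n g z)
  rw [act_inv_act]

/-- Conjugation `T ↦ R_g T R_g⁻¹` on `B(L²(ℝⁿ))`. -/
def conjHom {n : ℕ} (g : U n) : (L2 n →L[ℂ] L2 n) →⋆ₐ[ℂ] (L2 n →L[ℂ] L2 n) :=
  StarAlgHomClass.toStarAlgHom (Unitary.conjStarAlgAut ℂ (L2 n →L[ℂ] L2 n) (R n g))

theorem conjHom_apply {n : ℕ} (g : U n) (T : L2 n →L[ℂ] L2 n) :
    conjHom g T = (R n g : L2 n →L[ℂ] L2 n) * T * star (R n g : L2 n →L[ℂ] L2 n) := rfl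

theorem conj_mem_Psi {n : ℕ} (g : U n) {T : L2 n →L[ℂ] L2 n} (hT : T ∈ Psi n) :
    conjHom g T ∈ Psi n := by
  have hc : Continuous (conjHom g) := by
    rw [show ⇑(conjHom g) = _ from funext (conjHom_apply g)]
    fun_prop
  have h1 : (conjHom g) T ∈ StarSubalgebra.map (conjHom g) (Psi n) := ⟨T, hT, rfl⟩
  have h2 := StarSubalgebra.map_topologicalClosure_le _ (conjHom g) hc h1
  refine StarSubalgebra.topologicalClosure_mono ?_ h2
  rw [StarAlgHom.map_adjoin]
  refine StarAlgebra.adjoin_mono ?_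
  rintro _ ⟨S, ⟨f, hf⟩, rfl⟩
  exact ⟨_, hf.conj g⟩

/-- The action of `U(n)` on `Ψ(ℝⁿ)` by conjugation `T ↦ R_g T R_g⁻¹`. -/
def psiAction (n : ℕ) : U n →* (Psi n →⋆ₐ[ℂ] Psi n) where
  toFun g := ((conjHom g).comp (Psi n).subtype).codRestrict (Psi n) fun T => conj_mem_Psi g T.2
  map_one' := by
    refine StarAlgHom.ext fun T => Subtype.ext ?_
    change conjHom 1 (T : L2 n →L[ℂ] L2 n) = T
    simp [conjHom_apply]
  map_mul' g h := by
    refine StarAlgHom.ext fun T => Subtype.ext ?_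
    change conjHom (g * h) (T : L2 n →L[ℂ] L2 n) = conjHom g (conjHom h T)
    simp [conjHom_apply, mul_assoc]

/-! ### Maximal crossed products by discrete groups -/

/-- Bounded families in nonzero unital `C*`-algebras form a unital `C*`-algebra. -/
instance lpCStarAlgebra {I : Type*} (A : I → Type*) [∀ i, Nontrivial (A i)]
    [∀ i, CStarAlgebra (A i)] : CStarAlgebra (lp A ∞) where

section Crossed

variable {A : Type} [CStarAlgebra A] {G : Type} [Group G] (α : G →* (A →⋆ₐ[ℂ] A))

/-- The covariance relation `u_g π(a) u_g* = π(α_g a)`. -/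
def IsCovariant {B : Type} [CStarAlgebra B] (hom : A →⋆ₐ[ℂ] B) (u : G →* unitary B) : Prop :=
  ∀ g a, (u g : B) * hom a * star (u g : B) = hom (α g a)

/-- A covariant pair `(π, u)` for the action `α` of the discrete group `G` on the unital
`C*`-algebra `A`, with values in a (nonzero, unital) `C*`-algebra: a unital `*`-homomorphism `π`
(`hom`) and a homomorphism `u` to the unitary group with `u_g π(a) u_g* = π(α_g a)`. -/
structure CovPair where
  carrier : Type
  [cstar : CStarAlgebra carrier]
  [nontriv : Nontrivial carrier]
  hom : A →⋆ₐ[ℂ] carrier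
  u : G →* unitary carrier
  covariant : IsCovariant α hom u

attribute [instance] CovPair.cstar CovPair.nontriv

/-- The `C*`-algebra of bounded families `(x_ρ)` indexed by all covariant pairs `ρ`, with the
supremum norm. -/
def CovProd : Type 1 := lp (fun ρ : CovPair α => ρ.carrier) ∞

instance CovProd.instCStarAlgebra : CStarAlgebra (CovProd α) := lpCStarAlgebra fun ρ : CovPair α => ρ.carrier

variable {α} in
/-- The component of a bounded family at the covariant pair `ρ`. -/
def CovProd.comp (ρ : CovPair α) : CovProd α →⋆ₐ[ℂ] ρ.carrier where
  toFun x := x.1 ρ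
  map_one' := rfl
  map_mul' _ _ := rfl
  map_zero' := rfl
  map_add' _ _ := rfl
  commutes' _ := rfl
  map_star' _ := rfl

variable {α} in
/-- The bounded family with given components. -/
def CovProd.mk (x : ∀ ρ : CovPair α, ρ.carrier) (C : ℝ) (h : ∀ ρ, ‖x ρ‖ ≤ C) : CovProd α :=
  ⟨x, memℓp_infty ⟨C, by rintro _ ⟨ρ, rfl⟩; exact h ρ⟩⟩

variable {α} in
theorem CovProd.ext {x y : CovProd α} (h : ∀ ρ, CovProd.comp ρ x = CovProd.comp ρ y) : x = y :=
  Subtype.ext (funext h)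

variable {α} in
theorem CovProd.comp_mk (x : ∀ ρ : CovPair α, ρ.carrier) (C : ℝ) (h : ∀ ρ, ‖x ρ‖ ≤ C)
    (ρ : CovPair α) : CovProd.comp ρ (CovProd.mk x C h) = x ρ := rfl

variable {α} in
theorem CovProd.norm_comp_le (ρ : CovPair α) (x : CovProd α) : ‖CovProd.comp ρ x‖ ≤ ‖x‖ :=
  lp.norm_apply_le_norm ENNReal.top_ne_zero x ρ

variable {α} in
theorem CovProd.norm_le {x : CovProd α} {C : ℝ} (hC : 0 ≤ C)
    (h : ∀ ρ, ‖CovProd.comp ρ x‖ ≤ C) : ‖x‖ ≤ C :=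
  lp.norm_le_of_forall_le hC h

attribute [irreducible] CovProd.instCStarAlgebra

/-- The copy of `A` in the universal covariant pair. -/
def univPi : A →⋆ₐ[ℂ] CovProd α where
  toFun a := CovProd.mk (fun ρ => ρ.hom a) ‖a‖ fun ρ =>
    NonUnitalStarAlgHom.norm_apply_le ρ.hom a
  map_one' := CovProd.ext fun ρ => by simp [CovProd.comp_mk]
  map_mul' a b := CovProd.ext fun ρ => by simp [CovProd.comp_mk]
  map_zero' := CovProd.ext fun ρ => by simp [CovProd.comp_mk]
  map_add' a b := CovProd.ext fun ρ => by simp [CovProd.comp_mk]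
  commutes' c := CovProd.ext fun ρ => by
    rw [CovProd.comp_mk, AlgHomClass.commutes, AlgHomClass.commutes]
  map_star' a := CovProd.ext fun ρ => by simp [CovProd.comp_mk, map_star]

/-- The copy of `G` in the universal covariant pair. -/
def univU : G →* unitary (CovProd α) where
  toFun g := ⟨CovProd.mk (fun ρ => (ρ.u g : ρ.carrier)) 1 fun ρ =>
      (CStarRing.norm_coe_unitary (ρ.u g)).le, Unitary.mem_iff.2
    ⟨CovProd.ext fun ρ => by simp [CovProd.comp_mk, map_star],
      CovProd.ext fun ρ => by simp [CovProd.comp_mk, map_star]⟩⟩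
  map_one' := Subtype.ext (CovProd.ext fun ρ => by simp [CovProd.comp_mk])
  map_mul' g h := Subtype.ext (CovProd.ext fun ρ => by simp [CovProd.comp_mk])

/-- The closed `*`-subalgebra generated by the universal covariant pair. -/
def crossedSub : StarSubalgebra ℂ (CovProd α) :=
  (StarAlgebra.adjoin ℂ
    (Set.range (univPi α) ∪ Set.range fun g => (univU α g : CovProd α))).topologicalClosure

instance : IsClosed ((crossedSub α : StarSubalgebra ℂ (CovProd α)) : Set (CovProd α)) :=
  StarSubalgebra.isClosed_topologicalClosure _

/-- The maximal crossed product `A ⋊ G`: the `C*`-algebra generated by the universal covariant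
pair, i.e. the completion of the `*`-algebra of finite sums `∑ a_g u_g` in the norm
`‖∑ a_g u_g‖ = sup ‖∑ π(a_g) u(g)‖` over all covariant pairs `(π, u)`. -/
def Crossed : Type 1 := crossedSub α

instance crossedSubCStarAlgebra : CStarAlgebra (crossedSub α) := inferInstance

instance Crossed.instCStarAlgebra : CStarAlgebra (Crossed α) := crossedSubCStarAlgebra α

/-- The inclusion of `A ⋊ G` in the algebra of bounded families. -/
def Crossed.val : Crossed α →⋆ₐ[ℂ] CovProd α := (crossedSub α).subtype

/-- The canonical homomorphism `A → A ⋊ G`. -/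
def Crossed.ι : A →⋆ₐ[ℂ] Crossed α :=
  (univPi α).codRestrict (crossedSub α) fun a =>
    StarSubalgebra.le_topologicalClosure _ (StarAlgebra.subset_adjoin ℂ _ (Or.inl ⟨a, rfl⟩))

/-- The canonical unitaries of `A ⋊ G`. -/
def Crossed.δ (g : G) : Crossed α :=
  ⟨univU α g,
    StarSubalgebra.le_topologicalClosure _ (StarAlgebra.subset_adjoin ℂ _ (Or.inr ⟨g, rfl⟩))⟩

/-- The homomorphism from `A ⋊ G` induced by a covariant pair: `∑ a_g u_g ↦ ∑ π(a_g) u(g)`. -/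
def Crossed.lift (ρ : CovPair α) : Crossed α →⋆ₐ[ℂ] ρ.carrier :=
  (CovProd.comp ρ).comp (Crossed.val α)

theorem Crossed.norm_val (x : Crossed α) : ‖Crossed.val α x‖ = ‖x‖ := rfl

theorem Crossed.val_ι (a : A) : Crossed.val α (Crossed.ι α a) = univPi α a := rfl

theorem Crossed.val_δ (g : G) : Crossed.val α (Crossed.δ α g) = univU α g := rfl

theorem Crossed.val_mem (x : Crossed α) : Crossed.val α x ∈ crossedSub α := x.2

theorem Crossed.lift_apply (ρ : CovPair α) (x : Crossed α) :
    Crossed.lift α ρ x = CovProd.comp ρ (Crossed.val α x) := rfl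

theorem Crossed.lift_ι (ρ : CovPair α) (a : A) : Crossed.lift α ρ (Crossed.ι α a) = ρ.hom a := rfl

theorem Crossed.lift_δ (ρ : CovPair α) (g : G) : Crossed.lift α ρ (Crossed.δ α g) = ρ.u g := rfl

end Crossed

/-- The maximal group `C*`-algebra `C*(G) = ℂ ⋊ G` of a discrete group. -/
abbrev GroupCStar (G : Type) [Group G] := Crossed (1 : G →* (ℂ →⋆ₐ[ℂ] ℂ))

section Inclusion

variable {A : Type} [CStarAlgebra A] {G : Type} [Group G] (α : G →* (A →⋆ₐ[ℂ] A))

/-- Restriction of a covariant pair for `A` to the scalars. -/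
def CovPair.scalars (ρ : CovPair α) : CovPair (1 : G →* (ℂ →⋆ₐ[ℂ] ℂ)) where
  carrier := ρ.carrier
  hom := StarAlgHom.ofId ℂ ρ.carrier
  u := ρ.u
  covariant g c := by
    change (ρ.u g : ρ.carrier) * algebraMap ℂ _ c * star (ρ.u g : ρ.carrier) = algebraMap ℂ _ c
    rw [← Algebra.commutes, mul_assoc, Unitary.mul_star_self_of_mem (ρ.u g).2, mul_one]

/-- The component at the restriction of `ρ` to the scalars. -/
def CovPair.compScalars (ρ : CovPair α) :
    CovProd (1 : G →* (ℂ →⋆ₐ[ℂ] ℂ)) →⋆ₐ[ℂ] ρ.carrier := CovProd.comp ρ.scalars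

theorem CovPair.norm_compScalars_le (ρ : CovPair α) (x : CovProd (1 : G →* (ℂ →⋆ₐ[ℂ] ℂ))) :
    ‖ρ.compScalars α x‖ ≤ ‖x‖ := CovProd.norm_comp_le ρ.scalars x

/-- The homomorphism induced by restriction of covariant pairs to the scalars. -/
def CovProd.ofScalars : CovProd (1 : G →* (ℂ →⋆ₐ[ℂ] ℂ)) →⋆ₐ[ℂ] CovProd α where
  toFun x := CovProd.mk (fun ρ => ρ.compScalars α x) ‖x‖ fun ρ => ρ.norm_compScalars_le α x
  map_one' := CovProd.ext fun ρ => by simp only [CovProd.comp_mk, map_one]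
  map_mul' x y := CovProd.ext fun ρ => by simp only [CovProd.comp_mk, map_mul]
  map_zero' := CovProd.ext fun ρ => by simp only [CovProd.comp_mk, map_zero]
  map_add' x y := CovProd.ext fun ρ => by simp only [CovProd.comp_mk, map_add]
  commutes' c := CovProd.ext fun ρ => by
    rw [CovProd.comp_mk, AlgHomClass.commutes, AlgHomClass.commutes]
  map_star' x := CovProd.ext fun ρ => by
    rw [CovProd.comp_mk, map_star, map_star, CovProd.comp_mk]

theorem CovProd.continuous_ofScalars : Continuous (CovProd.ofScalars α) := by
  refine AddMonoidHomClass.continuous_of_bound (CovProd.ofScalars α) 1 fun x => ?_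
  rw [one_mul]
  exact CovProd.norm_le (norm_nonneg x) fun ρ => ρ.norm_compScalars_le α x

theorem CovProd.ofScalars_mem {x : CovProd (1 : G →* (ℂ →⋆ₐ[ℂ] ℂ))}
    (hx : x ∈ crossedSub (1 : G →* (ℂ →⋆ₐ[ℂ] ℂ))) : CovProd.ofScalars α x ∈ crossedSub α := by
  have h1 : CovProd.ofScalars α x ∈ StarSubalgebra.map (CovProd.ofScalars α)
      (crossedSub (1 : G →* (ℂ →⋆ₐ[ℂ] ℂ))) := ⟨x, hx, rfl⟩
  have h2 := StarSubalgebra.map_topologicalClosure_le _ _ (CovProd.continuous_ofScalars α) h1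
  refine StarSubalgebra.topologicalClosure_mono ?_ h2
  rw [StarAlgHom.map_adjoin]
  refine StarAlgebra.adjoin_mono ?_
  rintro _ ⟨_, ⟨c, rfl⟩ | ⟨g, rfl⟩, rfl⟩
  · refine Or.inl ⟨algebraMap ℂ A c, CovProd.ext fun ρ => ?_⟩
    exact AlgHomClass.commutes ρ.hom c
  · exact Or.inr ⟨g, rfl⟩

/-- The canonical homomorphism `C*(G) → A ⋊ G`, `∑ c_g u_g ↦ ∑ (c_g 1) u_g`. -/
def GroupCStar.incl : GroupCStar G →⋆ₐ[ℂ] Crossed α :=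
  ((CovProd.ofScalars α).comp (Crossed.val _)).codRestrict (crossedSub α)
    fun x => CovProd.ofScalars_mem α x.2

theorem GroupCStar.val_incl (x : GroupCStar G) :
    Crossed.val α (GroupCStar.incl α x) = CovProd.ofScalars α (Crossed.val _ x) := rfl

theorem GroupCStar.incl_δ (g : G) :
    GroupCStar.incl α (Crossed.δ (1 : G →* (ℂ →⋆ₐ[ℂ] ℂ)) g) = Crossed.δ α g := rfl

end Inclusion

attribute [irreducible] Crossed.instCStarAlgebra

/-! ### `G`-operators -/

section GOperators

variable {n : ℕ} (G : Subgroup (U n))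

/-- The crossed product `Ψ(ℝⁿ) ⋊ G`. -/
abbrev PsiG := Crossed ((psiAction n).comp G.subtype)

/-- The crossed product `C(S^{2n-1}) ⋊ G`. -/
abbrev SymbG := Crossed ((sphAction n).comp G.subtype)

/-- The graph of the symbol homomorphism `σ : Ψ(ℝⁿ) → C(S^{2n-1})`: the closed `*`-subalgebra of
the product generated by the pairs (operator, principal symbol). -/
def symbolGraph (n : ℕ) : StarSubalgebra ℂ (Psi n × C(Sph n, ℂ)) :=
  (StarAlgebra.adjoin ℂ {q : Psi n × C(Sph n, ℂ) |
    HasPrincipalSymbol (q.1 : L2 n →L[ℂ] L2 n) q.2}).topologicalClosure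

/-- The graph of the symbol homomorphism of crossed products
`σ : Ψ(ℝⁿ) ⋊ G → C(S^{2n-1}) ⋊ G`, `{D_g} ↦ {σ(D_g)}`: the closed `*`-subalgebra of the product
generated by the pairs `(D, σ(D))`, `D ∈ Ψ(ℝⁿ)`, and `(u_g, u_g)`, `g ∈ G`. -/
def crossedSymbolGraph : StarSubalgebra ℂ (PsiG G × SymbG G) :=
  (StarAlgebra.adjoin ℂ
    ({q : PsiG G × SymbG G | ∃ t ∈ symbolGraph n, q = (Crossed.ι _ t.1, Crossed.ι _ t.2)} ∪
      Set.range fun g : G => ((Crossed.δ _ g, Crossed.δ _ g) : PsiG G × SymbG G)))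
    |>.topologicalClosure

/-- `s` is the symbol `σ(D)` of the matrix `D` over `Ψ(ℝⁿ) ⋊ G`. -/
def IsSymbol {N : ℕ} (D : Matrix (Fin N) (Fin N) (PsiG G))
    (s : Matrix (Fin N) (Fin N) (SymbG G)) : Prop :=
  ∀ i j, (D i j, s i j) ∈ crossedSymbolGraph G

instance (n : ℕ) : Nontrivial (L2 n) := by
  refine ⟨⟨coherent 0, 0, fun h => ?_⟩⟩
  have h1 := inner_coherent (0 : Phase n) 0
  rw [h, inner_zero_left] at h1
  refine mul_ne_zero ?_ (Complex.exp_ne_zero _) h1.symm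
  rw [Complex.cpow_ne_zero_iff]
  exact Or.inl (by exact_mod_cast Real.pi_ne_zero)

/-- The covariant pair given by the inclusion `Ψ(ℝⁿ) ⊂ B(L²(ℝⁿ))` and the unitaries `R_g`. -/
def naturalPair : CovPair ((psiAction n).comp G.subtype) where
  carrier := L2 n →L[ℂ] L2 n
  hom := (Psi n).subtype
  u := (R n).comp G.subtype
  covariant _ _ := rfl

/-- The natural representation `Ψ(ℝⁿ) ⋊ G → B(L²(ℝⁿ))`, `{D_g} ↦ ∑ D_g R_g`. -/
def natRep : PsiG G →⋆ₐ[ℂ] (L2 n →L[ℂ] L2 n) := Crossed.lift _ (naturalPair G)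

/-- The Hilbert space `L²(ℝⁿ, ℂ^N)`, as the Hilbert sum of `N` copies of `L²(ℝⁿ)`. -/
abbrev L2N (n N : ℕ) : Type := PiLp 2 fun _ : Fin N => L2 n

/-- The operator on `L²(ℝⁿ, ℂ^N)` given by a matrix of operators on `L²(ℝⁿ)`. -/
def matOp {N : ℕ} (T : Matrix (Fin N) (Fin N) (L2 n →L[ℂ] L2 n)) : L2N n N →L[ℂ] L2N n N :=
  ((PiLp.continuousLinearEquiv 2 ℂ fun _ : Fin N => L2 n).symm : _ →L[ℂ] L2N n N).comp
    (ContinuousLinearMap.pi fun i => ∑ j, (T i j).comp (PiLp.proj 2 (fun _ : Fin N => L2 n) j))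

theorem matOp_apply {N : ℕ} (T : Matrix (Fin N) (Fin N) (L2 n →L[ℂ] L2 n)) (f : L2N n N)
    (i : Fin N) : matOp T f i = ∑ j, T i j (f j) := by
  simp [matOp]

theorem matOp_mul {N : ℕ} (S T : Matrix (Fin N) (Fin N) (L2 n →L[ℂ] L2 n)) :
    matOp (S * T) = matOp S * matOp T := by
  ext f i : 2
  rw [mul_apply_eq_comp, matOp_apply, matOp_apply]
  simp only [matOp_apply, Matrix.mul_apply, sum_apply, mul_apply_eq_comp,
    map_sum]
  exact Finset.sum_comm

/-- The operator on `L²(ℝⁿ, ℂ^N)` represented by a matrix over `Ψ(ℝⁿ) ⋊ G`. -/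
def quantize {N : ℕ} (D : Matrix (Fin N) (Fin N) (PsiG G)) : L2N n N →L[ℂ] L2N n N :=
  matOp (D.map (natRep G))

theorem quantize_mul {N : ℕ} (D E : Matrix (Fin N) (Fin N) (PsiG G)) :
    quantize G (D * E) = quantize G D * quantize G E := by
  rw [quantize, Matrix.map_mul, matOp_mul]
  rfl

/-- The matrix over `Ψ(ℝⁿ) ⋊ G` given by a matrix over `C*(G)`. -/
def toPsiG {N : ℕ} (P : Matrix (Fin N) (Fin N) (GroupCStar G)) :
    Matrix (Fin N) (Fin N) (PsiG G) := P.map (GroupCStar.incl _)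

/-- The matrix over `C(S^{2n-1}) ⋊ G` given by a matrix over `C*(G)`. -/
def toSymbG {N : ℕ} (P : Matrix (Fin N) (Fin N) (GroupCStar G)) :
    Matrix (Fin N) (Fin N) (SymbG G) := P.map (GroupCStar.incl _)

/-- The compatibility condition `D = P₂ D P₁`. -/
def IsCompatible {N : ℕ} (D : Matrix (Fin N) (Fin N) (PsiG G))
    (P₁ P₂ : Matrix (Fin N) (Fin N) (GroupCStar G)) : Prop :=
  D = toPsiG G P₂ * D * toPsiG G P₁

/-- A triple `(D, P₁, P₂)`: an `N × N` matrix `D` over `Ψ(ℝⁿ) ⋊ G` and `N × N` matrix projections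
`P₁`, `P₂` over `C*(G)` with `D = P₂ D P₁`. -/
structure Triple (N : ℕ) where
  D : Matrix (Fin N) (Fin N) (PsiG G)
  P₁ : Matrix (Fin N) (Fin N) (GroupCStar G)
  P₂ : Matrix (Fin N) (Fin N) (GroupCStar G)
  proj₁ : IsStarProjection P₁
  proj₂ : IsStarProjection P₂
  compat : IsCompatible G D P₁ P₂

variable {G} {N : ℕ}

/-- The operator on `L²(ℝⁿ, ℂ^N)` represented by a matrix `P` over `C*(G)`: the matrix of the
operators `∑ P_{ij,g} R_g`. -/
def groupOp (P : Matrix (Fin N) (Fin N) (GroupCStar G)) : L2N n N →L[ℂ] L2N n N :=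
  quantize G (toPsiG G P)

theorem Triple.mapsTo (𝒟 : Triple G N) (f : L2N n N) :
    quantize G 𝒟.D f ∈ LinearMap.range (groupOp 𝒟.P₂).toLinearMap := by
  have h : 𝒟.D = _ := 𝒟.compat
  rw [h, mul_assoc, quantize_mul]
  exact ⟨_, rfl⟩

/-- The `G`-operator `D : Im P₁ → Im P₂` of a triple, where `Im P₁, Im P₂ ⊂ L²(ℝⁿ, ℂ^N)`. -/
def Triple.operator (𝒟 : Triple G N) :
    LinearMap.range (groupOp 𝒟.P₁).toLinearMap →L[ℂ] LinearMap.range (groupOp 𝒟.P₂).toLinearMap :=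
  ((quantize G 𝒟.D).comp (LinearMap.range (groupOp 𝒟.P₁).toLinearMap).subtypeL).codRestrict _
    fun f => 𝒟.mapsTo f

/-- Ellipticity: there is a matrix `r` over `C(S^{2n-1}) ⋊ G` with `P₁ r σ(D) = P₁` and
`σ(D) r P₂ = P₂`. -/
def Triple.IsElliptic (𝒟 : Triple G N) : Prop :=
  ∃ s r : Matrix (Fin N) (Fin N) (SymbG G), IsSymbol G 𝒟.D s ∧
    toSymbG G 𝒟.P₁ * r * s = toSymbG G 𝒟.P₁ ∧ s * r * toSymbG G 𝒟.P₂ = toSymbG G 𝒟.P₂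

end GOperators

end GOperators

end

/-!
The proof works modulo compact operators, in the Calkin algebra `B(L²(ℝⁿ)) / K(L²(ℝⁿ))`
(`Calkin (L2 n)`), which is shown to be a `C*`-algebra.

The central object is a `*`-homomorphism `symbolHom n` from `C(S^{2n-1})` to the Calkin algebra,
whose composition with the symbol map is the quotient map on `Ψ(ℝⁿ)`. It sends `f` to the class of
the anti-Wick operator `c⁻¹ ∫ F(z) ⟪φ_z, ·⟫ φ_z dz` of any bounded continuous function `F` on phase
space that equals `f(z / |z|)` for large `z`. The class does not depend on `F`, because anti-Wick
operators with compactly supported symbols are compact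
(`isCompactOperator_antiWick_of_hasCompactSupport`). It is multiplicative, because the product
defect of anti-Wick quantization is small in norm for slowly varying symbols
(`norm_antiWick_mul_sub_le`, by a Schur test for kernels with respect to coherent states), and `F`
can be replaced by a dilation `F(z / R)` without changing the class. It is equivariant, because
`R_g φ_z = φ_{g z}`.

The Weyl quantization of a classical symbol of order zero differs from the anti-Wick quantization of
its leading part by a compact operator (`isCompactOperator_weyl_sub_antiWick`): the kernel of the
difference in coherent states decays rapidly off the diagonal and tends to zero along it, by the
rapid decay of Fourier transforms of Gaussians times symbols. Hence the class of a
pseudodifferential operator is `symbolHom` of its principal symbol.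

Together with the classes of the operators `R_g`, `symbolHom` forms a covariant pair and so induces
`calkinRep G : C(S^{2n-1}) ⋊ G → Calkin (L2 n)`. By continuity, the class of the operator
represented by `D ∈ Ψ(ℝⁿ) ⋊ G` is `calkinRep` of the symbol of `D`, and likewise on `C*(G)`.
Applying `calkinRep` entrywise to the ellipticity relations and lifting the image of `r` to bounded
operators gives a parametrix modulo compact operators (`Triple.IsElliptic.exists_parametrix`), and
Atkinson's theorem on the ranges of the projections (`isFredholm_codRestrict_range`) concludes.
-/

noncomputable section

namespace GOperators

/-! ### Compact operators and the Calkin algebra -/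

section Compact

variable {E H : Type*} [NormedAddCommGroup E] [NormedSpace ℂ E]
  [NormedAddCommGroup H] [InnerProductSpace ℂ H]

/-- A compact operator with values in a Hilbert space is approximated in norm by its compressions
to finite dimensional subspaces of the target. -/
theorem exists_finiteDimensional_norm_sub_starProjection_le {k : E →L[ℂ] H}
    (hk : IsCompactOperator k) {ε : ℝ} (hε : 0 < ε) :
    ∃ U : Submodule ℂ H, ∃ _ : FiniteDimensional ℂ U, ‖k - U.starProjection ∘L k‖ ≤ ε := by
  have hcomp : IsCompact (closure (k '' Metric.closedBall 0 1)) :=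
    hk.isCompact_closure_image_closedBall 1
  obtain ⟨t, ht, hcov⟩ := Metric.totallyBounded_iff.1 hcomp.totallyBounded ε hε
  refine ⟨Submodule.span ℂ t, FiniteDimensional.span_of_finite ℂ ht, ?_⟩
  have := FiniteDimensional.span_of_finite ℂ ht
  refine ContinuousLinearMap.opNorm_le_of_unit_norm hε.le fun x hx => ?_
  have hx' : k x ∈ closure (k '' Metric.closedBall 0 1) :=
    subset_closure ⟨x, by simp [hx], rfl⟩
  obtain ⟨y, hy, hxy⟩ := Set.mem_iUnion₂.1 (hcov hx')
  have e : (k - (Submodule.span ℂ t).starProjection ∘L k) x =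
      (Submodule.span ℂ t)ᗮ.starProjection (k x - y) := by
    have h1 : (Submodule.span ℂ t)ᗮ.starProjection y = 0 := by
      rw [Submodule.starProjection_apply_eq_zero_iff]
      exact Submodule.le_orthogonal_orthogonal _ (Submodule.subset_span hy)
    rw [map_sub, h1, sub_zero, Submodule.starProjection_orthogonal']
    simp
  rw [e]
  refine (Submodule.norm_starProjection_apply_le _ _).trans ?_
  rw [← dist_eq_norm]
  exact (Metric.mem_ball.1 hxy).le

theorem isCompactOperator_starProjection_comp (U : Submodule ℂ H) [FiniteDimensional ℂ U]
    (k : E →L[ℂ] H) : IsCompactOperator (U.starProjection ∘L k) := by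
  have h : IsCompactOperator (U.subtypeL ∘L (U.orthogonalProjectionOnto ∘L k)) := by
    have : ProperSpace U := FiniteDimensional.proper ℂ U
    exact (isCompactOperator_of_locallyCompactSpace_dom
      (U.orthogonalProjectionOnto ∘L k)).clm_comp U.subtypeL
  exact h

end Compact

section Calkin

variable (H : Type*) [NormedAddCommGroup H] [InnerProductSpace ℂ H]

/-- The ideal of compact operators on a Hilbert space. -/
def compactIdeal : Ideal (H →L[ℂ] H) where
  carrier := {T | IsCompactOperator T}
  zero_mem' := isCompactOperator_zero
  add_mem' := fun h k => h.add k
  smul_mem' := fun T _ h => h.clm_comp T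

instance : (compactIdeal H).IsTwoSided := ⟨fun S h => IsCompactOperator.comp_clm h S⟩

/-- The Calkin algebra of a Hilbert space: bounded operators modulo compact ones. -/
def Calkin : Type _ := (H →L[ℂ] H) ⧸ compactIdeal H

instance : Ring (Calkin H) := inferInstanceAs (Ring ((H →L[ℂ] H) ⧸ compactIdeal H))

instance : Algebra ℂ (Calkin H) := inferInstanceAs (Algebra ℂ ((H →L[ℂ] H) ⧸ compactIdeal H))

variable {H}

namespace Calkin

/-- The class of a bounded operator in the Calkin algebra. -/
def mk : (H →L[ℂ] H) →ₐ[ℂ] Calkin H := Ideal.Quotient.mkₐ ℂ (compactIdeal H)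

theorem mk_surjective : Function.Surjective (mk : (H →L[ℂ] H) →ₐ[ℂ] Calkin H) :=
  Ideal.Quotient.mk_surjective

theorem mk_eq_zero_iff {T : H →L[ℂ] H} : mk T = 0 ↔ IsCompactOperator T :=
  Ideal.Quotient.eq_zero_iff_mem (I := compactIdeal H)

theorem isCompactOperator_sub_of_mk_eq {S T : H →L[ℂ] H} (h : mk S = mk T) :
    IsCompactOperator (S - T) := by
  have := mk_eq_zero_iff (T := S - T)
  rw [map_sub, h, sub_self] at this
  exact this.1 rfl

theorem mk_eq_of_isCompactOperator_sub {S T : H →L[ℂ] H} (h : IsCompactOperator (S - T)) :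
    mk S = mk T := by
  have := mk_eq_zero_iff (T := S - T)
  rw [map_sub, sub_eq_zero] at this
  exact this.2 h

end Calkin

variable [CompleteSpace H]

/-- The adjoint of a compact operator is compact, being a norm limit of operators of finite rank. -/
theorem star_mem_compactIdeal {T : H →L[ℂ] H} (hT : T ∈ compactIdeal H) :
    star T ∈ compactIdeal H := by
  have hcl : IsClosed {S : H →L[ℂ] H | IsCompactOperator S} :=
    isClosed_setOfPred_isCompactOperator
  have : star T ∈ closure {S : H →L[ℂ] H | IsCompactOperator S} := by
    refine Metric.mem_closure_iff.2 fun ε hε => ?_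
    obtain ⟨U, hU, h⟩ := exists_finiteDimensional_norm_sub_starProjection_le hT (half_pos hε)
    refine ⟨star (U.starProjection ∘L T), ?_, ?_⟩
    · have : star (U.starProjection ∘L T) = star T * (U.starProjection ∘L 1) := by
        change star (U.starProjection * T) = star T * (U.starProjection * 1)
        rw [star_mul, mul_one, (isSelfAdjoint_starProjection U).star_eq]
      rw [this]
      exact (isCompactOperator_starProjection_comp U 1).clm_comp (star T)
    · rw [dist_eq_norm, ← star_sub, norm_star]
      linarith
  rwa [hcl.closure_eq] at this

instance isClosed_compactIdeal : IsClosed (compactIdeal H : Set (H →L[ℂ] H)) :=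
  isClosed_setOfPred_isCompactOperator

namespace Calkin

instance : NormedAddCommGroup (Calkin H) :=
  inferInstanceAs (NormedAddCommGroup ((H →L[ℂ] H) ⧸ compactIdeal H))

instance : CompleteSpace (Calkin H) :=
  inferInstanceAs (CompleteSpace ((H →L[ℂ] H) ⧸ compactIdeal H))

theorem norm_mk_le (T : H →L[ℂ] H) : ‖mk T‖ ≤ ‖T‖ :=
  Submodule.Quotient.norm_mk_le (compactIdeal H) T

theorem exists_mk_eq_norm_lt (x : Calkin H) {ε : ℝ} (hε : 0 < ε) :
    ∃ T, mk T = x ∧ ‖T‖ < ‖x‖ + ε :=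
  Submodule.Quotient.norm_mk_lt (S := compactIdeal H) x hε

instance : NormedRing (Calkin H) where
  dist_eq := dist_eq_norm_neg_add
  norm_mul_le x y := by
    have hc : ContinuousWithinAt (fun ε : ℝ => (‖x‖ + ε) * (‖y‖ + ε)) (Set.Ioi 0) 0 := by
      fun_prop
    have ht := hc.tendsto
    simp only [add_zero] at ht
    refine ge_of_tendsto ht (eventually_nhdsWithin_of_forall fun ε hε => ?_)
    obtain ⟨S, rfl, hS⟩ := exists_mk_eq_norm_lt x hε
    obtain ⟨T, rfl, hT⟩ := exists_mk_eq_norm_lt y hε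
    rw [← map_mul]
    refine (norm_mk_le _).trans ((norm_mul_le S T).trans ?_)
    exact mul_le_mul hS.le hT.le (norm_nonneg T) ((norm_nonneg S).trans hS.le)

instance : NormedAlgebra ℂ (Calkin H) where
  norm_smul_le c x := by
    have h := norm_smul_le (α := ℂ) (β := (H →L[ℂ] H) ⧸ compactIdeal H) c x
    exact h

instance : Star (Calkin H) := ⟨fun x => mk (star (Function.surjInv mk_surjective x))⟩

theorem star_mk (T : H →L[ℂ] H) : star (mk T) = mk (star T) := by
  refine mk_eq_of_isCompactOperator_sub ?_
  rw [← star_sub]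
  exact star_mem_compactIdeal
    (isCompactOperator_sub_of_mk_eq (Function.surjInv_eq mk_surjective (mk T)))

instance : StarRing (Calkin H) where
  star_involutive x := by
    obtain ⟨T, rfl⟩ := mk_surjective x
    rw [star_mk, star_mk, star_star]
  star_mul x y := by
    obtain ⟨S, rfl⟩ := mk_surjective x
    obtain ⟨T, rfl⟩ := mk_surjective y
    rw [← map_mul, star_mk, star_mk, star_mk, star_mul, map_mul]
  star_add x y := by
    obtain ⟨S, rfl⟩ := mk_surjective x
    obtain ⟨T, rfl⟩ := mk_surjective y
    rw [← map_add, star_mk, star_mk, star_mk, star_add, map_add]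

instance : StarModule ℂ (Calkin H) where
  star_smul c x := by
    obtain ⟨S, rfl⟩ := mk_surjective x
    rw [← map_smul, star_mk, star_mk, star_smul, map_smul]

/-- The `C*`-identity: if `S` represents `x* x`, a finite rank projection `P` almost fixes the range
of the compact operator `S - T* T`, and compressing by `1 - P` changes no class in the quotient. -/
instance : CStarRing (Calkin H) where
  norm_mul_self_le x := by
    obtain ⟨T, rfl⟩ := mk_surjective x
    refine le_of_forall_pos_le_add fun ε hε => ?_
    obtain ⟨S, hS, hSn⟩ := exists_mk_eq_norm_lt (star (mk T) * mk T) (half_pos hε)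
    rw [star_mk, ← map_mul] at hS
    obtain ⟨U, hU, hUk⟩ := exists_finiteDimensional_norm_sub_starProjection_le
      (isCompactOperator_sub_of_mk_eq hS) (half_pos hε)
    set Q : H →L[ℂ] H := 1 - U.starProjection with hQ
    have hQn : ‖Q‖ ≤ 1 := by
      have : Q = Uᗮ.starProjection := by rw [Submodule.starProjection_orthogonal']
      rw [this]
      exact Submodule.starProjection_norm_le _
    have hQs : star Q = Q := by
      rw [hQ, star_sub, star_one, (isSelfAdjoint_starProjection U).star_eq]
    have hTQ : mk T = mk (T * Q) := by
      refine mk_eq_of_isCompactOperator_sub ?_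
      have : T - T * Q = T * (U.starProjection ∘L 1) := by
        change T - T * Q = T * (U.starProjection * 1)
        rw [hQ]; noncomm_ring
      rw [this]
      exact (isCompactOperator_starProjection_comp U 1).clm_comp T
    have e : star (T * Q) * (T * Q) = Q * S * Q - Q * (S - star T * T) * Q := by
      rw [star_mul, hQs]; noncomm_ring
    have e2 : ‖Q * (S - star T * T)‖ ≤ ε / 2 := by
      have : Q * (S - star T * T) = (S - star T * T) - U.starProjection ∘L (S - star T * T) := by
        rw [hQ, sub_mul, one_mul]; rfl
      rw [this]; exact hUk
    calc ‖mk T‖ * ‖mk T‖ ≤ ‖T * Q‖ * ‖T * Q‖ := by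
          rw [hTQ]; gcongr <;> exact norm_mk_le _
      _ = ‖Q * S * Q - Q * (S - star T * T) * Q‖ := by rw [← CStarRing.norm_star_mul_self, e]
      _ ≤ ‖Q * S * Q‖ + ‖Q * (S - star T * T) * Q‖ := norm_sub_le _ _
      _ ≤ ‖S‖ + ε / 2 := by
          gcongr
          · calc ‖Q * S * Q‖ ≤ ‖Q‖ * ‖S‖ * ‖Q‖ := norm_mul₃_le
              _ ≤ 1 * ‖S‖ * 1 := by gcongr
              _ = ‖S‖ := by ring
          · calc ‖Q * (S - star T * T) * Q‖ ≤ ‖Q * (S - star T * T)‖ * ‖Q‖ := norm_mul_le _ _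
              _ ≤ ε / 2 * 1 := by gcongr
              _ = ε / 2 := mul_one _
      _ ≤ ‖star (mk T) * mk T‖ + ε := by linarith

instance : CStarAlgebra (Calkin H) where

/-- The quotient map to the Calkin algebra as a `*`-homomorphism. -/
def mkStar : (H →L[ℂ] H) →⋆ₐ[ℂ] Calkin H where
  __ := mk
  map_star' T := (star_mk T).symm

end Calkin

end Calkin

/-! ### Fredholm operators -/

open LinearMap.FiniteRangeSetoid in
/-- A compact perturbation `w` of the identity is invertible modulo operators of finite rank: if
`1 - w` is within distance `1` of an operator `f` of finite rank, then `w + f` is invertible. -/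
theorem exists_comp_equiv_id_of_isCompactOperator {E : Type*} [NormedAddCommGroup E]
    [InnerProductSpace ℂ E] [CompleteSpace E] {w : E →L[ℂ] E}
    (hk : IsCompactOperator (1 - w : E →L[ℂ] E)) :
    ∃ v : E →L[ℂ] E, (v * w).toLinearMap ≈ LinearMap.id ∧ (w * v).toLinearMap ≈ LinearMap.id := by
  obtain ⟨U, hU, h⟩ := exists_finiteDimensional_norm_sub_starProjection_le hk
    (show (0 : ℝ) < 1 / 2 by norm_num)
  set f : E →L[ℂ] E := U.starProjection * (1 - w) with hf
  have hu : IsUnit (w + f) := by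
    have : w + f = 1 - ((1 - w) - U.starProjection ∘L (1 - w)) := by
      change _ = 1 - ((1 - w) - f)
      abel
    rw [this]
    exact isUnit_one_sub_of_norm_lt_one (h.trans_lt (by norm_num))
  obtain ⟨u, hu⟩ := hu
  have hfin : ∀ a b : E →L[ℂ] E, (a * f * b).toLinearMap.HasFiniteRange := by
    intro a b
    have e : (a * f * b).toLinearMap = (a.toLinearMap ∘ₗ U.subtype) ∘ₗ
        (U.orthogonalProjectionOnto.toLinearMap ∘ₗ ((1 - w) * b).toLinearMap) := by
      ext x; rfl
    rw [LinearMap.HasFiniteRange, e]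
    have : FiniteDimensional ℂ (LinearMap.range (a.toLinearMap ∘ₗ U.subtype)) := inferInstance
    exact Submodule.FG.of_le (Module.Finite.iff_fg.1 this) (LinearMap.range_comp_le_range _ _)
  refine ⟨(↑u⁻¹ : E →L[ℂ] E), ?_, ?_⟩
  · rw [equiv_iff_hasFiniteRange]
    have e : (↑u⁻¹ * w : E →L[ℂ] E) - 1 = -↑u⁻¹ * f * 1 := by
      have h1 : (↑u⁻¹ : E →L[ℂ] E) * (w + f) = 1 := by rw [← hu, Units.inv_mul]
      have h2 : (↑u⁻¹ : E →L[ℂ] E) * w = 1 - ↑u⁻¹ * f := by rw [← h1]; noncomm_ring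
      rw [h2]; noncomm_ring
    have := hfin (-↑u⁻¹) 1
    rw [← e] at this
    exact this
  · rw [equiv_iff_hasFiniteRange]
    have e : (w * ↑u⁻¹ : E →L[ℂ] E) - 1 = (-1) * f * ↑u⁻¹ := by
      have h1 : (w + f) * (↑u⁻¹ : E →L[ℂ] E) = 1 := by rw [← hu, Units.mul_inv]
      have h2 : w * (↑u⁻¹ : E →L[ℂ] E) = 1 - f * ↑u⁻¹ := by rw [← h1]; noncomm_ring
      rw [h2]; noncomm_ring
    have := hfin (-1) ↑u⁻¹
    rw [← e] at this
    exact this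

open LinearMap.FiniteRangeSetoid in
/-- **Atkinson's theorem** (sufficiency): an operator between Hilbert spaces that is invertible
modulo compact operators is Fredholm. -/
theorem isFredholm_of_isCompactOperator {E F : Type*} [NormedAddCommGroup E]
    [InnerProductSpace ℂ E] [CompleteSpace E] [NormedAddCommGroup F]
    [InnerProductSpace ℂ F] [CompleteSpace F] {u : E →L[ℂ] F} {b : F →L[ℂ] E}
    (h₁ : IsCompactOperator (1 - b ∘L u : E →L[ℂ] E))
    (h₂ : IsCompactOperator (1 - u ∘L b : F →L[ℂ] F)) :
    u.IsFredholm := by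
  obtain ⟨v₁, hv₁, -⟩ := exists_comp_equiv_id_of_isCompactOperator h₁
  obtain ⟨v₂, -, hv₂⟩ := exists_comp_equiv_id_of_isCompactOperator h₂
  have hl : (v₁ ∘L b).toLinearMap ∘ₗ u.toLinearMap ≈ LinearMap.id := hv₁
  have hr : u.toLinearMap ∘ₗ (b ∘L v₂).toLinearMap ≈ LinearMap.id := hv₂
  -- A left and a right inverse modulo finite rank agree modulo finite rank.
  have hlr : (v₁ ∘L b).toLinearMap ≈ (b ∘L v₂).toLinearMap := by
    have h1 := equiv_comp_left (u' := (v₁ ∘L b).toLinearMap) hr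
    have h2 := equiv_comp_right (u := (b ∘L v₂).toLinearMap) hl
    exact Setoid.trans (Setoid.symm h1) h2
  refine ContinuousLinearMap.IsFredholm.of_isQuasiInverse (v := v₁ ∘L b) ⟨hl, ?_⟩
  exact Setoid.trans (equiv_comp_left hlr) hr

/-- Fredholm criterion for an operator between the ranges of two idempotents, in terms of a
parametrix on the ambient space. -/
theorem isFredholm_codRestrict_range {H : Type*} [NormedAddCommGroup H]
    [InnerProductSpace ℂ H] [CompleteSpace H] {D B P₁ P₂ : H →L[ℂ] H}
    (h₁ : P₁ * P₁ = P₁) (h₂ : P₂ * P₂ = P₂) (hD : D = P₂ * D * P₁)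
    (hl : IsCompactOperator (P₁ * B * D - P₁)) (hr : IsCompactOperator (D * B * P₂ - P₂))
    (hm : ∀ f : LinearMap.range P₁.toLinearMap,
      (D ∘L (LinearMap.range P₁.toLinearMap).subtypeL) f ∈ LinearMap.range P₂.toLinearMap) :
    ((D ∘L (LinearMap.range P₁.toLinearMap).subtypeL).codRestrict
      (LinearMap.range P₂.toLinearMap) hm).IsFredholm := by
  have fixed : ∀ {P : H →L[ℂ] H}, P * P = P → ∀ x ∈ LinearMap.range P.toLinearMap, P x = x := by
    rintro P hP _ ⟨y, rfl⟩
    exact congrArg (fun T : H →L[ℂ] H => T y) hP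
  have closed : ∀ {P : H →L[ℂ] H}, P * P = P →
      IsClosed (LinearMap.range P.toLinearMap : Set H) := by
    intro P hP
    have : (LinearMap.range P.toLinearMap : Set H) = {x | P x = x} :=
      Set.Subset.antisymm (fun x hx => fixed hP x hx) fun x hx => ⟨x, hx⟩
    rw [this]
    exact isClosed_eq P.continuous continuous_id
  have c1 := closed h₁
  have c2 := closed h₂
  have : CompleteSpace (LinearMap.range P₁.toLinearMap) := c1.completeSpace_coe
  have : CompleteSpace (LinearMap.range P₂.toLinearMap) := c2.completeSpace_coe
  have hDP : D * P₁ = D := by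
    conv_lhs => rw [hD, mul_assoc, h₁, ← hD]
  have hPD : P₂ * D = D := by
    conv_lhs => rw [hD, ← mul_assoc, ← mul_assoc, h₂, ← hD]
  have mem1 : ∀ x : LinearMap.range P₂.toLinearMap,
      (P₁ * B) x ∈ LinearMap.range P₁.toLinearMap := fun x => ⟨B x, rfl⟩
  let b : LinearMap.range P₂.toLinearMap →L[ℂ] LinearMap.range P₁.toLinearMap :=
    ((P₁ * B) ∘L (LinearMap.range P₂.toLinearMap).subtypeL).codRestrict _ mem1
  refine isFredholm_of_isCompactOperator (b := b) ?_ ?_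
  · have h : IsCompactOperator ((-(P₁ * B * D - P₁)) ∘L
        (LinearMap.range P₁.toLinearMap).subtypeL) := (hl.neg).comp_clm _
    have hmem : ∀ x, ((-(P₁ * B * D - P₁)) ∘L
        (LinearMap.range P₁.toLinearMap).subtypeL) x ∈ LinearMap.range P₁.toLinearMap := by
      intro x
      exact ⟨x - B (D x), by simp⟩
    refine (congrArg IsCompactOperator (funext fun x => Subtype.ext ?_)).mp
      (h.codRestrict hmem c1)
    simp [b, fixed h₁ x x.2]
    rfl
  · have h : IsCompactOperator ((-(D * B * P₂ - P₂)) ∘L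
        (LinearMap.range P₂.toLinearMap).subtypeL) := (hr.neg).comp_clm _
    have hmem : ∀ x, ((-(D * B * P₂ - P₂)) ∘L
        (LinearMap.range P₂.toLinearMap).subtypeL) x ∈ LinearMap.range P₂.toLinearMap := by
      intro x
      refine ⟨x - D (B x), ?_⟩
      have : P₂ (D (B x)) = D (B x) := congrArg (fun T : H →L[ℂ] H => T (B x)) hPD
      simp [this, fixed h₂ x x.2]
    refine (congrArg IsCompactOperator (funext fun x => Subtype.ext ?_)).mp
      (h.codRestrict hmem c2)
    have e : D (P₁ (B x)) = D (B x) := congrArg (fun T : H →L[ℂ] H => T (B x)) hDP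
    simp [b, fixed h₂ x x.2]
    exact e.symm

/-! ### The coherent state transform -/

section Transform

variable {n : ℕ}

theorem ofReal_inner_real (w v : Phase n) :
    ((⟪w, v⟫_ℝ : ℝ) : ℂ) = (⟪w, v⟫_ℂ + ⟪v, w⟫_ℂ) / 2 := by
  rw [← inner_conj_symm v w, Complex.add_conj]
  simp [PiLp.inner_apply]

theorem norm_sq_eq_inner (z : Phase n) : ((‖z‖ : ℝ) : ℂ) ^ 2 = ⟪z, z⟫_ℂ := by
  rw [inner_self_eq_norm_sq_to_K]; rfl

theorem inner_self_eq_ofReal (u : L2 n) : ⟪u, u⟫_ℂ = ((‖u‖ ^ 2 : ℝ) : ℂ) := by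
  rw [inner_self_eq_norm_sq_to_K]; push_cast; rfl

/-- The midpoint of two points of phase space. -/
def mid (a b : Phase n) : Phase n := (1 / 2 : ℂ) • (a + b)

/-- With respect to the midpoint of `a` and `b`, the product of overlaps `⟪φ_a, φ_z⟫ ⟪φ_z, φ_b⟫` is a
centred Gaussian with an oscillating factor of frequency `i (b - a)`. -/
theorem inner_coherent_mul_inner_coherent (a b ζ : Phase n) :
    ⟪coherent a, coherent (mid a b + ζ)⟫_ℂ * ⟪coherent (mid a b + ζ), coherent b⟫_ℂ =
      (π : ℂ) ^ ((n : ℂ) / 2) * ⟪coherent a, coherent b⟫_ℂ * cexp (‖I • (b - a)‖ ^ 2 / 8) *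
        cexp (-(1 / 2) * ‖ζ‖ ^ 2 + I / 2 * ⟪I • (b - a), ζ⟫_ℝ) := by
  rw [inner_coherent, inner_coherent, inner_coherent]
  rw [show ∀ x y z : ℂ, x * y * (x * z) = x * x * (y * z) from fun x y z => by ring,
    show ∀ x y z w : ℂ, x * (x * y) * z * w = x * x * (y * z * w) from fun x y z w => by ring,
    ← Complex.exp_add, ← Complex.exp_add, ← Complex.exp_add]
  congr 2
  rw [ofReal_inner_real]
  simp only [norm_sq_eq_inner, mid, inner_add_left, inner_add_right, inner_smul_left,
    inner_smul_right, inner_sub_left, inner_sub_right, map_div₀, map_one, map_ofNat, conj_I]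
  linear_combination ((⟪b, b⟫_ℂ - ⟪b, a⟫_ℂ - ⟪a, b⟫_ℂ + ⟪a, a⟫_ℂ) / 8 -
    (⟪ζ, b⟫_ℂ - ⟪ζ, a⟫_ℂ + ⟪a, ζ⟫_ℂ - ⟪b, ζ⟫_ℂ) / 4) * I_sq

/-- The constant in the resolution of the identity by coherent states. -/
def resConst (n : ℕ) : ℝ :=
  π ^ ((n : ℝ) / 2) * (2 * π) ^ ((Module.finrank ℝ (Phase n) : ℝ) / 2)

theorem resConst_pos (n : ℕ) : 0 < resConst n := by
  unfold resConst; positivity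

theorem ofReal_resConst (n : ℕ) : ((resConst n : ℝ) : ℂ) =
    (π : ℂ) ^ ((n : ℂ) / 2) * (π / (1 / 2 : ℂ)) ^ ((Module.finrank ℝ (Phase n) : ℂ) / 2) := by
  rw [resConst, ofReal_mul, ofReal_cpow Real.pi_pos.le, ofReal_cpow (by positivity)]
  push_cast
  congr 2
  ring

/-- The resolution of the identity, tested on coherent states. -/
theorem integral_inner_coherent_mul (a b : Phase n) :
    ∫ z, ⟪coherent a, coherent z⟫_ℂ * ⟪coherent z, coherent b⟫_ℂ =
      resConst n * ⟪coherent a, coherent b⟫_ℂ := by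
  rw [← integral_add_left_eq_self _ (mid a b)]
  simp only [inner_coherent_mul_inner_coherent]
  rw [integral_const_mul, GaussianFourier.integral_cexp_neg_mul_sq_norm_add (V := Phase n)
    (by norm_num) (I / 2) (I • (b - a)), ofReal_resConst]
  rw [show ∀ x y e g h : ℂ, x * y * e * (g * h) = x * g * y * (e * h) from
    fun x y e g h => by ring, ← Complex.exp_add]
  have : ((‖I • (b - a)‖ : ℝ) : ℂ) ^ 2 / 8 +
      (I / 2) ^ 2 * ((‖I • (b - a)‖ : ℝ) : ℂ) ^ 2 / (4 * (1 / 2)) = 0 := by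
    rw [div_pow, I_sq]; ring
  rw [this, Complex.exp_zero, mul_one]

theorem inner_coherent_ne_zero (a b : Phase n) : ⟪coherent a, coherent b⟫_ℂ ≠ 0 := by
  rw [inner_coherent]
  refine mul_ne_zero ?_ (Complex.exp_ne_zero _)
  rw [Complex.cpow_ne_zero_iff]
  exact Or.inl (by exact_mod_cast Real.pi_ne_zero)

theorem continuous_coherent : Continuous (coherent : Phase n → L2 n) := by
  rw [continuous_iff_continuousAt]
  intro z
  rw [ContinuousAt, tendsto_iff_norm_sub_tendsto_zero]
  have h : Filter.Tendsto (fun w : Phase n => ‖coherent w - coherent z‖ ^ 2) (nhds z) (nhds 0) := by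
    have e : ∀ w : Phase n, ‖coherent w - coherent z‖ ^ 2 =
        (⟪coherent w, coherent w⟫_ℂ - ⟪coherent w, coherent z⟫_ℂ - ⟪coherent z, coherent w⟫_ℂ
          + ⟪coherent z, coherent z⟫_ℂ).re := by
      intro w
      rw [← inner_self_eq_norm_sq (𝕜 := ℂ), inner_sub_sub_self]
      rfl
    simp only [e]
    have h2 : Continuous fun w : Phase n => (⟪coherent w, coherent w⟫_ℂ -
        ⟪coherent w, coherent z⟫_ℂ - ⟪coherent z, coherent w⟫_ℂ
          + ⟪coherent z, coherent z⟫_ℂ).re := by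
      simp only [inner_coherent]
      fun_prop
    convert h2.tendsto z using 2
    simp
  have := h.sqrt
  simpa using this

theorem continuous_inner_coherent (u : L2 n) : Continuous fun z : Phase n => ⟪coherent z, u⟫_ℂ :=
  continuous_coherent.inner continuous_const

theorem integrable_inner_coherent_mul (a b : Phase n) :
    Integrable fun z => ⟪coherent a, coherent z⟫_ℂ * ⟪coherent z, coherent b⟫_ℂ := by
  -- The integral of a function that is not integrable would be `0`, but this one is not.
  by_contra h
  have := integral_undef h
  rw [integral_inner_coherent_mul] at this
  exact mul_ne_zero (by exact_mod_cast (resConst_pos n).ne') (inner_coherent_ne_zero a b) this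

theorem lintegral_sq_inner_coherentComb (c : Phase n →₀ ℂ) :
    ∫⁻ z, ‖⟪coherent z, coherentComb n c⟫_ℂ‖ₑ ^ 2 =
      ENNReal.ofReal (resConst n * ‖coherentComb n c‖ ^ 2) := by
  have e : ∀ z, ⟪coherentComb n c, coherent z⟫_ℂ * ⟪coherent z, coherentComb n c⟫_ℂ =
      ∑ a ∈ c.support, ∑ b ∈ c.support, (starRingEnd ℂ) (c a) * c b *
        (⟪coherent a, coherent z⟫_ℂ * ⟪coherent z, coherent b⟫_ℂ) := by
    intro z
    simp only [coherentComb, Finsupp.linearCombination_apply, Finsupp.sum, sum_inner, inner_sum,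
      inner_smul_left, inner_smul_right, Finset.sum_mul_sum]
    exact Finset.sum_congr rfl fun a _ => Finset.sum_congr rfl fun b _ => by ring
  have e2 : ∀ z, ⟪coherentComb n c, coherent z⟫_ℂ * ⟪coherent z, coherentComb n c⟫_ℂ =
      ((‖⟪coherent z, coherentComb n c⟫_ℂ‖ ^ 2 : ℝ) : ℂ) := by
    intro z
    rw [← inner_conj_symm, Complex.conj_mul']
    push_cast; rfl
  have hi : Integrable fun z => ⟪coherentComb n c, coherent z⟫_ℂ * ⟪coherent z, coherentComb n c⟫_ℂ := by
    simp only [e]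
    exact integrable_finsetSum _ fun a _ => integrable_finsetSum _ fun b _ =>
      (integrable_inner_coherent_mul a b).const_mul _
  have hv : ∫ z, ⟪coherentComb n c, coherent z⟫_ℂ * ⟪coherent z, coherentComb n c⟫_ℂ =
      resConst n * ⟪coherentComb n c, coherentComb n c⟫_ℂ := by
    simp only [e]
    rw [integral_finsetSum _ fun a _ => integrable_finsetSum _ fun b _ =>
      (integrable_inner_coherent_mul a b).const_mul _]
    simp only [integral_finsetSum _ fun b _ => (integrable_inner_coherent_mul _ b).const_mul _,
      integral_const_mul, integral_inner_coherent_mul]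
    simp only [coherentComb, Finsupp.linearCombination_apply, Finsupp.sum, sum_inner, inner_sum,
      inner_smul_left, inner_smul_right, Finset.mul_sum]
    rw [Finset.sum_comm]
    exact Finset.sum_congr rfl fun a _ => Finset.sum_congr rfl fun b _ => by ring
  simp only [e2] at hi hv
  have hi' : Integrable fun z => ‖⟪coherent z, coherentComb n c⟫_ℂ‖ ^ 2 := by
    simpa using hi.norm
  rw [integral_complex_ofReal, inner_self_eq_ofReal] at hv
  have hv' : ∫ z, ‖⟪coherent z, coherentComb n c⟫_ℂ‖ ^ 2 = resConst n * ‖coherentComb n c‖ ^ 2 := by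
    exact_mod_cast hv
  rw [← hv', ofReal_integral_eq_lintegral_ofReal hi' (Filter.Eventually.of_forall fun z => by positivity)]
  refine lintegral_congr fun z => ?_
  rw [ENNReal.ofReal_pow (norm_nonneg _), ofReal_norm]

/-- The coherent state transform is bounded, by density of the span of coherent states and Fatou. -/
theorem lintegral_sq_inner_coherent_le (u : L2 n) :
    ∫⁻ z, ‖⟪coherent z, u⟫_ℂ‖ₑ ^ 2 ≤ ENNReal.ofReal (resConst n * ‖u‖ ^ 2) := by
  obtain ⟨x, hx, hlim⟩ := mem_closure_iff_seq_limit.1 (denseRange_coherentComb n u)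
  choose c hc using hx
  have h1 : ∀ z : Phase n, Filter.Tendsto (fun k => ‖⟪coherent z, coherentComb n (c k)⟫_ℂ‖ₑ ^ 2)
      Filter.atTop (nhds (‖⟪coherent z, u⟫_ℂ‖ₑ ^ 2)) := by
    intro z
    simp only [hc]
    have : Continuous fun v : L2 n => ‖⟪coherent z, v⟫_ℂ‖ₑ ^ 2 :=
      (ENNReal.continuous_pow 2).comp (continuous_const.inner continuous_id).enorm
    exact (this.tendsto u).comp hlim
  calc ∫⁻ z, ‖⟪coherent z, u⟫_ℂ‖ₑ ^ 2
      = ∫⁻ z, Filter.liminf (fun k => ‖⟪coherent z, coherentComb n (c k)⟫_ℂ‖ₑ ^ 2) Filter.atTop :=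
        lintegral_congr fun z => (h1 z).liminf_eq.symm
    _ ≤ Filter.liminf (fun k => ∫⁻ z, ‖⟪coherent z, coherentComb n (c k)⟫_ℂ‖ₑ ^ 2) Filter.atTop :=
        lintegral_liminf_le fun k =>
          (continuous_inner_coherent _).enorm.measurable.pow_const 2
    _ = ENNReal.ofReal (resConst n * ‖u‖ ^ 2) := by
        have e : ∀ k, ∫⁻ z, ‖⟪coherent z, coherentComb n (c k)⟫_ℂ‖ₑ ^ 2 =
            ENNReal.ofReal (resConst n * ‖x k‖ ^ 2) := by
          intro k
          rw [lintegral_sq_inner_coherentComb, hc]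
        simp only [e]
        refine Filter.Tendsto.liminf_eq ?_
        have : Continuous fun v : L2 n => ENNReal.ofReal (resConst n * ‖v‖ ^ 2) :=
          ENNReal.continuous_ofReal.comp (by fun_prop)
        exact (this.tendsto u).comp hlim

theorem memLp_inner_coherent (u : L2 n) : MemLp (fun z => ⟪coherent z, u⟫_ℂ) 2
    (volume : Measure (Phase n)) := by
  refine ⟨(continuous_inner_coherent u).aestronglyMeasurable, ?_⟩
  rw [eLpNorm_lt_top_iff_lintegral_rpow_enorm_lt_top (by norm_num) (by norm_num)]
  refine lt_of_le_of_lt ?_ (ENNReal.ofReal_lt_top (r := resConst n * ‖u‖ ^ 2))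
  refine le_trans (le_of_eq (lintegral_congr fun z => ?_)) (lintegral_sq_inner_coherent_le u)
  norm_num

/-- The coherent state transform `u ↦ (z ↦ ⟪φ_z, u⟫)`. -/
def transform (n : ℕ) : L2 n →L[ℂ] Lp ℂ 2 (volume : Measure (Phase n)) :=
  LinearMap.mkContinuous
    { toFun := fun u => (memLp_inner_coherent u).toLp _
      map_add' := fun u v => by
        rw [← MemLp.toLp_add]
        exact MemLp.toLp_congr _ _ (Filter.Eventually.of_forall fun z => inner_add_right _ _ _)
      map_smul' := fun c u => by
        rw [RingHom.id_apply, ← MemLp.toLp_const_smul]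
        exact MemLp.toLp_congr _ _ (Filter.Eventually.of_forall fun z => inner_smul_right _ _ _) }
    (√(resConst n)) (fun u => by
      simp only [LinearMap.coe_mk, AddHom.coe_mk]
      rw [Lp.norm_toLp, eLpNorm_eq_lintegral_rpow_enorm_toReal (by norm_num) (by norm_num)]
      refine ENNReal.toReal_le_of_le_ofReal (by positivity) ?_
      have h := lintegral_sq_inner_coherent_le u
      have e : ENNReal.ofReal (√(resConst n) * ‖u‖) =
          ENNReal.ofReal (resConst n * ‖u‖ ^ 2) ^ (1 / (2 : ℝ)) := by
        rw [ENNReal.ofReal_rpow_of_nonneg (by have := resConst_pos n; positivity) (by norm_num),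
          ← Real.sqrt_eq_rpow, Real.sqrt_mul (resConst_pos n).le, Real.sqrt_sq (norm_nonneg u)]
      rw [e]
      have e2 : (ENNReal.toReal 2) = 2 := by norm_num
      rw [e2]
      refine ENNReal.rpow_le_rpow ?_ (by norm_num)
      refine le_trans (le_of_eq (lintegral_congr fun z => ?_)) h
      norm_num)

theorem transform_ae (u : L2 n) : transform n u =ᵐ[volume] fun z => ⟪coherent z, u⟫_ℂ :=
  (memLp_inner_coherent u).coeFn_toLp

theorem integrable_inner_mul_inner (u v : L2 n) :
    Integrable fun z => ⟪u, coherent z⟫_ℂ * ⟪coherent z, v⟫_ℂ := by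
  refine (L2.integrable_inner (𝕜 := ℂ) (transform n u) (transform n v)).congr ?_
  filter_upwards [transform_ae u, transform_ae v] with z h1 h2
  rw [h1, h2, RCLike.inner_apply, inner_conj_symm, mul_comm]

theorem inner_transform (u v : L2 n) : ⟪transform n u, transform n v⟫_ℂ =
    ∫ z, ⟪u, coherent z⟫_ℂ * ⟪coherent z, v⟫_ℂ := by
  rw [L2.inner_def]
  refine integral_congr_ae ?_
  filter_upwards [transform_ae u, transform_ae v] with z h1 h2
  rw [h1, h2, RCLike.inner_apply, inner_conj_symm, mul_comm]

theorem adjoint_transform_comp_transform :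
    (transform n).adjoint ∘L transform n = (resConst n : ℂ) • ContinuousLinearMap.id ℂ (L2 n) := by
  refine ext_coherent fun b => ?_
  have key : (innerSL ℂ ((transform n).adjoint (transform n (coherent b)))) =
      innerSL ℂ ((resConst n : ℂ) • coherent b) := by
    refine ext_coherent fun a => ?_
    simp only [innerSL_apply_apply]
    rw [ContinuousLinearMap.adjoint_inner_left, inner_transform, integral_inner_coherent_mul,
      inner_smul_left, conj_ofReal]
  refine ext_inner_right ℂ fun v => ?_
  exact congrArg (fun S : L2 n →L[ℂ] ℂ => S v) key

/-- The resolution of the identity by coherent states. -/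
theorem integral_inner_mul_inner (u v : L2 n) :
    ∫ z, ⟪u, coherent z⟫_ℂ * ⟪coherent z, v⟫_ℂ = resConst n * ⟪u, v⟫_ℂ := by
  rw [← inner_transform, ← ContinuousLinearMap.adjoint_inner_right,
    ← ContinuousLinearMap.comp_apply, adjoint_transform_comp_transform]
  change ⟪u, (resConst n : ℂ) • v⟫_ℂ = _
  rw [inner_smul_right]

theorem integral_sq_inner_coherent (u : L2 n) :
    ∫ z, ‖⟪coherent z, u⟫_ℂ‖ ^ 2 = resConst n * ‖u‖ ^ 2 := by
  have h := integral_inner_mul_inner u u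
  have e2 : ∀ z, ⟪u, coherent z⟫_ℂ * ⟪coherent z, u⟫_ℂ = ((‖⟪coherent z, u⟫_ℂ‖ ^ 2 : ℝ) : ℂ) := by
    intro z
    rw [← inner_conj_symm, Complex.conj_mul']
    push_cast; rfl
  simp only [e2] at h
  rw [integral_complex_ofReal, inner_self_eq_ofReal] at h
  exact_mod_cast h

theorem integrable_sq_inner_coherent (u : L2 n) :
    Integrable fun z => ‖⟪coherent z, u⟫_ℂ‖ ^ 2 :=
  (memLp_two_iff_integrable_sq_norm (continuous_inner_coherent u).aestronglyMeasurable).1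
    (memLp_inner_coherent u)

end Transform

/-! ### Anti-Wick quantization -/

section AntiWick

open scoped BoundedContinuousFunction

variable {n : ℕ}

theorem memLp_bcf_mul (F : Phase n →ᵇ ℂ) (u : Lp ℂ 2 (volume : Measure (Phase n))) :
    MemLp (fun z => F z * u z) 2 (volume : Measure (Phase n)) := by
  refine (Lp.memLp u).of_le_mul (c := ‖F‖)
    (F.continuous.aestronglyMeasurable.mul (Lp.aestronglyMeasurable u))
    (Filter.Eventually.of_forall fun z => ?_)
  rw [norm_mul]
  gcongr
  exact F.norm_coe_le_norm z

/-- Multiplication by a bounded continuous function on `L²` of phase space. -/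
def mulOp (F : Phase n →ᵇ ℂ) :
    Lp ℂ 2 (volume : Measure (Phase n)) →L[ℂ] Lp ℂ 2 (volume : Measure (Phase n)) :=
  LinearMap.mkContinuous
    { toFun := fun u => (memLp_bcf_mul F u).toLp _
      map_add' := fun u v => by
        rw [← MemLp.toLp_add]
        refine MemLp.toLp_congr _ _ ?_
        filter_upwards [Lp.coeFn_add u v] with z h
        rw [h, Pi.add_apply, Pi.add_apply, mul_add]
      map_smul' := fun c u => by
        rw [RingHom.id_apply, ← MemLp.toLp_const_smul]
        refine MemLp.toLp_congr _ _ ?_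
        filter_upwards [Lp.coeFn_smul c u] with z h
        rw [h, Pi.smul_apply, Pi.smul_apply, smul_eq_mul, smul_eq_mul, mul_left_comm] }
    ‖F‖ (fun u => by
      refine Lp.norm_le_mul_norm_of_ae_le_mul ?_
      filter_upwards [(memLp_bcf_mul F u).coeFn_toLp] with z h
      simp only [LinearMap.coe_mk, AddHom.coe_mk]
      rw [h, norm_mul]
      gcongr
      exact F.norm_coe_le_norm z)

theorem mulOp_ae (F : Phase n →ᵇ ℂ) (u : Lp ℂ 2 (volume : Measure (Phase n))) :
    mulOp F u =ᵐ[volume] fun z => F z * u z :=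
  (memLp_bcf_mul F u).coeFn_toLp

/-- The anti-Wick operator `c⁻¹ ∫ F(z) ⟪φ_z, ·⟫ φ_z dz` with bounded continuous symbol `F`. -/
def antiWick (F : Phase n →ᵇ ℂ) : L2 n →L[ℂ] L2 n :=
  (resConst n : ℂ)⁻¹ • ((transform n).adjoint ∘L mulOp F ∘L transform n)

theorem resConst_ne_zero : (resConst n : ℂ) ≠ 0 := by exact_mod_cast (resConst_pos n).ne'

theorem integrable_bcf_mul_inner (F : Phase n →ᵇ ℂ) (u v : L2 n) :
    Integrable fun z => F z * (⟪u, coherent z⟫_ℂ * ⟪coherent z, v⟫_ℂ) :=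
  (integrable_inner_mul_inner u v).bdd_mul F.continuous.aestronglyMeasurable
    (Filter.Eventually.of_forall F.norm_coe_le_norm)

theorem inner_antiWick (F : Phase n →ᵇ ℂ) (u v : L2 n) : ⟪u, antiWick F v⟫_ℂ =
    (resConst n : ℂ)⁻¹ * ∫ z, F z * (⟪u, coherent z⟫_ℂ * ⟪coherent z, v⟫_ℂ) := by
  change ⟪u, (resConst n : ℂ)⁻¹ • (transform n).adjoint (mulOp F (transform n v))⟫_ℂ = _
  rw [inner_smul_right, ContinuousLinearMap.adjoint_inner_right, L2.inner_def]
  congr 1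
  refine integral_congr_ae ?_
  filter_upwards [transform_ae u, transform_ae v, mulOp_ae F (transform n v)] with z h1 h2 h3
  rw [h1, h3, h2, RCLike.inner_apply, inner_conj_symm]
  ring

theorem antiWick_add (F G : Phase n →ᵇ ℂ) : antiWick (F + G) = antiWick F + antiWick G := by
  refine ContinuousLinearMap.ext fun v => ext_inner_left ℂ fun u => ?_
  change _ = ⟪u, antiWick F v + antiWick G v⟫_ℂ
  rw [inner_add_right, inner_antiWick, inner_antiWick, inner_antiWick, ← mul_add,
    ← integral_add (integrable_bcf_mul_inner F u v) (integrable_bcf_mul_inner G u v)]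
  simp only [BoundedContinuousFunction.coe_add, Pi.add_apply, add_mul]

theorem antiWick_smul (c : ℂ) (F : Phase n →ᵇ ℂ) : antiWick (c • F) = c • antiWick F := by
  refine ContinuousLinearMap.ext fun v => ext_inner_left ℂ fun u => ?_
  change _ = ⟪u, c • antiWick F v⟫_ℂ
  rw [inner_smul_right, inner_antiWick, inner_antiWick, mul_left_comm]
  congr 1
  rw [← integral_const_mul]
  simp only [BoundedContinuousFunction.coe_smul, smul_eq_mul, mul_assoc]

theorem antiWick_sub (F G : Phase n →ᵇ ℂ) : antiWick (F - G) = antiWick F - antiWick G := by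
  rw [sub_eq_add_neg, sub_eq_add_neg, ← neg_one_smul ℂ G, antiWick_add, antiWick_smul, neg_one_smul]

theorem antiWick_one : antiWick (1 : Phase n →ᵇ ℂ) = 1 := by
  refine ContinuousLinearMap.ext fun v => ext_inner_left ℂ fun u => ?_
  rw [inner_antiWick]
  simp only [BoundedContinuousFunction.coe_one, Pi.one_apply, one_mul]
  rw [integral_inner_mul_inner, inv_mul_cancel_left₀ resConst_ne_zero]
  rfl

theorem antiWick_star (F : Phase n →ᵇ ℂ) : antiWick (star F) = star (antiWick F) := by
  refine ContinuousLinearMap.ext fun v => ext_inner_left ℂ fun u => ?_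
  rw [ContinuousLinearMap.star_eq_adjoint, ContinuousLinearMap.adjoint_inner_right,
    ← inner_conj_symm (antiWick F u) v, inner_antiWick, inner_antiWick, map_mul, map_inv₀, conj_ofReal,
    ← integral_conj]
  congr 1
  refine integral_congr_ae (Filter.Eventually.of_forall fun z => ?_)
  simp only [BoundedContinuousFunction.star_apply, map_mul, inner_conj_symm]
  rw [mul_comm ⟪u, coherent z⟫_ℂ]
  rfl

/-- Anti-Wick quantization is exactly covariant, since `R_g` permutes the coherent states. -/
theorem conj_antiWick (g : U n) (F F' : Phase n →ᵇ ℂ) (h : ∀ z, F' (act n g z) = F z) :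
    (R n g : L2 n →L[ℂ] L2 n) * antiWick F * star (R n g : L2 n →L[ℂ] L2 n) = antiWick F' := by
  refine ContinuousLinearMap.ext fun v => ext_inner_left ℂ fun u => ?_
  have hmp := (actReal g).measurePreserving
  have hme : MeasurableEmbedding (actReal g) := (actReal g).toHomeomorph.measurableEmbedding
  have e1 : ⟪u, ((R n g : L2 n →L[ℂ] L2 n) * antiWick F * star (R n g : L2 n →L[ℂ] L2 n)) v⟫_ℂ =
      ⟪star (R n g : L2 n →L[ℂ] L2 n) u, antiWick F (star (R n g : L2 n →L[ℂ] L2 n) v)⟫_ℂ := by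
    rw [ContinuousLinearMap.star_eq_adjoint, ContinuousLinearMap.adjoint_inner_left]
    rfl
  rw [e1, inner_antiWick, inner_antiWick, ← hmp.integral_comp hme
    (fun z => F' z * (⟪u, coherent z⟫_ℂ * ⟪coherent z, v⟫_ℂ))]
  congr 1
  refine integral_congr_ae (Filter.Eventually.of_forall fun z => ?_)
  simp only
  rw [ContinuousLinearMap.star_eq_adjoint, ContinuousLinearMap.adjoint_inner_left,
    ContinuousLinearMap.adjoint_inner_right, R_coherent]
  change _ = F' (act n g z) * (⟪u, coherent (act n g z)⟫_ℂ * ⟪coherent (act n g z), v⟫_ℂ)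
  rw [h]

theorem isCompactOperator_smulRight (x y : L2 n) :
    IsCompactOperator ((innerSL ℂ y).smulRight x) :=
  (isCompactOperator_of_locallyCompactSpace_dom (innerSL ℂ y)).clm_comp
    (ContinuousLinearMap.toSpanSingleton ℂ x)

/-- An anti-Wick operator with compactly supported symbol is a norm convergent integral of rank one
operators, hence compact. -/
theorem isCompactOperator_antiWick_of_hasCompactSupport {F : Phase n →ᵇ ℂ}
    (hF : HasCompactSupport F) : IsCompactOperator (antiWick F) := by
  set k : Phase n → L2 n →L[ℂ] L2 n := fun z =>
    F z • (innerSL ℂ (coherent z)).smulRight (coherent z) with hk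
  have hr : Continuous fun z : Phase n => (innerSL ℂ (coherent z)).smulRight (coherent z) :=
    (ContinuousLinearMap.smulRightL ℂ (L2 n) (L2 n)).continuous₂.comp
      (((innerSL ℂ).continuous.comp continuous_coherent).prodMk continuous_coherent)
  have hkc : Continuous k := F.continuous.smul hr
  have hki : Integrable k := hkc.integrable_of_hasCompactSupport hF.smul_right
  have e : antiWick F = (resConst n : ℂ)⁻¹ • ∫ z, k z := by
    refine ContinuousLinearMap.ext fun v => ext_inner_left ℂ fun u => ?_
    change _ = ⟪u, (resConst n : ℂ)⁻¹ • (∫ z, k z) v⟫_ℂ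
    rw [inner_smul_right, inner_antiWick, ContinuousLinearMap.integral_apply hki,
      ← integral_inner (hki.apply_continuousLinearMap v)]
    congr 1
    refine integral_congr_ae (Filter.Eventually.of_forall fun z => ?_)
    simp only [hk]
    change _ = ⟪u, F z • ⟪coherent z, v⟫_ℂ • coherent z⟫_ℂ
    rw [inner_smul_right, inner_smul_right,
      mul_comm ⟪u, coherent z⟫_ℂ]
  let mkL : (L2 n →L[ℂ] L2 n) →L[ℂ] Calkin (L2 n) :=
    LinearMap.mkContinuous Calkin.mk.toLinearMap 1 fun T => by
      rw [one_mul]; exact Calkin.norm_mk_le T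
  rw [← Calkin.mk_eq_zero_iff, e, map_smul]
  have : mkL (∫ z, k z) = 0 := by
    rw [← mkL.integral_comp_comm hki]
    have h0 : ∀ z, mkL (k z) = 0 := fun z =>
      Calkin.mk_eq_zero_iff.2 ((isCompactOperator_smulRight _ _).smul (F z))
    simp only [h0, integral_zero]
  change _ • mkL (∫ z, k z) = 0
  rw [this, smul_zero]

end AntiWick

/-! ### Schur estimates -/

theorem exists_one_add_pow_mul_exp_le (k : ℕ) {β : ℝ} (hβ : 0 < β) :
    ∃ C : ℝ, 0 ≤ C ∧ ∀ t : ℝ, 0 ≤ t → (1 + t) ^ k * rexp (-β * t ^ 2) ≤ C := by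
  refine ⟨k.factorial * rexp (1 + 1 / (4 * β)), by positivity, fun t ht => ?_⟩
  have h := Real.pow_div_factorial_le_exp (1 + t) (by positivity) k
  rw [div_le_iff₀ (by positivity)] at h
  calc (1 + t) ^ k * rexp (-β * t ^ 2) ≤ rexp (1 + t) * k.factorial * rexp (-β * t ^ 2) := by gcongr
    _ = k.factorial * rexp ((1 + t) + -β * t ^ 2) := by rw [Real.exp_add (1 + t)]; ring
    _ ≤ k.factorial * rexp (1 + 1 / (4 * β)) := by
        refine mul_le_mul_of_nonneg_left (Real.exp_le_exp.2 ?_) (by positivity)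
        have h2 : 1 / (4 * β) - t + β * t ^ 2 = β * (t - 1 / (2 * β)) ^ 2 := by
          field_simp; ring
        nlinarith [mul_nonneg hβ.le (sq_nonneg (t - 1 / (2 * β)))]

theorem integrable_one_add_norm_pow_mul_exp {V : Type*} [NormedAddCommGroup V]
    [InnerProductSpace ℝ V] [FiniteDimensional ℝ V] [MeasurableSpace V] [BorelSpace V]
    (k : ℕ) {β : ℝ} (hβ : 0 < β) :
    Integrable fun v : V => (1 + ‖v‖) ^ k * rexp (-β * ‖v‖ ^ 2) := by
  set N := Module.finrank ℝ V + 1 with hN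
  obtain ⟨C, hC0, hC⟩ := exists_one_add_pow_mul_exp_le (k + N) hβ
  have hi : Integrable fun v : V => C * (1 + ‖v‖) ^ (-(N : ℝ)) :=
    (integrable_one_add_norm (by rw [hN]; push_cast; linarith)).const_mul C
  refine hi.mono' (Continuous.aestronglyMeasurable (by fun_prop))
    (Filter.Eventually.of_forall fun v => ?_)
  have h1 : 0 < 1 + ‖v‖ := by positivity
  rw [Real.norm_of_nonneg (by positivity), Real.rpow_neg h1.le, Real.rpow_natCast,
    ← div_eq_mul_inv, le_div_iff₀ (by positivity)]
  have := hC ‖v‖ (norm_nonneg v)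
  rw [pow_add] at this
  linarith

section Schur

variable {n : ℕ}

theorem norm_inner_coherent (a b : Phase n) :
    ‖⟪coherent a, coherent b⟫_ℂ‖ = π ^ ((n : ℝ) / 2) * rexp (-(1 / 4) * ‖b - a‖ ^ 2) := by
  rw [inner_coherent, norm_mul, Complex.norm_exp]
  congr 1
  · have : (π : ℂ) ^ ((n : ℂ) / 2) = ((π ^ ((n : ℝ) / 2) : ℝ) : ℂ) := by
      rw [ofReal_cpow Real.pi_pos.le]; push_cast; rfl
    rw [this, Complex.norm_real, Real.norm_of_nonneg (by positivity)]
  · congr 1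
    have h := norm_sub_sq (𝕜 := ℂ) b a
    rw [h]
    have h1 : (-(((‖a‖ : ℝ) : ℂ) ^ 2 + ((‖b‖ : ℝ) : ℂ) ^ 2) / 4 + ⟪b, a⟫_ℂ / 2).re =
        -(‖a‖ ^ 2 + ‖b‖ ^ 2) / 4 + (⟪b, a⟫_ℂ).re / 2 := by
      rw [← ofReal_pow, ← ofReal_pow, ← ofReal_add, ← ofReal_neg, ← ofReal_ofNat, ← ofReal_div,
        add_re, ofReal_re, ← ofReal_ofNat, div_ofReal_re]
    rw [h1]
    change _ = -(1 / 4) * (‖b‖ ^ 2 - 2 * (⟪b, a⟫_ℂ).re + ‖a‖ ^ 2)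
    ring

/-- Convolution kernels integrate a function of one of the two variables to a multiple of its
integral. -/
theorem lintegral_lintegral_conv_mul_add {K f g : Phase n → ℝ≥0∞} (hK : Measurable K)
    (hf : Measurable f) (hg : Measurable g) :
    ∫⁻ b, ∫⁻ a, K (b - a) * (f b + g a) = (∫⁻ a, K a) * ((∫⁻ b, f b) + ∫⁻ a, g a) := by
  have hK1 : ∀ b, Measurable fun a => K (b - a) := fun b => hK.comp (measurable_const.sub measurable_id)
  simp only [mul_add]
  simp only [lintegral_add_left ((hK1 _).mul_const _)]
  rw [lintegral_add_left]
  · congr 1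
    · simp only [lintegral_mul_const _ (hK1 _), lintegral_sub_left_eq_self K]
      rw [lintegral_const_mul _ hf]
    · rw [lintegral_lintegral_swap]
      · have hK2 : ∀ a, Measurable fun b => K (b - a) :=
          fun a => hK.comp (measurable_id.sub measurable_const)
        simp only [lintegral_mul_const _ (hK2 _), lintegral_sub_right_eq_self K]
        rw [lintegral_const_mul _ hg]
      · exact ((hK.comp (measurable_fst.sub measurable_snd)).mul
          (hg.comp measurable_snd)).aemeasurable
  · simp only [lintegral_mul_const _ (hK1 _), lintegral_sub_left_eq_self K]
    exact hf.const_mul _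

/-- **Schur test** for operators given by integral kernels with respect to coherent states. -/
theorem norm_le_of_lintegral_kernel_le {T : L2 n →L[ℂ] L2 n} {K : Phase n → ℝ} (hK0 : ∀ z, 0 ≤ K z)
    (hK : Integrable K) (hKm : Measurable K)
    (h : ∀ u v, ‖⟪v, T u⟫_ℂ‖ₑ ≤ ∫⁻ b, ∫⁻ a, ENNReal.ofReal
      (K (b - a) * (‖⟪coherent b, v⟫_ℂ‖ * ‖⟪coherent a, u⟫_ℂ‖))) :
    ‖T‖ ≤ resConst n * ∫ z, K z := by
  have hI0 : 0 ≤ ∫ z, K z := integral_nonneg hK0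
  have hc := resConst_pos n
  have main : ∀ u v, ‖⟪v, T u⟫_ℂ‖ ≤ (∫ z, K z) * (resConst n * (‖v‖ ^ 2 + ‖u‖ ^ 2) / 2) := by
    intro u v
    have hm : ∀ w : L2 n, Measurable fun z => ENNReal.ofReal (‖⟪coherent z, w⟫_ℂ‖ ^ 2 / 2) :=
      fun w => (((continuous_inner_coherent w).norm.pow 2).div_const 2).measurable.ennreal_ofReal
    have hint : ∀ w : L2 n, ∫⁻ z, ENNReal.ofReal (‖⟪coherent z, w⟫_ℂ‖ ^ 2 / 2) =
        ENNReal.ofReal (resConst n * ‖w‖ ^ 2 / 2) := by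
      intro w
      rw [← ofReal_integral_eq_lintegral_ofReal ((integrable_sq_inner_coherent w).div_const 2)
        (Filter.Eventually.of_forall fun z => by positivity), integral_div,
        integral_sq_inner_coherent]
    -- Split the product of the two transforms by `x y ≤ x² / 2 + y² / 2`.
    have h1 : ‖⟪v, T u⟫_ℂ‖ₑ ≤ ∫⁻ b, ∫⁻ a, ENNReal.ofReal (K (b - a)) *
        (ENNReal.ofReal (‖⟪coherent b, v⟫_ℂ‖ ^ 2 / 2) +
          ENNReal.ofReal (‖⟪coherent a, u⟫_ℂ‖ ^ 2 / 2)) := by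
      refine (h u v).trans (lintegral_mono fun b => lintegral_mono fun a => ?_)
      rw [← ENNReal.ofReal_add (by positivity) (by positivity), ← ENNReal.ofReal_mul (hK0 _)]
      refine ENNReal.ofReal_le_ofReal (mul_le_mul_of_nonneg_left ?_ (hK0 _))
      nlinarith [sq_nonneg (‖⟪coherent b, v⟫_ℂ‖ - ‖⟪coherent a, u⟫_ℂ‖)]
    rw [lintegral_lintegral_conv_mul_add (K := fun z => ENNReal.ofReal (K z)) hKm.ennreal_ofReal
      (hm v) (hm u), hint, hint, ← ofReal_integral_eq_lintegral_ofReal hK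
      (Filter.Eventually.of_forall hK0), ← ENNReal.ofReal_add (by positivity) (by positivity),
      ← ENNReal.ofReal_mul hI0, ← ofReal_norm,
      ENNReal.ofReal_le_ofReal_iff (by positivity)] at h1
    refine h1.trans (le_of_eq ?_)
    ring
  refine ContinuousLinearMap.opNorm_le_of_unit_norm (by positivity) fun u hu => ?_
  by_cases h0 : T u = 0
  · rw [h0, norm_zero]; positivity
  have hn : ‖T u‖ ≠ 0 := norm_ne_zero_iff.2 h0
  have := main u (((‖T u‖⁻¹ : ℝ) : ℂ) • T u)
  rw [inner_smul_left, conj_ofReal, inner_self_eq_ofReal, ← ofReal_mul, Complex.norm_real,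
    norm_smul, Complex.norm_real, norm_inv, norm_norm, inv_mul_cancel₀ hn, hu,
    show ‖T u‖⁻¹ * ‖T u‖ ^ 2 = ‖T u‖ by field_simp, norm_norm] at this
  linarith

theorem enorm_integral_integral_le (k : Phase n → Phase n → ℂ) :
    ‖∫ b, ∫ a, k b a‖ₑ ≤ ∫⁻ b, ∫⁻ a, ‖k b a‖ₑ :=
  (enorm_integral_le_lintegral_enorm _).trans
    (lintegral_mono fun _ => enorm_integral_le_lintegral_enorm _)

theorem inner_eq_integral_inner (S : L2 n →L[ℂ] L2 n) (v u : L2 n) : ⟪v, S u⟫_ℂ =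
    (resConst n : ℂ)⁻¹ * ∫ a, ⟪v, S (coherent a)⟫_ℂ * ⟪coherent a, u⟫_ℂ := by
  have h := integral_inner_mul_inner (S.adjoint v) u
  simp only [ContinuousLinearMap.adjoint_inner_left] at h
  rw [h, inv_mul_cancel_left₀ resConst_ne_zero]

open scoped BoundedContinuousFunction

/-- The operator `antiWick F * S` in terms of the kernel `⟪φ_b, S φ_a⟫`. -/
theorem inner_antiWick_mul (F : Phase n →ᵇ ℂ) (S : L2 n →L[ℂ] L2 n) (v u : L2 n) :
    ⟪v, (antiWick F * S) u⟫_ℂ = ∫ b, ∫ a, (resConst n : ℂ)⁻¹ * (resConst n : ℂ)⁻¹ *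
      (F b * ⟪coherent b, S (coherent a)⟫_ℂ * (⟪v, coherent b⟫_ℂ * ⟪coherent a, u⟫_ℂ)) := by
  change ⟪v, antiWick F (S u)⟫_ℂ = _
  rw [inner_antiWick, ← integral_const_mul]
  refine integral_congr_ae (Filter.Eventually.of_forall fun b => ?_)
  simp only
  rw [inner_eq_integral_inner S (coherent b) u, ← mul_assoc, ← mul_assoc, ← mul_assoc,
    ← integral_const_mul]
  refine integral_congr_ae (Filter.Eventually.of_forall fun a => ?_)
  simp only
  ring

/-- The continuous cutoff equal to `1` on the ball of radius `m` and to `0` off the ball of radius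
`m + 1`. -/
def cutoff (n m : ℕ) : Phase n →ᵇ ℂ := BoundedContinuousFunction.ofNormedAddCommGroup
  (fun z => ((max 0 (min 1 (m + 1 - ‖z‖)) : ℝ) : ℂ)) (by fun_prop) 1 (fun z => by
    rw [Complex.norm_real, Real.norm_of_nonneg (le_max_left _ _)]
    exact max_le zero_le_one (min_le_left _ _))

theorem cutoff_apply (m : ℕ) (z : Phase n) :
    cutoff n m z = ((max 0 (min 1 (m + 1 - ‖z‖)) : ℝ) : ℂ) := rfl

theorem hasCompactSupport_cutoff (m : ℕ) : HasCompactSupport (cutoff n m) := by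
  refine HasCompactSupport.of_support_subset_isCompact (isCompact_closedBall 0 ((m : ℝ) + 1)) ?_
  intro z hz
  rw [Function.mem_support, cutoff_apply, ofReal_ne_zero] at hz
  rw [mem_closedBall_zero_iff]
  by_contra hlt
  refine hz (max_eq_left ((min_le_right _ _).trans ?_))
  linarith

theorem norm_one_sub_cutoff_mul_le (m : ℕ) (b : Phase n) :
    ‖(1 - cutoff n m) b‖ * (1 + ‖b‖)⁻¹ ≤ (1 + (m : ℝ))⁻¹ := by
  have e1 : (1 - cutoff n m) b = ((1 - max 0 (min 1 (m + 1 - ‖b‖)) : ℝ) : ℂ) := by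
    change 1 - cutoff n m b = _
    rw [cutoff_apply]; push_cast; rfl
  rw [e1, Complex.norm_real]
  by_cases hbm : ‖b‖ ≤ m
  · rw [min_eq_left (by linarith), max_eq_right zero_le_one, sub_self, norm_zero, zero_mul]
    positivity
  · have h01 : |1 - max 0 (min 1 ((m : ℝ) + 1 - ‖b‖))| ≤ 1 := by
      have h0 : 0 ≤ max 0 (min 1 ((m : ℝ) + 1 - ‖b‖)) := le_max_left _ _
      have h1 : max 0 (min 1 ((m : ℝ) + 1 - ‖b‖)) ≤ 1 := max_le zero_le_one (min_le_left _ _)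
      rw [abs_le]
      constructor <;> linarith
    rw [Real.norm_eq_abs]
    calc _ ≤ 1 * (1 + ‖b‖)⁻¹ := by gcongr
      _ ≤ (1 + (m : ℝ))⁻¹ := by
        rw [one_mul]
        gcongr
        linarith

/-- An operator whose coherent state kernel decays off the diagonal, and tends to zero along it,
is compact: it is the norm limit of its products with compact anti-Wick cutoffs. -/
theorem isCompactOperator_of_kernel_decay {S : L2 n →L[ℂ] L2 n} {C : ℝ} (hC : 0 ≤ C)
    (h : ∀ a b : Phase n, ‖⟪coherent b, S (coherent a)⟫_ℂ‖ ≤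
      C * (1 + ‖b‖)⁻¹ * (1 + ‖b - a‖) ^ (-((Module.finrank ℝ (Phase n) + 1 : ℕ) : ℝ))) :
    IsCompactOperator S := by
  set N : ℝ := ((Module.finrank ℝ (Phase n) + 1 : ℕ) : ℝ) with hN
  have hc := resConst_pos n
  have hi : Integrable fun z : Phase n => (1 + ‖z‖) ^ (-N) :=
    integrable_one_add_norm (by rw [hN]; push_cast; linarith)
  have hcomp : ∀ m, IsCompactOperator (antiWick (cutoff n m) * S) := fun m =>
    IsCompactOperator.comp_clm
      (isCompactOperator_antiWick_of_hasCompactSupport (hasCompactSupport_cutoff m)) S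
  have hest : ∀ m : ℕ, ‖S - antiWick (cutoff n m) * S‖ ≤
      resConst n * ∫ z : Phase n, (resConst n)⁻¹ * (resConst n)⁻¹ * (C * (1 + (m : ℝ))⁻¹) *
        (1 + ‖z‖) ^ (-N) := by
    intro m
    have e : S - antiWick (cutoff n m) * S = antiWick (1 - cutoff n m) * S := by
      rw [antiWick_sub, antiWick_one, sub_mul, one_mul]
    rw [e]
    refine norm_le_of_lintegral_kernel_le (fun z => by positivity) (hi.const_mul _)
      (by fun_prop) fun u v => ?_
    rw [inner_antiWick_mul]
    refine (enorm_integral_integral_le _).trans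
      (lintegral_mono fun b => lintegral_mono fun a => ?_)
    rw [← ofReal_norm]
    refine ENNReal.ofReal_le_ofReal ?_
    rw [norm_mul, norm_mul, norm_mul, norm_mul, norm_mul, norm_inv, Complex.norm_real,
      Real.norm_of_nonneg hc.le, norm_inner_symm v, mul_assoc ((resConst n)⁻¹ * (resConst n)⁻¹),
      mul_assoc ((resConst n)⁻¹ * (resConst n)⁻¹)]
    refine mul_le_mul_of_nonneg_left ?_ (by positivity)
    refine mul_le_mul_of_nonneg_right ?_ (by positivity)
    calc ‖(1 - cutoff n m) b‖ * ‖⟪coherent b, S (coherent a)⟫_ℂ‖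
        ≤ ‖(1 - cutoff n m) b‖ * (C * (1 + ‖b‖)⁻¹ * (1 + ‖b - a‖) ^ (-N)) := by gcongr; exact h a b
      _ = C * (‖(1 - cutoff n m) b‖ * (1 + ‖b‖)⁻¹) * (1 + ‖b - a‖) ^ (-N) := by ring
      _ ≤ C * (1 + (m : ℝ))⁻¹ * (1 + ‖b - a‖) ^ (-N) := by
          gcongr
          exact norm_one_sub_cutoff_mul_le m b
  refine isCompactOperator_of_tendsto (l := Filter.atTop) (F := fun m => antiWick (cutoff n m) * S) ?_
    (Filter.Eventually.of_forall hcomp)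
  rw [tendsto_iff_norm_sub_tendsto_zero]
  have hlim : Filter.Tendsto (fun m : ℕ => resConst n * ∫ z : Phase n, (resConst n)⁻¹ *
      (resConst n)⁻¹ * (C * (1 + (m : ℝ))⁻¹) * (1 + ‖z‖) ^ (-N)) Filter.atTop (nhds 0) := by
    simp only [integral_const_mul]
    have h1 : Filter.Tendsto (fun m : ℕ => (1 + (m : ℝ))⁻¹) Filter.atTop (nhds 0) :=
      tendsto_inv_atTop_zero.comp
        (Filter.tendsto_atTop_add_const_left _ _ tendsto_natCast_atTop_atTop)
    have h2 := ((((h1.const_mul C).const_mul ((resConst n)⁻¹ * (resConst n)⁻¹)).mul_const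
      (∫ z : Phase n, (1 + ‖z‖) ^ (-N))).const_mul (resConst n))
    simpa using h2
  refine squeeze_zero (fun m => norm_nonneg _) (fun m => ?_) hlim
  rw [norm_sub_rev]
  exact hest m

/-- The constant in the estimate of the multiplicative defect of anti-Wick quantization. -/
def defectConst (n : ℕ) : ℝ := (resConst n)⁻¹ * ∫ z : Phase n,
  (1 + ‖z‖) ^ 1 * rexp (-(1 / 4) * ‖z‖ ^ 2) * π ^ ((n : ℝ) / 2)

/-- The multiplicative defect of anti-Wick quantization is small when one symbol varies slowly: the
kernel of `antiWick F * antiWick G - antiWick (F * G)` carries the factor `G a - G b`. -/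
theorem norm_antiWick_mul_sub_le (F G : Phase n →ᵇ ℂ) {ε : ℝ} (hε : 0 ≤ ε)
    (hG : ∀ x y, ‖G x - G y‖ ≤ ε * (1 + ‖x - y‖)) :
    ‖antiWick F * antiWick G - antiWick (F * G)‖ ≤ ‖F‖ * ε * defectConst n := by
  have hc := resConst_pos n
  have key : ‖antiWick F * antiWick G - antiWick (F * G)‖ ≤ resConst n * ∫ z : Phase n,
      (resConst n)⁻¹ * (resConst n)⁻¹ * (‖F‖ * ε) *
        ((1 + ‖z‖) ^ 1 * rexp (-(1 / 4) * ‖z‖ ^ 2) * π ^ ((n : ℝ) / 2)) := by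
    refine norm_le_of_lintegral_kernel_le (fun z => by positivity)
      (((integrable_one_add_norm_pow_mul_exp 1 (by norm_num)).mul_const _).const_mul _)
      (by fun_prop) fun u v => ?_
    have e : ⟪v, (antiWick F * antiWick G - antiWick (F * G)) u⟫_ℂ = ∫ b, ∫ a,
        (resConst n : ℂ)⁻¹ * (resConst n : ℂ)⁻¹ * (F b * (G a - G b) *
          ⟪coherent b, coherent a⟫_ℂ * (⟪v, coherent b⟫_ℂ * ⟪coherent a, u⟫_ℂ)) := by
      change ⟪v, antiWick F (antiWick G u) - antiWick (F * G) u⟫_ℂ = _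
      rw [inner_sub_right, inner_antiWick, inner_antiWick, ← mul_sub,
        ← integral_sub (integrable_bcf_mul_inner _ _ _) (integrable_bcf_mul_inner _ _ _),
        ← integral_const_mul]
      refine integral_congr_ae (Filter.Eventually.of_forall fun b => ?_)
      have h1 : ⟪coherent b, antiWick G u⟫_ℂ - G b * ⟪coherent b, u⟫_ℂ = (resConst n : ℂ)⁻¹ *
          ∫ a, (G a - G b) * (⟪coherent b, coherent a⟫_ℂ * ⟪coherent a, u⟫_ℂ) := by
        have h2 := integral_inner_mul_inner (coherent b) u
        rw [inner_antiWick]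
        simp only [sub_mul]
        rw [integral_sub (integrable_bcf_mul_inner _ _ _)
          ((integrable_inner_mul_inner _ _).const_mul _), integral_const_mul, h2, mul_sub,
          mul_left_comm (resConst n : ℂ)⁻¹, inv_mul_cancel_left₀ resConst_ne_zero]
      calc (resConst n : ℂ)⁻¹ * (F b * (⟪v, coherent b⟫_ℂ * ⟪coherent b, antiWick G u⟫_ℂ) -
            (F * G) b * (⟪v, coherent b⟫_ℂ * ⟪coherent b, u⟫_ℂ))
          = (resConst n : ℂ)⁻¹ * (F b * ⟪v, coherent b⟫_ℂ) *
            (⟪coherent b, antiWick G u⟫_ℂ - G b * ⟪coherent b, u⟫_ℂ) := by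
            rw [BoundedContinuousFunction.mul_apply]; ring
        _ = _ := by
            rw [h1, ← mul_assoc, ← integral_const_mul]
            refine integral_congr_ae (Filter.Eventually.of_forall fun a => ?_)
            simp only
            ring
    rw [e]
    refine (enorm_integral_integral_le _).trans
      (lintegral_mono fun b => lintegral_mono fun a => ?_)
    rw [← ofReal_norm]
    refine ENNReal.ofReal_le_ofReal ?_
    rw [norm_mul, norm_mul, norm_mul, norm_mul, norm_mul, norm_mul, norm_inv, Complex.norm_real,
      Real.norm_of_nonneg hc.le, norm_inner_symm v, norm_inner_coherent,
      mul_assoc ((resConst n)⁻¹ * (resConst n)⁻¹), mul_assoc ((resConst n)⁻¹ * (resConst n)⁻¹),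
      norm_sub_rev a b]
    refine mul_le_mul_of_nonneg_left ?_ (by positivity)
    refine mul_le_mul_of_nonneg_right ?_ (by positivity)
    calc ‖F b‖ * ‖G a - G b‖ * (π ^ ((n : ℝ) / 2) * rexp (-(1 / 4) * ‖b - a‖ ^ 2))
        ≤ ‖F‖ * (ε * (1 + ‖a - b‖)) * (π ^ ((n : ℝ) / 2) * rexp (-(1 / 4) * ‖b - a‖ ^ 2)) := by
          gcongr
          · exact F.norm_coe_le_norm b
          · exact hG a b
      _ = _ := by rw [norm_sub_rev a b]; ring
  refine key.trans (le_of_eq ?_)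
  rw [integral_const_mul, defectConst]
  generalize (∫ z : Phase n, (1 + ‖z‖) ^ 1 * rexp (-(1 / 4) * ‖z‖ ^ 2) * π ^ ((n : ℝ) / 2)) = J
  field_simp

end Schur

/-! ### Derivatives of Gaussians and of symbols -/

section Gaussian

variable {V : Type*} [NormedAddCommGroup V] [InnerProductSpace ℝ V]

theorem norm_iteratedFDeriv_id_le (i : ℕ) (v : V) :
    ‖iteratedFDeriv ℝ i (fun v : V => v) v‖ ≤ 1 + ‖v‖ := by
  match i with
  | 0 => rw [norm_iteratedFDeriv_zero]; linarith
  | i + 1 =>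
    rw [← norm_iteratedFDeriv_fderiv]
    have e : fderiv ℝ (fun v : V => v) = fun _ => ContinuousLinearMap.id ℝ V :=
      funext fun x => fderiv_fun_id
    rw [e]
    match i with
    | 0 =>
      rw [norm_iteratedFDeriv_zero]
      exact ContinuousLinearMap.norm_id_le.trans (by linarith [norm_nonneg v])
    | i + 1 =>
      rw [iteratedFDeriv_succ_const]
      simp only [Pi.zero_apply, norm_zero]
      positivity

theorem norm_iteratedFDeriv_norm_sq_le (i : ℕ) (v : V) :
    ‖iteratedFDeriv ℝ i (fun v : V => -‖v‖ ^ 2) v‖ ≤ 2 ^ i * (1 + ‖v‖) ^ 2 := by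
  have e : (fun v : V => -‖v‖ ^ 2) = fun v : V => (-innerSL ℝ : V →L[ℝ] V →L[ℝ] ℝ) v v := by
    funext v
    change -‖v‖ ^ 2 = -⟪v, v⟫_ℝ
    rw [real_inner_self_eq_norm_sq]
  rw [e]
  refine ((-innerSL ℝ : V →L[ℝ] V →L[ℝ] ℝ).norm_iteratedFDeriv_le_of_bilinear_of_le_one
    (f := fun v : V => v) (g := fun v : V => v) (N := ⊤) contDiff_id contDiff_id v (n := i)
    le_top ?_).trans ?_
  · exact (norm_neg (innerSL ℝ : V →L[ℝ] V →L[ℝ] ℝ)).trans_le (norm_innerSL_le ℝ)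
  · calc _ ≤ ∑ j ∈ Finset.range (i + 1), (i.choose j : ℝ) * (1 + ‖v‖) * (1 + ‖v‖) := by
          gcongr <;> exact norm_iteratedFDeriv_id_le _ v
      _ = 2 ^ i * (1 + ‖v‖) ^ 2 := by
          simp only [mul_assoc]
          rw [← Finset.sum_mul]
          have := Nat.sum_range_choose i
          rw [← Nat.cast_sum, this]
          push_cast; ring

/-- The real Gaussian `exp (-‖v‖²)`. -/
def gauss (v : V) : ℝ := rexp (-‖v‖ ^ 2)

theorem contDiff_gauss : ContDiff ℝ ∞ (gauss : V → ℝ) :=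
  ((contDiff_norm_sq ℝ).neg).exp

theorem norm_iteratedFDeriv_gauss_le (j : ℕ) (v : V) :
    ‖iteratedFDeriv ℝ j gauss v‖ ≤
      j.factorial * 2 ^ j * ((1 + ‖v‖) ^ (2 * j) * gauss v) := by
  have h1 : 1 ≤ 1 + ‖v‖ := by linarith [norm_nonneg v]
  have h := norm_iteratedFDeriv_comp_le (𝕜 := ℝ) (g := Real.exp) (f := fun v : V => -‖v‖ ^ 2)
    (n := j) (N := ∞) Real.contDiff_exp (contDiff_norm_sq ℝ).neg (by exact_mod_cast le_top) v
    (C := gauss v) (D := 2 * (1 + ‖v‖) ^ 2)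
    (fun i _ => by
      rw [norm_iteratedFDeriv_eq_norm_iteratedDeriv]
      have := iteratedDeriv_exp_const_mul i 1
      simp only [one_mul, one_pow] at this
      change ‖iteratedDeriv i (fun s => rexp s) _‖ ≤ _
      rw [this, Real.norm_of_nonneg (Real.exp_pos _).le, gauss])
    (fun i hi _ => by
      refine (norm_iteratedFDeriv_norm_sq_le i v).trans ?_
      rw [mul_pow]
      gcongr
      exact le_self_pow₀ (one_le_pow₀ h1) (by lia))
  change ‖iteratedFDeriv ℝ j (Real.exp ∘ fun v : V => -‖v‖ ^ 2) v‖ ≤ _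
  refine h.trans (le_of_eq ?_)
  rw [mul_pow, ← pow_mul]; ring

end Gaussian

section Symbols

variable {n : ℕ}

/-- Peetre's inequality. -/
theorem one_add_norm_le_mul (x y : Phase n) : 1 + ‖x‖ ≤ (1 + ‖y‖) * (1 + ‖x - y‖) := by
  have h : ‖x‖ ≤ ‖y‖ + ‖x - y‖ := by
    calc ‖x‖ = ‖y + (x - y)‖ := by rw [add_sub_cancel]
      _ ≤ _ := norm_add_le _ _
  nlinarith [mul_nonneg (norm_nonneg y) (norm_nonneg (x - y))]

theorem inv_one_add_norm_le (x y : Phase n) :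
    (1 + ‖y‖)⁻¹ ≤ (1 + ‖x‖)⁻¹ * (1 + ‖x - y‖) := by
  rw [inv_mul_eq_div, inv_eq_one_div, div_le_div_iff₀ (by positivity) (by positivity), one_mul,
    mul_comm]
  exact one_add_norm_le_mul x y

/-- Uniform bounds for the derivatives of order at most `M` of a symbol of nonpositive order. -/
theorem IsShubinSymbol.exists_bound {m : ℝ} {d : Phase n → ℂ} (h : IsShubinSymbol m d) (M : ℕ) :
    ∃ C : ℝ, 0 ≤ C ∧ ∀ k ≤ M, ∀ z, ‖iteratedFDeriv ℝ k d z‖ ≤ C * (1 + ‖z‖) ^ (m - k) := by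
  choose C hC using h.2
  refine ⟨∑ k ∈ Finset.range (M + 1), |C k|, Finset.sum_nonneg fun _ _ => abs_nonneg _,
    fun k hk z => (hC k z).trans ?_⟩
  gcongr
  exact (le_abs_self _).trans (Finset.single_le_sum (f := fun k => |C k|)
    (fun _ _ => abs_nonneg _) (Finset.mem_range.2 (by lia)))

theorem rpow_neg_le_inv (z : Phase n) {s : ℝ} (hs : s ≤ -1) : (1 + ‖z‖) ^ s ≤ (1 + ‖z‖)⁻¹ := by
  rw [← Real.rpow_neg_one]
  exact Real.rpow_le_rpow_of_exponent_le (by linarith [norm_nonneg z]) hs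

/-- A symbol of order zero is slowly varying. -/
theorem IsShubinSymbol.exists_norm_sub_le {d : Phase n → ℂ} (h : IsShubinSymbol 0 d) :
    ∃ C : ℝ, 0 ≤ C ∧ ∀ m ζ, ‖d (m + ζ) - d m‖ ≤ C * (1 + ‖m‖)⁻¹ * (1 + ‖ζ‖) ^ 2 := by
  obtain ⟨C, hC0, hC⟩ := h.exists_bound 1
  refine ⟨C, hC0, fun m ζ => ?_⟩
  have hb : ∀ y ∈ Metric.closedBall m ‖ζ‖, ‖fderiv ℝ d y‖ ≤ C * (1 + ‖m‖)⁻¹ * (1 + ‖ζ‖) := by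
    intro y hy
    have h1 := hC 1 le_rfl y
    rw [norm_iteratedFDeriv_one] at h1
    refine h1.trans ?_
    rw [mul_assoc]
    refine mul_le_mul_of_nonneg_left ?_ hC0
    refine (rpow_neg_le_inv y (by norm_num)).trans ((inv_one_add_norm_le m y).trans ?_)
    gcongr
    rw [← dist_eq_norm, dist_comm]
    exact Metric.mem_closedBall.1 hy
  have h2 := (convex_closedBall m ‖ζ‖).norm_image_sub_le_of_norm_fderiv_le (𝕜 := ℝ)
    (fun y _ => (h.1.differentiable (by simp)) y) hb
    (Metric.mem_closedBall_self (norm_nonneg ζ)) (show m + ζ ∈ _ by simp)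
  rw [add_sub_cancel_left] at h2
  refine h2.trans ?_
  rw [mul_assoc _ (1 + ‖ζ‖), pow_two]
  gcongr
  linarith

/-- The decay of the derivatives of `ζ ↦ (d(m + ζ) - a(m)) exp(-|ζ|²)` as `m → ∞`, for a symbol `d`
of order zero with leading part `a`. -/
theorem exists_norm_iteratedFDeriv_gauss_mul_le {d a : Phase n → ℂ} (hd : IsShubinSymbol 0 d)
    (ha : IsShubinSymbol 0 a) {s : ℝ} (hs : s ≤ -1) (hda : IsShubinSymbol s fun z => d z - a z)
    (M : ℕ) : ∃ C : ℝ, 0 ≤ C ∧ ∀ j ≤ M, ∀ m ζ : Phase n,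
      ‖iteratedFDeriv ℝ j (fun ζ => gauss ζ • (d (m + ζ) - a m)) ζ‖ ≤
        C * (1 + ‖m‖)⁻¹ * ((1 + ‖ζ‖) ^ (2 * M + 2) * gauss ζ) := by
  obtain ⟨C₁, hC₁0, hC₁⟩ := hd.exists_bound M
  obtain ⟨C₂, hC₂0, hC₂⟩ := ha.exists_norm_sub_le
  obtain ⟨C₃, hC₃0, hC₃⟩ := hda.exists_bound 0
  have hh : ∀ i ≤ M, ∀ m ζ : Phase n, ‖iteratedFDeriv ℝ i (fun ζ => d (m + ζ) - a m) ζ‖ ≤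
      (C₁ + C₂ + C₃) * (1 + ‖m‖)⁻¹ * (1 + ‖ζ‖) ^ 2 := by
    intro i hi m ζ
    have h1 : (1 + ‖m + ζ‖)⁻¹ ≤ (1 + ‖m‖)⁻¹ * (1 + ‖ζ‖) ^ 2 := by
      refine (inv_one_add_norm_le m (m + ζ)).trans ?_
      rw [sub_add_cancel_left, norm_neg]
      gcongr
      exact le_self_pow₀ (by linarith [norm_nonneg ζ]) (by norm_num)
    match i with
    | 0 =>
      rw [norm_iteratedFDeriv_zero]
      have h3 := hC₃ 0 le_rfl (m + ζ)
      rw [norm_iteratedFDeriv_zero] at h3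
      have h4 := rpow_neg_le_inv (m + ζ) (s := s - (0 : ℕ)) (by simpa using hs)
      calc ‖d (m + ζ) - a m‖ = ‖(d (m + ζ) - a (m + ζ)) + (a (m + ζ) - a m)‖ := by
            rw [sub_add_sub_cancel]
        _ ≤ ‖d (m + ζ) - a (m + ζ)‖ + ‖a (m + ζ) - a m‖ := norm_add_le _ _
        _ ≤ C₃ * ((1 + ‖m‖)⁻¹ * (1 + ‖ζ‖) ^ 2) + C₂ * (1 + ‖m‖)⁻¹ * (1 + ‖ζ‖) ^ 2 := by
            gcongr
            · exact h3.trans (mul_le_mul_of_nonneg_left (h4.trans h1) hC₃0)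
            · exact hC₂ m ζ
        _ ≤ _ := by
            have : 0 ≤ C₁ * ((1 + ‖m‖)⁻¹ * (1 + ‖ζ‖) ^ 2) := by positivity
            linarith
    | i + 1 =>
      rw [← norm_iteratedFDeriv_fderiv]
      have e : fderiv ℝ (fun ζ => d (m + ζ) - a m) = fderiv ℝ (fun ζ => d (m + ζ)) :=
        funext fun x => fderiv_sub_const _
      rw [e, norm_iteratedFDeriv_fderiv, iteratedFDeriv_comp_add_left]
      refine (hC₁ (i + 1) hi (m + ζ)).trans ?_
      calc C₁ * (1 + ‖m + ζ‖) ^ (0 - ((i + 1 : ℕ) : ℝ)) ≤ C₁ * ((1 + ‖m‖)⁻¹ * (1 + ‖ζ‖) ^ 2) := by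
            gcongr
            refine (rpow_neg_le_inv (m + ζ) ?_).trans h1
            push_cast
            linarith [Nat.cast_nonneg (α := ℝ) i]
        _ ≤ _ := by
            have : 0 ≤ (C₂ + C₃) * ((1 + ‖m‖)⁻¹ * (1 + ‖ζ‖) ^ 2) := by positivity
            linarith
  refine ⟨2 ^ M * (M.factorial * 2 ^ M) * (C₁ + C₂ + C₃), by positivity, fun j hj m ζ => ?_⟩
  have hsm : ContDiff ℝ ∞ fun ζ => d (m + ζ) - a m :=
    (hd.1.comp (contDiff_const.add contDiff_id)).sub contDiff_const
  have h1 : 1 ≤ 1 + ‖ζ‖ := by linarith [norm_nonneg ζ]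
  have hg0 : 0 ≤ gauss ζ := (Real.exp_pos _).le
  refine (norm_iteratedFDeriv_smul_le (𝕜 := ℝ) contDiff_gauss hsm ζ (n := j)
    (by exact_mod_cast le_top)).trans ?_
  calc _ ≤ ∑ i ∈ Finset.range (j + 1), (j.choose i : ℝ) *
        (M.factorial * 2 ^ M * ((1 + ‖ζ‖) ^ (2 * M) * gauss ζ)) *
        ((C₁ + C₂ + C₃) * (1 + ‖m‖)⁻¹ * (1 + ‖ζ‖) ^ 2) := by
        refine Finset.sum_le_sum fun i hi => ?_
        have hi' : i ≤ M := (Nat.lt_succ_iff.1 (Finset.mem_range.1 hi)).trans hj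
        gcongr
        · refine (norm_iteratedFDeriv_gauss_le i ζ).trans ?_
          gcongr
          norm_num
        · exact hh _ ((Nat.sub_le _ _).trans hj) m ζ
    _ = 2 ^ j * (M.factorial * 2 ^ M) * (C₁ + C₂ + C₃) * (1 + ‖m‖)⁻¹ *
        ((1 + ‖ζ‖) ^ (2 * M + 2) * gauss ζ) := by
        rw [← Finset.sum_mul, ← Finset.sum_mul, ← Nat.cast_sum, Nat.sum_range_choose, pow_add]
        push_cast; ring
    _ ≤ _ := by
        gcongr
        norm_num

end Symbols

/-! ### Weyl quantization modulo compact operators -/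

section Weyl

open scoped BoundedContinuousFunction

variable {n : ℕ}

/-- The decay of the Fourier transform of a function whose derivatives are bounded by a fixed
multiple of a Gaussian. -/
theorem exists_norm_fourier_le (M : ℕ) : ∃ C : ℝ, 0 ≤ C ∧ ∀ (f : Phase n → ℂ) (B : ℝ), 0 ≤ B →
    ContDiff ℝ ∞ f →
    (∀ j ≤ M, ∀ ζ, ‖iteratedFDeriv ℝ j f ζ‖ ≤ B * ((1 + ‖ζ‖) ^ (2 * M + 2) * gauss ζ)) →
    ∀ w, (1 + ‖w‖) ^ M * ‖FourierTransform.fourier f w‖ ≤ C * B := by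
  set J : ℝ := ∫ ζ : Phase n, (1 + ‖ζ‖) ^ (2 * M + 2) * gauss ζ with hJ
  have hJi : Integrable fun ζ : Phase n => (1 + ‖ζ‖) ^ (2 * M + 2) * gauss ζ := by
    have := integrable_one_add_norm_pow_mul_exp (V := Phase n) (2 * M + 2) one_pos
    simpa only [gauss, neg_one_mul] using this
  have hJ0 : 0 ≤ J := integral_nonneg fun ζ => mul_nonneg (by positivity) (Real.exp_pos _).le
  refine ⟨2 ^ M * ((1 + 2 ^ M * (M + 1)) * J), by positivity, fun f B hB hf hfb w => ?_⟩
  have hint : ∀ j ≤ M, Integrable fun ζ => ‖iteratedFDeriv ℝ j f ζ‖ := by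
    intro j hj
    refine (hJi.const_mul B).mono' ?_ (Filter.Eventually.of_forall fun ζ => ?_)
    · exact (hf.continuous_iteratedFDeriv (by exact_mod_cast le_top)).norm.aestronglyMeasurable
    · rw [norm_norm]; exact hfb j hj ζ
  have hle : ∀ j ≤ M, ∫ ζ, ‖iteratedFDeriv ℝ j f ζ‖ ≤ B * J := by
    intro j hj
    rw [hJ, ← integral_const_mul]
    exact integral_mono (hint j hj) (hJi.const_mul B) (hfb j hj)
  have key : ∀ j ≤ M, ‖w‖ ^ j * ‖FourierTransform.fourier f w‖ ≤ 2 ^ j * ((j + 1) * (B * J)) := by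
    intro j hj
    have h := Real.pow_mul_norm_iteratedFDeriv_fourier_le (f := f) (K := 0) (N := (M : ℕ∞))
      (hf.of_le (by exact_mod_cast le_top)) (fun k i hk hi => by
        have hk0 : k = 0 := by simpa using hk
        subst hk0
        simp only [pow_zero, one_mul]
        exact hint i (by exact_mod_cast hi)) (k := 0) (n := j) (by simp) (by exact_mod_cast hj) w
    rw [norm_iteratedFDeriv_zero] at h
    refine h.trans ?_
    simp only [pow_zero, one_mul, CharP.cast_eq_zero, mul_zero, zero_add, Finset.sum_product,
      Finset.range_one, Finset.sum_singleton]
    gcongr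
    calc _ ≤ ∑ i ∈ Finset.range (j + 1), B * J :=
          Finset.sum_le_sum fun i hi => hle i ((Nat.lt_succ_iff.1 (Finset.mem_range.1 hi)).trans hj)
      _ = _ := by simp
  have h0 := key 0 (Nat.zero_le _)
  have hM := key M le_rfl
  simp only [pow_zero, one_mul, Nat.cast_zero, zero_add] at h0
  have hp : (1 + ‖w‖) ^ M ≤ 2 ^ M * (1 + ‖w‖ ^ M) := by
    rcases le_total ‖w‖ 1 with h | h
    · calc (1 + ‖w‖) ^ M ≤ 2 ^ M := by gcongr; linarith
        _ ≤ 2 ^ M * (1 + ‖w‖ ^ M) := le_mul_of_one_le_right (by positivity)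
            (by linarith [pow_nonneg (norm_nonneg w) M])
    · calc (1 + ‖w‖) ^ M ≤ (2 * ‖w‖) ^ M := by gcongr; linarith
        _ = 2 ^ M * ‖w‖ ^ M := mul_pow _ _ _
        _ ≤ _ := by gcongr; linarith
  calc (1 + ‖w‖) ^ M * ‖FourierTransform.fourier f w‖
      ≤ 2 ^ M * (1 + ‖w‖ ^ M) * ‖FourierTransform.fourier f w‖ := by gcongr
    _ = 2 ^ M * (‖FourierTransform.fourier f w‖ + ‖w‖ ^ M * ‖FourierTransform.fourier f w‖) := by ring
    _ ≤ 2 ^ M * (B * J + 2 ^ M * ((M + 1) * (B * J))) := by gcongr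
    _ = _ := by ring

/-- The prefactor of the cross-Wigner function of two coherent states. -/
def wignerPhase (a b : Phase n) : ℂ :=
  (((π : ℝ)⁻¹ ^ n : ℝ) : ℂ) * ((π : ℂ) ^ ((n : ℂ) / 2) * cexp (-I * (⟪mid a b, a⟫_ℂ).im))

theorem norm_wignerPhase (a b : Phase n) : ‖wignerPhase a b‖ = (π : ℝ)⁻¹ ^ n * π ^ ((n : ℝ) / 2) := by
  have h : (π : ℂ) ^ ((n : ℂ) / 2) = ((π ^ ((n : ℝ) / 2) : ℝ) : ℂ) := by
    rw [ofReal_cpow Real.pi_pos.le]; push_cast; rfl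
  rw [wignerPhase, norm_mul, norm_mul, h, Complex.norm_real, Complex.norm_real,
    Real.norm_of_nonneg (by positivity), Real.norm_of_nonneg (by positivity),
    show -I * (((⟪mid a b, a⟫_ℂ).im : ℝ) : ℂ) = ((-(⟪mid a b, a⟫_ℂ).im : ℝ) : ℂ) * I by push_cast; ring,
    Complex.norm_exp_ofReal_mul_I, mul_one]

theorem ofReal_im_inner (x y : Phase n) : (((⟪x, y⟫_ℂ).im : ℝ) : ℂ) = -I * (⟪x, y⟫_ℂ - ⟪y, x⟫_ℂ) / 2 := by
  rw [← inner_conj_symm y x, Complex.sub_conj]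
  push_cast
  linear_combination (((⟪x, y⟫_ℂ).im : ℝ) : ℂ) * I_sq

/-- The cross-Wigner function of two coherent states is a Gaussian centred at their midpoint. -/
theorem wigner_coherent_mid (a b ζ : Phase n) :
    wigner (coherent a) (coherent b) (mid a b + ζ) =
      wignerPhase a b * cexp (-1 * ‖ζ‖ ^ 2 + I * ⟪I • (a - b), ζ⟫_ℝ) := by
  rw [wigner_coherent, wignerPhase, inner_coherent]
  rw [show ∀ p x y z : ℂ, p * (x * (y * z)) = p * y * (x * z) from fun p x y z => by ring,
    show ∀ p x y z : ℂ, p * (x * y) * z = p * x * (y * z) from fun p x y z => by ring,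
    ← Complex.exp_add, ← Complex.exp_add]
  congr 2
  rw [ofReal_inner_real, ofReal_im_inner, ofReal_im_inner]
  simp only [norm_sq_eq_inner, mid, inner_add_left, inner_add_right, inner_smul_left,
    inner_smul_right, inner_sub_left, inner_sub_right, map_div₀, map_one, map_ofNat, conj_I, smul_add]
  linear_combination (⟪ζ, b⟫_ℂ - ⟪b, ζ⟫_ℂ) / 2 * I_sq

/-- Cross-Wigner functions of coherent states are integrable, so that the matrix elements of a Weyl
operator between coherent states are given by its symbol. -/
theorem integrable_wigner_coherent (a b : Phase n) :
    Integrable (wigner (coherent a) (coherent b)) := by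
  have h := (GaussianFourier.integrable_cexp_neg_mul_sq_norm_add (V := Phase n) (b := 1)
    (by simp) I (I • (a - b))).const_mul (wignerPhase a b)
  simp only [← wigner_coherent_mid] at h
  have h2 := h.comp_add_left (-mid a b)
  simpa only [add_neg_cancel_left] using h2

theorem norm_I_smul_sub (a b : Phase n) : ‖I • (a - b)‖ = ‖b - a‖ := by
  rw [norm_smul, norm_I, one_mul, norm_sub_rev]

theorem finrank_phase : Module.finrank ℝ (Phase n) = 2 * n := by
  rw [finrank_real_of_complex, finrank_euclideanSpace, Fintype.card_fin]

/-- The identity has Weyl symbol `1`. -/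
theorem integral_wigner_coherent (a b : Phase n) :
    ∫ z, wigner (coherent a) (coherent b) z = ⟪coherent b, coherent a⟫_ℂ := by
  rw [← integral_add_left_eq_self _ (mid a b)]
  simp only [wigner_coherent_mid]
  rw [integral_const_mul, GaussianFourier.integral_cexp_neg_mul_sq_norm_add (V := Phase n)
    (by simp) I (I • (a - b)), finrank_phase, wignerPhase, inner_coherent]
  have h1 : ((π : ℂ) / 1) ^ (((2 * n : ℕ) : ℂ) / 2) = (π : ℂ) ^ n := by
    rw [div_one, ← Complex.cpow_natCast]; congr 1; push_cast; ring
  rw [h1, show ∀ p x y q z : ℂ, p * (x * y) * (q * z) = p * q * (x * (y * z)) from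
    fun p x y q z => by ring, ← Complex.exp_add]
  have h2 : (((π : ℝ)⁻¹ ^ n : ℝ) : ℂ) * (π : ℂ) ^ n = 1 := by
    push_cast
    rw [← mul_pow, inv_mul_cancel₀ (by exact_mod_cast Real.pi_ne_zero), one_pow]
  rw [h2, one_mul]
  congr 2
  rw [ofReal_im_inner]
  simp only [norm_sq_eq_inner, mid, inner_add_left, inner_add_right, inner_smul_left,
    inner_smul_right, inner_sub_left, inner_sub_right, map_div₀, map_one, map_ofNat, conj_I, smul_add]
  linear_combination ((-⟪a, a⟫_ℂ + ⟪b, a⟫_ℂ + ⟪a, b⟫_ℂ - ⟪b, b⟫_ℂ) / 4 * (I ^ 2 - 1) +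
    (⟪b, a⟫_ℂ - ⟪a, b⟫_ℂ) / 4) * I_sq

/-- The bounded continuous function underlying a symbol of order zero. -/
def IsShubinSymbol.toBCF {d : Phase n → ℂ} (h : IsShubinSymbol 0 d) : Phase n →ᵇ ℂ :=
  BoundedContinuousFunction.ofNormedAddCommGroup d h.1.continuous (h.2 0).choose fun z => by
    have := (h.2 0).choose_spec z
    rw [norm_iteratedFDeriv_zero] at this
    simpa using this

theorem IsShubinSymbol.toBCF_apply {d : Phase n → ℂ} (h : IsShubinSymbol 0 d) (z : Phase n) :
    h.toBCF z = d z := rfl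

/-- Off-diagonal decay of the coherent state matrix elements of a Weyl operator, after subtracting
from its symbol `d` the value of the leading part `a` at the midpoint. -/
theorem exists_norm_integral_sub_mul_wigner_le {d a : Phase n → ℂ} (hd : IsShubinSymbol 0 d)
    (ha : IsShubinSymbol 0 a) {s : ℝ} (hs : s ≤ -1) (hda : IsShubinSymbol s fun z => d z - a z)
    (M : ℕ) : ∃ C : ℝ, 0 ≤ C ∧ ∀ x y : Phase n,
      ‖∫ z, (d z - a (mid x y)) * wigner (coherent x) (coherent y) z‖ ≤
        C * (1 + ‖mid x y‖)⁻¹ * ((1 + ‖y - x‖) ^ M)⁻¹ := by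
  obtain ⟨C₁, hC₁0, hC₁⟩ := exists_norm_iteratedFDeriv_gauss_mul_le hd ha hs hda M
  obtain ⟨C₂, hC₂0, hC₂⟩ := exists_norm_fourier_le (n := n) M
  refine ⟨((π : ℝ)⁻¹ ^ n * π ^ ((n : ℝ) / 2)) * ((2 * π) ^ M * (C₂ * C₁)), by positivity,
    fun x y => ?_⟩
  set m := mid x y with hm
  set f : Phase n → ℂ := fun ζ => gauss ζ • (d (m + ζ) - a m) with hf
  -- The frequency at which the Fourier transform reproduces the oscillating factor of the
  -- cross-Wigner function.
  set w : Phase n := -((2 * π)⁻¹ • (I • (x - y))) with hw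
  have hsm : ContDiff ℝ ∞ f := contDiff_gauss.smul
    ((hd.1.comp (contDiff_const.add contDiff_id)).sub contDiff_const)
  have e : ∫ z, (d z - a m) * wigner (coherent x) (coherent y) z =
      wignerPhase x y * FourierTransform.fourier f w := by
    rw [← integral_add_left_eq_self _ m, Real.fourier_eq', ← integral_const_mul]
    refine integral_congr_ae (Filter.Eventually.of_forall fun ζ => ?_)
    simp only
    rw [hm, wigner_coherent_mid, ← hm, hf, smul_eq_mul]
    simp only [gauss, real_smul]
    rw [hw, inner_neg_right, inner_smul_right, real_inner_comm, Complex.exp_add, ofReal_exp]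
    have e1 : (((-2 * π * -((2 * π)⁻¹ * ⟪ζ, I • (x - y)⟫_ℝ) : ℝ)) : ℂ) * I =
        I * ((⟪ζ, I • (x - y)⟫_ℝ : ℝ) : ℂ) := by
      rw [show -2 * π * -((2 * π)⁻¹ * ⟪ζ, I • (x - y)⟫_ℝ) = ⟪ζ, I • (x - y)⟫_ℝ by
        field_simp, mul_comm]
    rw [e1]
    push_cast
    rw [neg_one_mul]
    ring
  have hwn : ‖w‖ = (2 * π)⁻¹ * ‖y - x‖ := by
    rw [hw, norm_neg, norm_smul, norm_I_smul_sub, Real.norm_of_nonneg (by positivity)]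
  have h := hC₂ f (C₁ * (1 + ‖m‖)⁻¹) (by positivity) hsm (fun j hj ζ => hC₁ j hj m ζ) w
  have h1 : 1 + ‖y - x‖ ≤ 2 * π * (1 + ‖w‖) := by
    rw [hwn, mul_add, mul_inv_cancel_left₀ (by positivity)]
    have := Real.pi_gt_three
    linarith
  have h2 : (1 + ‖y - x‖) ^ M * ‖FourierTransform.fourier f w‖ ≤
      (2 * π) ^ M * (C₂ * (C₁ * (1 + ‖m‖)⁻¹)) := by
    calc (1 + ‖y - x‖) ^ M * ‖FourierTransform.fourier f w‖
        ≤ (2 * π * (1 + ‖w‖)) ^ M * ‖FourierTransform.fourier f w‖ := by gcongr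
      _ = (2 * π) ^ M * ((1 + ‖w‖) ^ M * ‖FourierTransform.fourier f w‖) := by
        rw [mul_pow]; ring
      _ ≤ _ := by gcongr
  rw [e, norm_mul, norm_wignerPhase, mul_assoc _ _ (1 + ‖m‖)⁻¹, mul_assoc _ _ (_)⁻¹]
  refine mul_le_mul_of_nonneg_left ?_ (by positivity)
  rw [← div_eq_mul_inv, le_div_iff₀ (by positivity), mul_comm]
  refine h2.trans (le_of_eq ?_)
  ring

/-- The corresponding decay for the anti-Wick operator with symbol `a`. -/
theorem exists_norm_integral_sub_mul_inner_le {a : Phase n → ℂ} (ha : IsShubinSymbol 0 a)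
    (M : ℕ) : ∃ C : ℝ, 0 ≤ C ∧ ∀ x y : Phase n,
      ‖∫ z, (a z - a (mid x y)) * (⟪coherent y, coherent z⟫_ℂ * ⟪coherent z, coherent x⟫_ℂ)‖ ≤
        C * (1 + ‖mid x y‖)⁻¹ * ((1 + ‖y - x‖) ^ M)⁻¹ := by
  obtain ⟨C₁, hC₁0, hC₁⟩ := ha.exists_norm_sub_le
  obtain ⟨C₂, hC₂0, hC₂⟩ := exists_one_add_pow_mul_exp_le M (show (0 : ℝ) < 1 / 8 by norm_num)
  set J : ℝ := ∫ ζ : Phase n, (1 + ‖ζ‖) ^ 2 * rexp (-(1 / 2) * ‖ζ‖ ^ 2) with hJ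
  have hJi := integrable_one_add_norm_pow_mul_exp (V := Phase n) 2 (show (0 : ℝ) < 1 / 2 by norm_num)
  have hJ0 : 0 ≤ J := integral_nonneg fun ζ => by positivity
  set c : ℝ := π ^ ((n : ℝ) / 2) with hc
  have hc0 : 0 ≤ c := by positivity
  refine ⟨c * c * C₂ * C₁ * J, by positivity, fun x y => ?_⟩
  have hπ : ‖(π : ℂ) ^ ((n : ℂ) / 2)‖ = c := by
    have : (π : ℂ) ^ ((n : ℂ) / 2) = ((c : ℝ) : ℂ) := by
      rw [hc, ofReal_cpow Real.pi_pos.le]; push_cast; rfl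
    rw [this, Complex.norm_real, Real.norm_of_nonneg hc0]
  have hmid : mid y x = mid x y := by rw [mid, mid, add_comm]
  have hov : ∀ ζ, ‖⟪coherent y, coherent (mid x y + ζ)⟫_ℂ * ⟪coherent (mid x y + ζ), coherent x⟫_ℂ‖ =
      c * c * rexp (-(1 / 8) * ‖y - x‖ ^ 2) * rexp (-(1 / 2) * ‖ζ‖ ^ 2) := by
    intro ζ
    rw [← hmid, inner_coherent_mul_inner_coherent, norm_mul, norm_mul, norm_mul, hπ,
      norm_inner_coherent, ← hc, Complex.norm_exp, Complex.norm_exp, norm_I_smul_sub]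
    have e1 : (((‖y - x‖ : ℝ) : ℂ) ^ 2 / 8).re = ‖y - x‖ ^ 2 / 8 := by
      rw [← ofReal_pow, ← ofReal_ofNat, ← ofReal_div, ofReal_re]
    have e2 : (-(1 / 2) * ((‖ζ‖ : ℝ) : ℂ) ^ 2 + I / 2 * ((⟪I • (x - y), ζ⟫_ℝ : ℝ) : ℂ)).re =
        -(1 / 2) * ‖ζ‖ ^ 2 := by
      have : -(1 / 2) * ((‖ζ‖ : ℝ) : ℂ) ^ 2 + I / 2 * ((⟪I • (x - y), ζ⟫_ℝ : ℝ) : ℂ) =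
          ((-(1 / 2) * ‖ζ‖ ^ 2 : ℝ) : ℂ) + ((⟪I • (x - y), ζ⟫_ℝ / 2 : ℝ) : ℂ) * I := by
        push_cast; ring
      rw [this, add_re, ofReal_re, re_ofReal_mul, I_re, mul_zero, add_zero]
    rw [e1, e2, norm_sub_rev x y, ← mul_assoc, mul_assoc (c * c), ← Real.exp_add]
    congr 3
    ring
  rw [← integral_add_left_eq_self _ (mid x y)]
  have hbound : ∀ ζ, ‖(a (mid x y + ζ) - a (mid x y)) * (⟪coherent y, coherent (mid x y + ζ)⟫_ℂ *
      ⟪coherent (mid x y + ζ), coherent x⟫_ℂ)‖ ≤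
      c * c * rexp (-(1 / 8) * ‖y - x‖ ^ 2) * (C₁ * (1 + ‖mid x y‖)⁻¹) *
        ((1 + ‖ζ‖) ^ 2 * rexp (-(1 / 2) * ‖ζ‖ ^ 2)) := by
    intro ζ
    rw [norm_mul, hov]
    calc _ ≤ (C₁ * (1 + ‖mid x y‖)⁻¹ * (1 + ‖ζ‖) ^ 2) *
          (c * c * rexp (-(1 / 8) * ‖y - x‖ ^ 2) * rexp (-(1 / 2) * ‖ζ‖ ^ 2)) := by
          gcongr; exact hC₁ _ ζ
      _ = _ := by ring
  refine (norm_integral_le_of_norm_le (hJi.const_mul _)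
    (Filter.Eventually.of_forall hbound)).trans ?_
  rw [integral_const_mul, ← hJ]
  have h2 : rexp (-(1 / 8) * ‖y - x‖ ^ 2) ≤ C₂ * ((1 + ‖y - x‖) ^ M)⁻¹ := by
    rw [← div_eq_mul_inv, le_div_iff₀ (by positivity), mul_comm]
    exact hC₂ _ (norm_nonneg _)
  calc _ ≤ c * c * (C₂ * ((1 + ‖y - x‖) ^ M)⁻¹) * (C₁ * (1 + ‖mid x y‖)⁻¹) * J := by gcongr
    _ = _ := by ring

/-- A bounded operator with Weyl symbol `d` of order zero differs from the anti-Wick operator of the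
leading part of `d` by a compact operator. -/
theorem isCompactOperator_weyl_sub_antiWick {d a : Phase n → ℂ} (hd : IsShubinSymbol 0 d)
    (ha : IsShubinSymbol 0 a) {s : ℝ} (hs : s ≤ -1) (hda : IsShubinSymbol s fun z => d z - a z)
    {T : L2 n →L[ℂ] L2 n} (hT : IsWeylOp d T) : IsCompactOperator (T - antiWick ha.toBCF) := by
  set M := Module.finrank ℝ (Phase n) + 1 with hM
  obtain ⟨C₁, hC₁0, hC₁⟩ := exists_norm_integral_sub_mul_wigner_le hd ha hs hda (M + 1)
  obtain ⟨C₂, hC₂0, hC₂⟩ := exists_norm_integral_sub_mul_inner_le ha (M + 1)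
  have hr := resConst_pos n
  refine isCompactOperator_of_kernel_decay (C := C₁ + (resConst n)⁻¹ * C₂) (by positivity)
    fun x y => ?_
  -- Both quantizations send the constant `a (mid x y)` to the same multiple of the identity, so that
  -- it may be subtracted from both symbols.
  have e : ⟪coherent y, (T - antiWick ha.toBCF) (coherent x)⟫_ℂ =
      (∫ z, (d z - a (mid x y)) * wigner (coherent x) (coherent y) z) -
        (resConst n : ℂ)⁻¹ * ∫ z, (a z - a (mid x y)) *
          (⟪coherent y, coherent z⟫_ℂ * ⟪coherent z, coherent x⟫_ℂ) := by
    change ⟪coherent y, T (coherent x) - antiWick ha.toBCF (coherent x)⟫_ℂ = _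
    have hw := integrable_wigner_coherent x y
    have hdw : Integrable fun z => d z * wigner (coherent x) (coherent y) z :=
      hw.bdd_mul hd.1.continuous.aestronglyMeasurable
        (Filter.Eventually.of_forall hd.toBCF.norm_coe_le_norm)
    have hi : Integrable fun z =>
        a z * (⟪coherent y, coherent z⟫_ℂ * ⟪coherent z, coherent x⟫_ℂ) :=
      integrable_bcf_mul_inner ha.toBCF _ _
    rw [inner_sub_right, hT _ _ hw, inner_antiWick]
    simp only [sub_mul, IsShubinSymbol.toBCF_apply]
    rw [integral_sub hdw (hw.const_mul _), integral_sub hi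
      ((integrable_inner_mul_inner _ _).const_mul _), integral_const_mul, integral_const_mul,
      integral_wigner_coherent, integral_inner_mul_inner, mul_sub,
      mul_left_comm (resConst n : ℂ)⁻¹, inv_mul_cancel_left₀ resConst_ne_zero]
    ring
  rw [e]
  refine (norm_sub_le _ _).trans ?_
  rw [norm_mul, norm_inv, Complex.norm_real, Real.norm_of_nonneg hr.le]
  -- One power of the off-diagonal decay is spent on replacing the midpoint by `y`.
  have hmid : ‖y - mid x y‖ ≤ ‖y - x‖ := by
    have : y - mid x y = (1 / 2 : ℂ) • (y - x) := by rw [mid]; module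
    rw [this, norm_smul]
    norm_num
    linarith [norm_nonneg (y - x)]
  have hdec : (1 + ‖mid x y‖)⁻¹ * ((1 + ‖y - x‖) ^ (M + 1))⁻¹ ≤
      (1 + ‖y‖)⁻¹ * (1 + ‖y - x‖) ^ (-(M : ℝ)) := by
    rw [Real.rpow_neg (by positivity), Real.rpow_natCast, pow_succ, mul_inv_rev]
    calc (1 + ‖mid x y‖)⁻¹ * ((1 + ‖y - x‖)⁻¹ * ((1 + ‖y - x‖) ^ M)⁻¹)
        ≤ ((1 + ‖y‖)⁻¹ * (1 + ‖y - x‖)) * ((1 + ‖y - x‖)⁻¹ * ((1 + ‖y - x‖) ^ M)⁻¹) := by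
          gcongr
          refine (inv_one_add_norm_le y (mid x y)).trans ?_
          gcongr
      _ = _ := by field_simp
  calc _ ≤ C₁ * (1 + ‖mid x y‖)⁻¹ * ((1 + ‖y - x‖) ^ (M + 1))⁻¹ + (resConst n)⁻¹ *
        (C₂ * (1 + ‖mid x y‖)⁻¹ * ((1 + ‖y - x‖) ^ (M + 1))⁻¹) := by
        gcongr
        · exact hC₁ x y
        · exact hC₂ x y
    _ = (C₁ + (resConst n)⁻¹ * C₂) * ((1 + ‖mid x y‖)⁻¹ * ((1 + ‖y - x‖) ^ (M + 1))⁻¹) := by ring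
    _ ≤ (C₁ + (resConst n)⁻¹ * C₂) * ((1 + ‖y‖)⁻¹ * (1 + ‖y - x‖) ^ (-(M : ℝ))) := by gcongr
    _ = _ := by ring

end Weyl

/-! ### The homomorphism from symbols to the Calkin algebra -/

section Radial

open scoped BoundedContinuousFunction

variable {n : ℕ}

/-- The bounded function `F` on phase space equals `f(z / |z|)` outside some ball; points of the
complement of a ball are written as `t s` with `t` large and `s` on the unit sphere. -/
def IsRadialExtension (F : Phase n →ᵇ ℂ) (f : C(Sph n, ℂ)) : Prop :=
  ∃ r : ℝ, ∀ t : ℝ, r ≤ t → ∀ s : Sph n, F ((t : ℂ) • (s : Phase n)) = f s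

/-- The retraction of phase space onto the closed unit ball along rays. -/
def ballRetraction (z : Phase n) : Phase n := (max 1 ‖z‖)⁻¹ • z

theorem lipschitzWith_ballRetraction : LipschitzWith 2 (ballRetraction (n := n)) := by
  refine LipschitzWith.of_dist_le_mul fun x y => ?_
  rw [dist_eq_norm, dist_eq_norm, ballRetraction, ballRetraction]
  set a := max 1 ‖x‖ with ha
  set b := max 1 ‖y‖ with hb
  have ha1 : 1 ≤ a := le_max_left _ _
  have hb1 : 1 ≤ b := le_max_left _ _
  have hyb : ‖y‖ ≤ b := le_max_right _ _
  have hab : |b - a| ≤ ‖x - y‖ := by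
    rw [hb, ha, max_comm 1, max_comm 1, norm_sub_rev]
    exact (abs_max_sub_max_le_abs _ _ _).trans (abs_norm_sub_norm_le y x)
  have e : a⁻¹ • x - b⁻¹ • y = a⁻¹ • (x - y) + ((b - a) * (a⁻¹ * b⁻¹)) • y := by
    have : (b - a) * (a⁻¹ * b⁻¹) = a⁻¹ - b⁻¹ := by field_simp
    rw [this]; module
  rw [e]
  refine (norm_add_le _ _).trans ?_
  rw [norm_smul, norm_smul, norm_mul, Real.norm_eq_abs (b - a), norm_mul, norm_inv, norm_inv,
    Real.norm_of_nonneg (zero_le_one.trans ha1), Real.norm_of_nonneg (zero_le_one.trans hb1)]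
  have h1 : a⁻¹ ≤ 1 := inv_le_one_of_one_le₀ ha1
  have h2 : b⁻¹ * ‖y‖ ≤ 1 := by
    rw [inv_mul_le_iff₀ (by positivity), mul_one]; exact hyb
  calc a⁻¹ * ‖x - y‖ + |b - a| * (a⁻¹ * b⁻¹) * ‖y‖
      = a⁻¹ * ‖x - y‖ + |b - a| * (a⁻¹ * (b⁻¹ * ‖y‖)) := by ring
    _ ≤ 1 * ‖x - y‖ + ‖x - y‖ * (1 * 1) := by gcongr
    _ = ((2 : NNReal) : ℝ) * ‖x - y‖ := by push_cast; ring

/-- Radial extensions exist: extend `f` continuously to phase space and compose with the retraction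
onto the unit ball. -/
theorem exists_isRadialExtension (f : C(Sph n, ℂ)) :
    ∃ F : Phase n →ᵇ ℂ, IsRadialExtension F f ∧ UniformContinuous F := by
  obtain ⟨g, hg⟩ := ContinuousMap.exists_restrict_eq (Metric.isClosed_sphere) f
  have hmem : ∀ z : Phase n, ballRetraction z ∈ Metric.closedBall (0 : Phase n) 1 := by
    intro z
    have : 0 < max 1 ‖z‖ := zero_lt_one.trans_le (le_max_left _ _)
    rw [mem_closedBall_zero_iff, ballRetraction, norm_smul, norm_inv,
      Real.norm_of_nonneg this.le, inv_mul_le_iff₀ this, mul_one]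
    exact le_max_right _ _
  have hK := isCompact_closedBall (0 : Phase n) 1
  obtain ⟨C, hC⟩ := hK.exists_bound_of_continuousOn g.continuous.continuousOn
  have huc : UniformContinuous fun z : Phase n => g (ballRetraction z) := by
    have h1 := hK.uniformContinuousOn_of_continuous g.continuous.continuousOn
    rw [uniformContinuousOn_iff_restrict] at h1
    exact h1.comp (g := (Metric.closedBall (0 : Phase n) 1).domRestrict g)
      (f := fun z => ⟨ballRetraction z, hmem z⟩)
      (lipschitzWith_ballRetraction.uniformContinuous.subtype_mk hmem)
  refine ⟨BoundedContinuousFunction.ofNormedAddCommGroup _ huc.continuous C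
    fun z => hC _ (hmem z), ⟨1, fun t ht s => ?_⟩, huc⟩
  have hs : ‖(s : Phase n)‖ = 1 := mem_sphere_zero_iff_norm.1 s.2
  have hn : ‖(t : ℂ) • (s : Phase n)‖ = t := by
    rw [norm_smul, hs, mul_one, Complex.norm_real, Real.norm_of_nonneg (zero_le_one.trans ht)]
  have : ballRetraction ((t : ℂ) • (s : Phase n)) = s := by
    rw [ballRetraction, hn, max_eq_right ht, ← Complex.coe_smul, smul_smul, ← ofReal_mul,
      inv_mul_cancel₀ (zero_lt_one.trans_le ht).ne', ofReal_one, one_smul]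
  change g (ballRetraction ((t : ℂ) • (s : Phase n))) = f s
  rw [this, ← hg]
  rfl

theorem IsRadialExtension.add {F G : Phase n →ᵇ ℂ} {f g : C(Sph n, ℂ)}
    (hF : IsRadialExtension F f) (hG : IsRadialExtension G g) :
    IsRadialExtension (F + G) (f + g) := by
  obtain ⟨r, hr⟩ := hF
  obtain ⟨r', hr'⟩ := hG
  refine ⟨max r r', fun t ht s => ?_⟩
  rw [BoundedContinuousFunction.add_apply, hr t ((le_max_left _ _).trans ht),
    hr' t ((le_max_right _ _).trans ht)]
  rfl

theorem IsRadialExtension.mul {F G : Phase n →ᵇ ℂ} {f g : C(Sph n, ℂ)}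
    (hF : IsRadialExtension F f) (hG : IsRadialExtension G g) :
    IsRadialExtension (F * G) (f * g) := by
  obtain ⟨r, hr⟩ := hF
  obtain ⟨r', hr'⟩ := hG
  refine ⟨max r r', fun t ht s => ?_⟩
  rw [BoundedContinuousFunction.mul_apply, hr t ((le_max_left _ _).trans ht),
    hr' t ((le_max_right _ _).trans ht)]
  rfl

theorem IsRadialExtension.star {F : Phase n →ᵇ ℂ} {f : C(Sph n, ℂ)}
    (hF : IsRadialExtension F f) : IsRadialExtension (star F) (star f) := by
  obtain ⟨r, hr⟩ := hF
  refine ⟨r, fun t ht s => ?_⟩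
  rw [BoundedContinuousFunction.star_apply, hr t ht]
  rfl

theorem isRadialExtension_algebraMap (c : ℂ) :
    IsRadialExtension (c • (1 : Phase n →ᵇ ℂ)) (algebraMap ℂ C(Sph n, ℂ) c) :=
  ⟨0, fun t _ s => by simp⟩

theorem IsRadialExtension.comp_act {F : Phase n →ᵇ ℂ} {f : C(Sph n, ℂ)}
    (hF : IsRadialExtension F f) (g : U n) :
    IsRadialExtension (F.compContinuous ⟨act n g⁻¹, (act n g⁻¹).continuous⟩)
      (sphAction n g f) := by
  obtain ⟨r, hr⟩ := hF
  refine ⟨r, fun t ht s => ?_⟩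
  change F (act n g⁻¹ ((t : ℂ) • (s : Phase n))) = f (sphAct g⁻¹ s)
  rw [map_smul]
  exact hr t ht (sphAct g⁻¹ s)

theorem hasCompactSupport_sub_of_isRadialExtension {F F' : Phase n →ᵇ ℂ} {f : C(Sph n, ℂ)}
    (h : IsRadialExtension F f) (h' : IsRadialExtension F' f) : HasCompactSupport (F - F') := by
  obtain ⟨r, hr⟩ := h
  obtain ⟨r', hr'⟩ := h'
  refine HasCompactSupport.intro (isCompact_closedBall (0 : Phase n) (max 0 (max r r')))
    fun z hz => ?_
  rw [mem_closedBall_zero_iff, not_le, max_lt_iff, max_lt_iff] at hz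
  have hz0 : (‖z‖ : ℂ) ≠ 0 := by exact_mod_cast hz.1.ne'
  let s : Sph n := ⟨(‖z‖ : ℂ)⁻¹ • z, by
    rw [mem_sphere_zero_iff_norm, norm_smul, norm_inv, Complex.norm_real, norm_norm,
      inv_mul_cancel₀ hz.1.ne']⟩
  have e : z = (‖z‖ : ℂ) • (s : Phase n) := by rw [smul_inv_smul₀ hz0]
  rw [e, BoundedContinuousFunction.sub_apply, hr _ hz.2.1.le, hr' _ hz.2.2.le, sub_self]

/-- The class of an anti-Wick operator in the Calkin algebra depends only on the behaviour of its
symbol at infinity. -/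
theorem mk_antiWick_eq {F F' : Phase n →ᵇ ℂ} {f : C(Sph n, ℂ)}
    (h : IsRadialExtension F f) (h' : IsRadialExtension F' f) :
    Calkin.mk (antiWick F) = Calkin.mk (antiWick F') := by
  refine Calkin.mk_eq_of_isCompactOperator_sub ?_
  rw [← antiWick_sub]
  exact isCompactOperator_antiWick_of_hasCompactSupport
    (hasCompactSupport_sub_of_isRadialExtension h h')

/-- The dilation `z ↦ F(z / R)`. -/
def dilate (R : ℝ) (F : Phase n →ᵇ ℂ) : Phase n →ᵇ ℂ :=
  F.compContinuous ⟨fun z => R⁻¹ • z, by fun_prop⟩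

theorem IsRadialExtension.dilate {F : Phase n →ᵇ ℂ} {f : C(Sph n, ℂ)} (h : IsRadialExtension F f)
    {R : ℝ} (hR : 0 < R) : IsRadialExtension (dilate R F) f := by
  obtain ⟨r, hr⟩ := h
  refine ⟨R * r, fun t ht s => ?_⟩
  change F (R⁻¹ • ((t : ℂ) • (s : Phase n))) = f s
  rw [← Complex.coe_smul, smul_smul, ← ofReal_mul]
  refine hr _ ?_ s
  rwa [inv_mul_eq_div, le_div_iff₀ hR, mul_comm]

/-- Dilations of a uniformly continuous function vary slowly. -/
theorem exists_norm_dilate_sub_le {F : Phase n →ᵇ ℂ} (hF : UniformContinuous F) {ε : ℝ}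
    (hε : 0 < ε) : ∃ R : ℝ, 0 < R ∧ ∀ x y, ‖dilate R F x - dilate R F y‖ ≤ ε * (1 + ‖x - y‖) := by
  obtain ⟨δ, hδ, h⟩ := Metric.uniformContinuous_iff.1 hF ε hε
  refine ⟨2 * ‖F‖ / (ε * δ) + 1, by positivity, fun x y => ?_⟩
  set R := 2 * ‖F‖ / (ε * δ) + 1 with hR
  have hR0 : 0 < R := by positivity
  have hd : dist (R⁻¹ • x) (R⁻¹ • y) = R⁻¹ * ‖x - y‖ := by
    rw [dist_eq_norm, ← smul_sub, norm_smul, norm_inv, Real.norm_of_nonneg hR0.le]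
  rcases lt_or_ge (R⁻¹ * ‖x - y‖) δ with hlt | hge
  · have h1 := h (hd.trans_lt hlt)
    rw [dist_eq_norm] at h1
    refine h1.le.trans (le_mul_of_one_le_right hε.le ?_)
    linarith [norm_nonneg (x - y)]
  · rw [inv_mul_eq_div, le_div_iff₀ hR0] at hge
    have h2 : 2 * ‖F‖ ≤ ε * (δ * R) := by
      have : ε * (δ * R) = 2 * ‖F‖ + ε * δ := by rw [hR]; field_simp
      rw [this]
      linarith [mul_pos hε hδ]
    calc ‖dilate R F x - dilate R F y‖ = dist (F (R⁻¹ • x)) (F (R⁻¹ • y)) := (dist_eq_norm _ _).symm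
      _ ≤ 2 * ‖F‖ := F.dist_le_two_norm _ _
      _ ≤ ε * (δ * R) := h2
      _ ≤ ε * ‖x - y‖ := by gcongr
      _ ≤ ε * (1 + ‖x - y‖) := by gcongr; linarith

/-- Anti-Wick quantization is multiplicative modulo compact operators on symbols with continuous
boundary values on the sphere at infinity: the product defect of slowly varying symbols is small in
norm, and dilating a symbol does not change its class. -/
theorem mk_antiWick_mul {F G : Phase n →ᵇ ℂ} {f g : C(Sph n, ℂ)} (hF : IsRadialExtension F f)
    (hG : IsRadialExtension G g) (hGu : UniformContinuous G) :
    Calkin.mk (antiWick (F * G)) = Calkin.mk (antiWick F) * Calkin.mk (antiWick G) := by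
  rw [eq_comm, ← sub_eq_zero, ← norm_le_zero_iff]
  refine le_of_forall_pos_le_add fun ε hε => ?_
  set c := ‖F‖ * |defectConst n| + 1 with hc
  have hc0 : 0 < c := by positivity
  obtain ⟨R, hR, hRG⟩ := exists_norm_dilate_sub_le hGu (div_pos hε hc0)
  have h := norm_antiWick_mul_sub_le F (dilate R G) (div_pos hε hc0).le hRG
  rw [mk_antiWick_eq hG (hG.dilate hR), mk_antiWick_eq (hF.mul hG) (hF.mul (hG.dilate hR)),
    ← map_mul, ← map_sub]
  refine (Calkin.norm_mk_le _).trans (h.trans ?_)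
  calc ‖F‖ * (ε / c) * defectConst n = ε / c * (‖F‖ * defectConst n) := by ring
    _ ≤ ε / c * c := by
        gcongr
        rw [hc]
        have := mul_le_mul_of_nonneg_left (le_abs_self (defectConst n)) (norm_nonneg F)
        linarith
    _ = 0 + ε := by field_simp; simp

variable (n) in
/-- The homomorphism from functions on the sphere to the Calkin algebra of `L²(ℝⁿ)` that sends `f`
to the class of the anti-Wick operator of any radial extension of `f`. -/
def symbolHom : C(Sph n, ℂ) →⋆ₐ[ℂ] Calkin (L2 n) where
  toFun f := Calkin.mk (antiWick (exists_isRadialExtension f).choose)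
  map_one' := by
    have h := isRadialExtension_algebraMap (n := n) 1
    rw [map_one, one_smul] at h
    rw [mk_antiWick_eq (exists_isRadialExtension _).choose_spec.1 h, antiWick_one, map_one]
  map_mul' f g := by
    rw [← mk_antiWick_mul (exists_isRadialExtension f).choose_spec.1
      (exists_isRadialExtension g).choose_spec.1 (exists_isRadialExtension g).choose_spec.2]
    exact mk_antiWick_eq (exists_isRadialExtension _).choose_spec.1
      ((exists_isRadialExtension f).choose_spec.1.mul (exists_isRadialExtension g).choose_spec.1)
  map_zero' := by
    have h := isRadialExtension_algebraMap (n := n) 0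
    rw [map_zero] at h
    rw [mk_antiWick_eq (exists_isRadialExtension _).choose_spec.1 h, antiWick_smul, zero_smul,
      map_zero]
  map_add' f g := by
    rw [← map_add, ← antiWick_add]
    exact mk_antiWick_eq (exists_isRadialExtension _).choose_spec.1
      ((exists_isRadialExtension f).choose_spec.1.add (exists_isRadialExtension g).choose_spec.1)
  commutes' c := by
    rw [mk_antiWick_eq (exists_isRadialExtension _).choose_spec.1 (isRadialExtension_algebraMap c),
      antiWick_smul, antiWick_one, map_smul, map_one, Algebra.algebraMap_eq_smul_one]
  map_star' f := by
    rw [Calkin.star_mk, ← antiWick_star]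
    exact mk_antiWick_eq (exists_isRadialExtension _).choose_spec.1
      (exists_isRadialExtension f).choose_spec.1.star

theorem symbolHom_eq {F : Phase n →ᵇ ℂ} {f : C(Sph n, ℂ)} (h : IsRadialExtension F f) :
    symbolHom n f = Calkin.mk (antiWick F) :=
  mk_antiWick_eq (exists_isRadialExtension f).choose_spec.1 h

/-- Modulo compact operators, a pseudodifferential operator of order zero is determined by its
principal symbol. -/
theorem HasPrincipalSymbol.mk_eq {T : L2 n →L[ℂ] L2 n} {f : C(Sph n, ℂ)}
    (h : HasPrincipalSymbol T f) : Calkin.mk T = symbolHom n f := by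
  obtain ⟨d, a, ⟨hd, ha, hda⟩, hT, hf⟩ := h
  have ha0 := (ha 0).1
  have hah := (ha 0).2
  have hd1 := hda 1
  simp only [Nat.cast_zero, sub_zero] at ha0 hah
  simp only [Finset.range_one, Finset.sum_singleton] at hd1
  have hext : IsRadialExtension ha0.toBCF f := by
    refine ⟨1, fun t ht s => ?_⟩
    rw [IsShubinSymbol.toBCF_apply, hah s (mem_sphere_zero_iff_norm.1 s.2).ge t ht, hf,
      Real.rpow_zero, ofReal_one, one_mul]
  rw [symbolHom_eq hext]
  exact Calkin.mk_eq_of_isCompactOperator_sub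
    (isCompactOperator_weyl_sub_antiWick hd ha0 (by norm_num) hd1 hT)

variable (n) in
/-- The unitaries of the Calkin algebra represented by the metaplectic operators `R_g`. -/
def calkinUnitary : U n →* unitary (Calkin (L2 n)) where
  toFun g := ⟨Calkin.mk (R n g : L2 n →L[ℂ] L2 n), by
    rw [Unitary.mem_iff, Calkin.star_mk, ← map_mul, ← map_mul,
      Unitary.star_mul_self_of_mem (R n g).2, Unitary.mul_star_self_of_mem (R n g).2, map_one]
    exact ⟨rfl, rfl⟩⟩
  map_one' := Subtype.ext (by simp)
  map_mul' g h := Subtype.ext (by simp)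

theorem isCovariant_symbolHom (G : Subgroup (U n)) :
    IsCovariant ((sphAction n).comp G.subtype) (symbolHom n)
      ((calkinUnitary n).comp G.subtype) := by
  intro g f
  obtain ⟨F, hF, -⟩ := exists_isRadialExtension f
  have h := conj_antiWick (g : U n) F
    (F.compContinuous ⟨act n (g : U n)⁻¹, (act n (g : U n)⁻¹).continuous⟩) fun z => by
    change F (act n (g : U n)⁻¹ (act n g z)) = F z
    rw [act_inv_act]
  have e : symbolHom n (((sphAction n).comp G.subtype) g f) = _ :=
    symbolHom_eq (hF.comp_act (g : U n))
  rw [e, ← h, symbolHom_eq hF, map_mul, map_mul, ← Calkin.star_mk]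
  rfl

end Radial

/-! ### The symbol homomorphism of crossed products and ellipticity -/

theorem continuous_starAlgHom {A B : Type*} [CStarAlgebra A] [CStarAlgebra B]
    (φ : A →⋆ₐ[ℂ] B) : Continuous φ :=
  AddMonoidHomClass.continuous_of_bound φ 1 fun a => by
    rw [one_mul]
    exact NonUnitalStarAlgHom.norm_apply_le φ a

/-- Two homomorphisms which agree on the generating pairs of a closed `*`-subalgebra of a product
agree on all its pairs. -/
theorem apply_eq_of_mem_topologicalClosure_adjoin {A B C : Type*} [CStarAlgebra A]
    [CStarAlgebra B] [CStarAlgebra C] (φ : A →⋆ₐ[ℂ] C) (ψ : B →⋆ₐ[ℂ] C) {S : Set (A × B)}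
    (hS : ∀ q ∈ S, φ q.1 = ψ q.2) {q : A × B}
    (hq : q ∈ (StarAlgebra.adjoin ℂ S).topologicalClosure) : φ q.1 = ψ q.2 := by
  have hφ : Continuous fun q : A × B => φ q.1 := (continuous_starAlgHom φ).comp continuous_fst
  have hψ : Continuous fun q : A × B => ψ q.2 := (continuous_starAlgHom ψ).comp continuous_snd
  have hle : (StarAlgebra.adjoin ℂ S).topologicalClosure ≤
      StarAlgHom.equalizer (φ.comp (StarAlgHom.fst ℂ A B)) (ψ.comp (StarAlgHom.snd ℂ A B)) :=
    StarSubalgebra.topologicalClosure_minimal (StarAlgebra.adjoin_le hS)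
      (isClosed_eq hφ hψ)
  exact hle hq

/-- Homomorphisms which agree on the universal covariant pair agree on the crossed product. -/
theorem apply_eq_of_mem_crossedSub {A : Type} [CStarAlgebra A] {G : Type} [Group G]
    {α : G →* (A →⋆ₐ[ℂ] A)} {C : Type*} [CStarAlgebra C] (φ ψ : CovProd α →⋆ₐ[ℂ] C)
    (h₁ : ∀ a, φ (univPi α a) = ψ (univPi α a))
    (h₂ : ∀ g, φ (univU α g : CovProd α) = ψ (univU α g : CovProd α))
    {x : CovProd α} (hx : x ∈ crossedSub α) : φ x = ψ x := by
  have hle : crossedSub α ≤ StarAlgHom.equalizer φ ψ := by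
    refine StarSubalgebra.topologicalClosure_minimal (StarAlgebra.adjoin_le ?_)
      (isClosed_eq (continuous_starAlgHom φ) (continuous_starAlgHom ψ))
    rintro _ (⟨c, rfl⟩ | ⟨g, rfl⟩)
    · exact h₁ c
    · exact h₂ g
  exact hle hx

section Elliptic

variable {n : ℕ} {G : Subgroup (U n)}

theorem mk_eq_symbolHom_of_mem_symbolGraph {t : Psi n × C(Sph n, ℂ)} (ht : t ∈ symbolGraph n) :
    Calkin.mk (t.1 : L2 n →L[ℂ] L2 n) = symbolHom n t.2 :=
  apply_eq_of_mem_topologicalClosure_adjoin (Calkin.mkStar.comp (Psi n).subtype) (symbolHom n)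
    (fun _ hq => HasPrincipalSymbol.mk_eq hq) ht

variable [Nontrivial (Calkin (L2 n))]

variable (G) in
/-- The covariant pair in the Calkin algebra formed by `symbolHom` and the classes of the
operators `R_g`. -/
def calkinPair : CovPair ((sphAction n).comp G.subtype) where
  carrier := Calkin (L2 n)
  hom := symbolHom n
  u := (calkinUnitary n).comp G.subtype
  covariant := isCovariant_symbolHom G

variable (G) in
/-- The homomorphism `C(S^{2n-1}) ⋊ G → B(L²)/K(L²)` through which the class of a `G`-operator
modulo compact operators is determined by its symbol. -/
def calkinRep : SymbG G →⋆ₐ[ℂ] Calkin (L2 n) := Crossed.lift _ (calkinPair G)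

theorem mk_natRep_of_mem_crossedSymbolGraph {q : PsiG G × SymbG G}
    (hq : q ∈ crossedSymbolGraph G) : Calkin.mk (natRep G q.1) = calkinRep G q.2 := by
  refine apply_eq_of_mem_topologicalClosure_adjoin (Calkin.mkStar.comp (natRep G)) (calkinRep G)
    ?_ hq
  rintro _ (⟨t, ht, rfl⟩ | ⟨g, rfl⟩)
  · exact mk_eq_symbolHom_of_mem_symbolGraph ht
  · rfl

variable (G) in
/-- The homomorphism `∑ c_g u_g ↦ ∑ c_g [R_g]` to the Calkin algebra, defined by way of `B(L²)`. -/
def natScalars : CovProd (1 : G →* (ℂ →⋆ₐ[ℂ] ℂ)) →⋆ₐ[ℂ] Calkin (L2 n) :=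
  Calkin.mkStar.comp (CovPair.compScalars _ (naturalPair G) : _ →⋆ₐ[ℂ] (L2 n →L[ℂ] L2 n))

variable (G) in
/-- The homomorphism `∑ c_g u_g ↦ ∑ c_g [R_g]` to the Calkin algebra, defined by way of the
covariant pair `calkinPair`. -/
def calkinScalars : CovProd (1 : G →* (ℂ →⋆ₐ[ℂ] ℂ)) →⋆ₐ[ℂ] Calkin (L2 n) :=
  CovPair.compScalars _ (calkinPair G)

/-- On `C*(G)` the class modulo compact operators of the natural representation is given by
`calkinRep`. -/
theorem mk_natRep_incl (x : GroupCStar G) :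
    Calkin.mk (natRep G (GroupCStar.incl _ x)) = calkinRep G (GroupCStar.incl _ x) := by
  exact apply_eq_of_mem_crossedSub (natScalars G) (calkinScalars G)
    (fun c => (AlgHomClass.commutes (Calkin.mkStar (H := L2 n)) c).trans rfl) (fun g => rfl)
    (Crossed.val_mem _ x)

end Elliptic

section Matrices

variable {n N : ℕ}

variable (n) in
/-- The embedding of `L²(ℝⁿ)` as the `i`-th summand of `L²(ℝⁿ, ℂ^N)`. -/
def summand (i : Fin N) : L2 n →L[ℂ] L2N n N :=
  ((PiLp.continuousLinearEquiv 2 ℂ fun _ : Fin N => L2 n).symm : _ →L[ℂ] L2N n N).comp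
    (ContinuousLinearMap.single ℂ (fun _ : Fin N => L2 n) i)

theorem summand_apply (i k : Fin N) (u : L2 n) : summand n i u k = if k = i then u else 0 := by
  rcases eq_or_ne k i with rfl | h
  · simp [summand]
  · simp [summand, h]

/-- Matrices of operators that agree entrywise modulo compact operators define operators on
`L²(ℝⁿ, ℂ^N)` that agree modulo compact operators. -/
theorem isCompactOperator_matOp_sub {S T : Matrix (Fin N) (Fin N) (L2 n →L[ℂ] L2 n)}
    (h : S.map Calkin.mk = T.map Calkin.mk) : IsCompactOperator (matOp S - matOp T) := by
  have hc : ∀ i j, IsCompactOperator (S i j - T i j) := fun i j =>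
    Calkin.isCompactOperator_sub_of_mk_eq (congrFun (congrFun h i) j)
  have e : matOp S - matOp T = ∑ i, ∑ j,
      summand n i ∘L (S i j - T i j) ∘L PiLp.proj 2 (fun _ : Fin N => L2 n) j := by
    ext f k : 2
    rw [sub_apply, PiLp.sub_apply, matOp_apply, matOp_apply, ← Finset.sum_sub_distrib]
    simp only [sum_apply, WithLp.ofLp_sum, Finset.sum_apply, ContinuousLinearMap.comp_apply,
      summand_apply]
    rw [Finset.sum_comm]
    simp
  rw [e]
  refine (compactIdeal (L2N n N)).sum_mem fun i _ => (compactIdeal (L2N n N)).sum_mem fun j _ => ?_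
  exact ((hc i j).comp_clm (PiLp.proj 2 (fun _ : Fin N => L2 n) j)).clm_comp (summand n i)

theorem matrix_map_mul_mul {A B F : Type*} [Semiring A] [Semiring B] [FunLike F A B]
    [RingHomClass F A B] (φ : F) (M₁ M₂ M₃ : Matrix (Fin N) (Fin N) A) :
    (M₁ * M₂ * M₃).map φ = M₁.map φ * M₂.map φ * M₃.map φ := by
  rw [Matrix.map_mul, Matrix.map_mul]

variable {G : Subgroup (U n)}

/-- An elliptic triple has a parametrix: a matrix of operators `B` with `P₁ B D = P₁` and
`D B P₂ = P₂` modulo compact operators. -/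
theorem Triple.IsElliptic.exists_parametrix {𝒟 : Triple G N} (h : 𝒟.IsElliptic) :
    ∃ B : Matrix (Fin N) (Fin N) (L2 n →L[ℂ] L2 n),
      ((toPsiG G 𝒟.P₁).map (natRep G) * B * 𝒟.D.map (natRep G)).map Calkin.mk =
        ((toPsiG G 𝒟.P₁).map (natRep G)).map Calkin.mk ∧
      (𝒟.D.map (natRep G) * B * (toPsiG G 𝒟.P₂).map (natRep G)).map Calkin.mk =
        ((toPsiG G 𝒟.P₂).map (natRep G)).map Calkin.mk := by
  rcases subsingleton_or_nontrivial (Calkin (L2 n)) with hQ | hQ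
  -- Covariant pairs live in nonzero algebras; if the Calkin algebra is zero, as it is for `n = 0`,
  -- every operator is compact.
  · exact ⟨0, Subsingleton.elim _ _, Subsingleton.elim _ _⟩
  obtain ⟨s, r, hs, h₁, h₂⟩ := h
  choose B hB using fun i j => Calkin.mk_surjective (calkinRep G (r i j))
  have hBr : (Matrix.of B).map Calkin.mk = r.map (calkinRep G) :=
    Matrix.ext fun i j => hB i j
  have hD : (𝒟.D.map (natRep G)).map Calkin.mk = s.map (calkinRep G) :=
    Matrix.ext fun i j => mk_natRep_of_mem_crossedSymbolGraph (hs i j)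
  have hP : ∀ P : Matrix (Fin N) (Fin N) (GroupCStar G),
      ((toPsiG G P).map (natRep G)).map Calkin.mk = (toSymbG G P).map (calkinRep G) :=
    fun P => Matrix.ext fun i j => mk_natRep_incl (P i j)
  refine ⟨Matrix.of B, ?_, ?_⟩
  · exact (matrix_map_mul_mul Calkin.mk _ _ _).trans <|
      (congrArg₂ (· * ·) (congrArg₂ (· * ·) (hP 𝒟.P₁) hBr) hD).trans <|
      (matrix_map_mul_mul (calkinRep G) _ _ _).symm.trans <|
      (congrArg (fun M : Matrix (Fin N) (Fin N) (SymbG G) => M.map (calkinRep G)) h₁).trans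
      (hP 𝒟.P₁).symm
  · exact (matrix_map_mul_mul Calkin.mk _ _ _).trans <|
      (congrArg₂ (· * ·) (congrArg₂ (· * ·) hD hBr) (hP 𝒟.P₂)).trans <|
      (matrix_map_mul_mul (calkinRep G) _ _ _).symm.trans <|
      (congrArg (fun M : Matrix (Fin N) (Fin N) (SymbG G) => M.map (calkinRep G)) h₂).trans
      (hP 𝒟.P₂).symm

theorem groupOp_mul_self {P : Matrix (Fin N) (Fin N) (GroupCStar G)} (h : P * P = P) :
    groupOp P * groupOp P = groupOp P :=
  (quantize_mul G _ _).symm.trans (congrArg (quantize G) ((Matrix.map_mul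
    (f := GroupCStar.incl ((psiAction n).comp G.subtype))).symm.trans (congrArg (toPsiG G) h)))

end Matrices

end GOperators

end


theorem mainTheorem5 (n N : ℕ) (G : Subgroup (GOperators.U n)) (𝒟 : GOperators.Triple G N)
    (h : 𝒟.IsElliptic) : 𝒟.operator.IsFredholm := by
  obtain ⟨B, hl, hr⟩ := h.exists_parametrix
  have hl' := GOperators.isCompactOperator_matOp_sub hl
  have hr' := GOperators.isCompactOperator_matOp_sub hr
  rw [GOperators.matOp_mul, GOperators.matOp_mul] at hl' hr'
  have hD : GOperators.quantize G 𝒟.D =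
      GOperators.groupOp 𝒟.P₂ * GOperators.quantize G 𝒟.D * GOperators.groupOp 𝒟.P₁ := by
    conv_lhs => rw [show 𝒟.D = _ from 𝒟.compat]
    rw [GOperators.quantize_mul, GOperators.quantize_mul]
    rfl
  exact GOperators.isFredholm_codRestrict_range
    (GOperators.groupOp_mul_self 𝒟.proj₁.isIdempotentElem)
    (GOperators.groupOp_mul_self 𝒟.proj₂.isIdempotentElem) hD hl' hr' fun f => 𝒟.mapsTo f
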